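/- **Conventions.** Let $I=(0,1]$. For nets $(u_\varepsilon)_{\varepsilon\in I}$ of smooth functions, $\mathcal G(\mathbb R^m)$ is the quotient of the nets with $\forall K$ compact $\forall\alpha\,\exists p:\ \sup_K|\partial^\alpha u_\varepsilon|=O(\varepsilon^{-p})$ modulo those with $\forall K,\alpha,q:\ \sup_K|\partial^\alpha u_\varepsilon|=O(\varepsilon^{q})$. $\mathcal G_\tau(\mathbb R^m)$ is the quotient of the nets in $\mathcal O_M(\mathbb R^m)$ with $\forall\alpha\,\exists p:\ \sup_x(1+|x|)^{-p}|\partial^\alpha u_\varepsilon(x)|=O(\varepsilon^{-p})$ modulo those with $\forall\alpha\,\exists p\,\forall q:\ \sup_x(1+|x|)^{-p}|\partial^\alpha u_\varepsilon(x)|=O(\varepsilon^{q})$. $\widetilde{\mathcal G}_\tau(\mathbb R^k\times\mathbb R^m)$ is the mixed algebra: each $u_\varepsilon$ is smooth with every derivative polynomially bounded in the second variable, uniformly for the first variable in compact sets, and the $\mathcal G_\tau$-type estimates hold in the second variable, uniformly for the first variable in compact sets. $\mathcal R$ denotes the generalized numbers (moderate nets of reals modulo negligible ones), $\mathcal R^m$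 the generalized points of $\mathbb R^m$, and $\mathcal R_c\subset\mathcal R$ the compactly supported generalized numbers. Composition, point values and derivatives are taken componentwise in $\varepsilon$. A *generalized group action* on $\mathbb R^m$ is $\Phi\in\widetilde{\mathcal G}_\tau(\mathbb R\times\mathbb R^m)^m$ with $\Phi(0,\cdot)=\mathrm{id}$ in $\mathcal G_\tau(\mathbb R^m)^m$ and $\Phi(\eta_1+\eta_2,\cdot)=\Phi(\eta_1,\Phi(\eta_2,\cdot))$ in $\widetilde{\mathcal G}_\tau(\mathbb R^2\times\mathbb R^m)^m$. Put $\xi:=\frac{d}{d\eta}\big|_0\Phi(\eta,\cdot)\in\mathcal G_\tau(\mathbb R^m)^m$. $\Phi$ is *$\mathcal G$-complete*, with infinitesimal generator $X=\sum\xi_i\partial_i$, if for all $t_0\in\mathbb R$ and $\tilde x_0\in\mathcal R^m$ the problem $\dot x=\xi(x)$, $x(t_0)=\tilde x_0$ has exactly one solution in $\mathcal G(\mathbb R)^m$. On $\mathbb R^p\times\mathbb R^q$, $\Phi$ is *projectable* if $\Phi(\eta,(x,u))=(\Xi_\eta(x),\Psi_\eta(x,u))$ with $\Xi\in\widetilde{\mathcal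 G}_\tau(\mathbb R\times\mathbb R^p)^p$ and $\Psi\in\widetilde{\mathcal G}_\tau(\mathbb R\times\mathbb R^{p+q})^q$; it acts on $U\in\mathcal G_\tau(\mathbb R^p)^q$ by $\Phi_\eta(U)(x)=\Psi_\eta(\Xi_{-\eta}(x),U(\Xi_{-\eta}(x)))$, for $\eta\in\mathcal R_c$. Let $(\mathbb R^p\times\mathbb R^q)^{(n)}\cong\mathbb R^N$ be the $n$-jet space, with coordinates $x_i$ and $u^\alpha_J$, $|J|\le n$. The prolongation is $\mathrm{pr}^{(n)}\Phi(\eta,z)=(\Xi_\eta(x),\mathrm{pr}^{(n)}(\Phi_\eta(h_z))(\Xi_\eta(x)))$, where $x$ is the base point of $z$ and $h_z$ is the Taylor polynomial at $x$ of degree at most $n$ with $n$-jet $z$. $\Phi$ is *$\mathcal G$-$n$-complete* if $\Phi$ and $\mathrm{pr}^{(n)}\Phi$ are $\mathcal G$-complete; $\mathrm{pr}^{(n)}X$ denotes the generator of $\mathrm{pr}^{(n)}\Phi$. **Theorem 4.16.** Let $\Phi=(\Xi,\Psi)$ be a $\mathcal G$-$n$-complete projectable generalized group action on $\mathbb R^p\times\mathbb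 R^q$ with infinitesimal generator $X$, and let $\Delta\in\mathcal G_\tau((\mathbb R^p\times\mathbb R^q)^{(n)})^l$. Suppose that $\Delta$ is of the form $$\Delta_\nu(z)=z_{i_\nu}-f_\nu(z')\qquad(1\le\nu\le l)$$ with distinct indices $i_1,\dots,i_l$, where $z'\in\mathbb R^{N-l}$ consists of the remaining jet coordinates and $f\in\mathcal G_\tau(\mathbb R^{N-l})^l$. Let $\zeta$ be the coefficient vector of $\mathrm{pr}^{(n)}X$, let $\zeta'$ be its components with index not in $\{i_1,\dots,i_l\}$, and suppose that the system $\dot z'=\zeta'(z',f(z'))$ possesses a flow in $\widetilde{\mathcal G}_\tau(\mathbb R\times\mathbb R^{N-l})^{N-l}$, that is, some $h$ in this space satisfies $h(0,\cdot)=\mathrm{id}$ and $\partial_\eta h(\eta,a)=\zeta'(h(\eta,a),f(h(\eta,a)))$. (For $l=1$ this is the case of a single equation $z_i=f(z')$.) If $$\mathrm{pr}^{(n)}X(\Delta)(\tilde z)=0\quad\text{for all }\tilde z\in\mathcal R^N\text{ with }\Delta(\tilde z)=0,$$ then $\Phi$ is a symmetry group of $\Delta(x,U^{(n)})=0$ in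 $\mathcal G_\tau$: whenever $U\in\mathcal G_\tau(\mathbb R^p)^q$ satisfies $\Delta(x,\mathrm{pr}^{(n)}U(x))=0$ in $\mathcal G_\tau(\mathbb R^p)^l$ and $\eta\in\mathcal R_c$, the generalized function $\Phi_\eta(U)$ satisfies $\Delta(x,\mathrm{pr}^{(n)}(\Phi_\eta(U))(x))=0$ in $\mathcal G_\tau(\mathbb R^p)^l$. -/

import Mathlib

noncomputable section
namespace GenFun
open Filter Topology Set
open scoped ContDiff

/-- The index set `I = (0,1]` of the regularization parameter `ε`. -/
abbrev Idx : Type := Set.Ioc (0 : ℝ) 1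

/-- The filter `ε → 0` on `I`. -/
def small : Filter Idx := comap Subtype.val (𝓝 (0 : ℝ))

/-- A growth regime on `D`: the sets on which estimates are required to be uniform, and the weight
in which polynomial growth is allowed. -/
structure Regime (D : Type) where
  sets : Set (Set D)
  weight : D → ℝ
  weight_nonneg : ∀ x, 0 ≤ weight x

section regimes
variable (D A E : Type) [NormedAddCommGroup D] [NormedAddCommGroup A] [NormedAddCommGroup E]

/-- Estimates on compact sets: the regime of `𝒢(D)`. -/
def Regime.loc : Regime D where
  sets := {K | IsCompact K}
  weight := fun _ => 0
  weight_nonneg := fun _ => le_rfl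

/-- Global polynomial estimates: the regime of `𝒢_τ(D)`. -/
def Regime.temp : Regime D where
  sets := {univ}
  weight := fun x => ‖x‖
  weight_nonneg := fun x => norm_nonneg x

/-- Estimates on compact sets in the first variable, global polynomial estimates in the second
one: the regime of the mixed algebra `𝒢̃_τ(A × E)`. -/
def Regime.mix : Regime (A × E) where
  sets := {S | ∃ K : Set A, IsCompact K ∧ S = K ×ˢ (univ : Set E)}
  weight := fun z => ‖z.2‖
  weight_nonneg := fun z => norm_nonneg z.2

end regimes

section asymptotics
variable {D : Type}

/-- `b_ε(x) ≤ C ε^{-p} (1 + w(x))^p` on `K`, eventually along `l`, for some `p` and `C`. -/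
def BigM (γ : Regime D) (l : Filter Idx) (K : Set D) (b : Idx → D → ℝ) : Prop :=
  ∃ (p : ℕ) (C : ℝ), ∀ᶠ ε in l, ∀ x ∈ K,
    b ε x ≤ C * ((ε : ℝ)⁻¹) ^ p * (1 + γ.weight x) ^ p

/-- For some `p` and all `q`: `b_ε(x) ≤ C ε^q (1 + w(x))^p` on `K` for small `ε`, for some `C`. -/
def BigN (γ : Regime D) (K : Set D) (b : Idx → D → ℝ) : Prop :=
  ∃ p : ℕ, ∀ q : ℕ, ∃ C : ℝ, ∀ᶠ ε in small, ∀ x ∈ K,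
    b ε x ≤ C * (ε : ℝ) ^ q * (1 + γ.weight x) ^ p

theorem one_le_inv (ε : Idx) : 1 ≤ (ε : ℝ)⁻¹ := (one_le_inv₀ ε.2.1).2 ε.2.2

variable {γ : Regime D} {l : Filter Idx} {K : Set D} {b c : Idx → D → ℝ}

theorem one_le_wt (γ : Regime D) (x : D) : 1 ≤ 1 + γ.weight x := by
  linarith [γ.weight_nonneg x]

theorem BigM.pos (h : BigM γ l K b) : ∃ p0 : ℕ, ∃ C : ℝ, 0 ≤ C ∧ ∀ p, p0 ≤ p → ∀ᶠ ε in l, ∀ x ∈ K,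
    b ε x ≤ C * ((ε : ℝ)⁻¹) ^ p * (1 + γ.weight x) ^ p := by
  obtain ⟨p, C, h⟩ := h
  refine ⟨p, |C|, abs_nonneg _, fun p2 hp => ?_⟩
  filter_upwards [h] with ε h x hx
  refine (h x hx).trans ?_
  have h1 := one_le_inv ε
  have h2 := one_le_wt γ x
  have h3 := le_abs_self C
  gcongr

theorem BigM.mono_le (h : BigM γ l K c) (hbc : ∀ᶠ ε in l, ∀ x ∈ K, b ε x ≤ c ε x) :
    BigM γ l K b := by
  obtain ⟨p, C, h⟩ := h
  refine ⟨p, C, ?_⟩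
  filter_upwards [h, hbc] with ε h h2 x hx
  exact (h2 x hx).trans (h x hx)

theorem BigM.const (C : ℝ) : BigM γ l K (fun _ _ => C) :=
  ⟨0, C, by simp⟩

theorem BigM.weight : BigM γ l K (fun _ x => 1 + γ.weight x) := by
  refine ⟨1, 1, Eventually.of_forall fun ε x _ => ?_⟩
  have h1 := one_le_inv ε
  have h2 := one_le_wt γ x
  simp only [pow_one, one_mul]
  nlinarith

theorem BigM.add (h : BigM γ l K b) (h2 : BigM γ l K c) :
    BigM γ l K (fun ε x => b ε x + c ε x) := by
  obtain ⟨p, C, _, h⟩ := h.pos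
  obtain ⟨p2, C2, _, h2⟩ := h2.pos
  refine ⟨max p p2, C + C2, ?_⟩
  filter_upwards [h _ (le_max_left p p2), h2 _ (le_max_right p p2)] with ε h h2 x hx
  linarith [h x hx, h2 x hx]

theorem BigM.mul (h : BigM γ l K b) (h2 : BigM γ l K c)
    (hc : ∀ ε x, 0 ≤ c ε x) : BigM γ l K (fun ε x => b ε x * c ε x) := by
  obtain ⟨p, C, hC, h⟩ := h.pos
  obtain ⟨p2, C2, hC2, h2⟩ := h2.pos
  refine ⟨p + p2, C * C2, ?_⟩
  filter_upwards [h _ le_rfl, h2 _ le_rfl] with ε h h2 x hx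
  have h1 := one_le_inv ε
  have h3 := one_le_wt γ x
  calc b ε x * c ε x ≤ (C * ((ε : ℝ)⁻¹) ^ p * (1 + γ.weight x) ^ p) *
        (C2 * ((ε : ℝ)⁻¹) ^ p2 * (1 + γ.weight x) ^ p2) :=
        mul_le_mul (h x hx) (h2 x hx) (hc ε x) (by positivity)
    _ = _ := by ring

theorem BigM.pow (h : BigM γ l K b) (hb : ∀ ε x, 0 ≤ b ε x) (n : ℕ) :
    BigM γ l K (fun ε x => b ε x ^ n) := by
  induction n with
  | zero => simpa using BigM.const 1
  | succ n ih =>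
    simp only [pow_succ]
    exact ih.mul h hb

theorem BigM.sum {ι : Type} (s : Finset ι) (f : ι → Idx → D → ℝ)
    (h : ∀ i ∈ s, BigM γ l K (f i)) : BigM γ l K (fun ε x => ∑ i ∈ s, f i ε x) := by
  classical
  induction s using Finset.induction_on with
  | empty => simpa using BigM.const 0
  | insert i s hi ih =>
    simp only [Finset.sum_insert hi]
    exact (h i (by simp)).add (ih fun j hj => h j (by simp [hj]))

theorem BigN.pos (h : BigN γ K b) : ∃ p0 : ℕ, ∀ p, p0 ≤ p → ∀ q : ℕ, ∃ C : ℝ, 0 ≤ C ∧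
    ∀ᶠ ε in small, ∀ x ∈ K, b ε x ≤ C * (ε : ℝ) ^ q * (1 + γ.weight x) ^ p := by
  obtain ⟨p, h⟩ := h
  refine ⟨p, fun p2 hp q => ?_⟩
  obtain ⟨C, h⟩ := h q
  refine ⟨|C|, abs_nonneg _, ?_⟩
  filter_upwards [h] with ε h x hx
  refine (h x hx).trans ?_
  have h1 := ε.2.1
  have h2 := one_le_wt γ x
  have h3 := le_abs_self C
  gcongr

theorem BigN.mono_le (h : BigN γ K c) (hbc : ∀ᶠ ε in small, ∀ x ∈ K, b ε x ≤ c ε x) :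
    BigN γ K b := by
  obtain ⟨p, h⟩ := h
  refine ⟨p, fun q => ?_⟩
  obtain ⟨C, h⟩ := h q
  refine ⟨C, ?_⟩
  filter_upwards [h, hbc] with ε h h2 x hx
  exact (h2 x hx).trans (h x hx)

theorem BigN.zero : BigN γ K (fun _ _ => 0) := ⟨0, fun q => ⟨0, by simp⟩⟩

theorem BigN.add (h : BigN γ K b) (h2 : BigN γ K c) : BigN γ K (fun ε x => b ε x + c ε x) := by
  obtain ⟨p, h⟩ := h.pos
  obtain ⟨p2, h2⟩ := h2.pos
  refine ⟨max p p2, fun q => ?_⟩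
  obtain ⟨C, _, h⟩ := h _ (le_max_left p p2) q
  obtain ⟨C2, _, h2⟩ := h2 _ (le_max_right p p2) q
  refine ⟨C + C2, ?_⟩
  filter_upwards [h, h2] with ε h h2 x hx
  linarith [h x hx, h2 x hx]

theorem BigN.mul_bigM (h : BigN γ K b) (h2 : BigM γ small K c) (hc : ∀ ε x, 0 ≤ c ε x) :
    BigN γ K (fun ε x => b ε x * c ε x) := by
  obtain ⟨p, h⟩ := h.pos
  obtain ⟨p2, C2, hC2, h2⟩ := h2.pos
  refine ⟨p + p2, fun q => ?_⟩
  obtain ⟨C, hC, h⟩ := h p le_rfl (q + p2)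
  refine ⟨C * C2, ?_⟩
  filter_upwards [h, h2 _ le_rfl] with ε h h2 x hx
  have h0 := ε.2.1
  have h3 := one_le_wt γ x
  calc b ε x * c ε x ≤ (C * (ε : ℝ) ^ (q + p2) * (1 + γ.weight x) ^ p) *
        (C2 * ((ε : ℝ)⁻¹) ^ p2 * (1 + γ.weight x) ^ p2) :=
        mul_le_mul (h x hx) (h2 x hx) (hc ε x) (by positivity)
    _ = C * C2 * (ε : ℝ) ^ q * (1 + γ.weight x) ^ (p + p2) * ((ε : ℝ) * (ε : ℝ)⁻¹) ^ p2 := by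
        ring
    _ = _ := by rw [mul_inv_cancel₀ h0.ne']; simp

theorem BigN.sum {ι : Type} (s : Finset ι) (f : ι → Idx → D → ℝ)
    (h : ∀ i ∈ s, BigN γ K (f i)) : BigN γ K (fun ε x => ∑ i ∈ s, f i ε x) := by
  classical
  induction s using Finset.induction_on with
  | empty => simpa using BigN.zero
  | insert i s hi ih =>
    simp only [Finset.sum_insert hi]
    exact (h i (by simp)).add (ih fun j hj => h j (by simp [hj]))

end asymptotics

set_option linter.unusedSectionVars false

section nets
variable {D E F G : Type} [NormedAddCommGroup D] [NormedSpace ℝ D]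
  [NormedAddCommGroup E] [NormedSpace ℝ E] [NormedAddCommGroup F] [NormedSpace ℝ F]
  [NormedAddCommGroup G] [NormedSpace ℝ G]

/-- Smooth functions all of whose derivatives grow at most polynomially in the weight, uniformly on
the sets of the regime. For the tempered regime this is `𝒪_M`; for the regime of compact sets it
is just smoothness. -/
def Slow (γ : Regime D) (f : D → F) : Prop :=
  ContDiff ℝ ∞ f ∧ ∀ K ∈ γ.sets, ∀ k : ℕ, ∃ (p : ℕ) (C : ℝ), ∀ x ∈ K,
    ‖iteratedFDeriv ℝ k f x‖ ≤ C * (1 + γ.weight x) ^ p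

/-- Moderate nets: on each set `K` of the regime and for each order `k` there is `p` with
`sup_{x ∈ K} (1 + w(x))^{-p} |∂^k u_ε(x)| = O(ε^{-p})`. -/
def Moderate (γ : Regime D) (u : Idx → D → F) : Prop :=
  (∀ ε, Slow γ (u ε)) ∧
    ∀ K ∈ γ.sets, ∀ k : ℕ, BigM γ small K (fun ε x => ‖iteratedFDeriv ℝ k (u ε) x‖)

/-- Negligible nets: on each set `K` of the regime and for each order `k` there is `p` with
`sup_{x ∈ K} (1 + w(x))^{-p} |∂^k u_ε(x)| = O(ε^q)` for all `q`. -/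
def Negl (γ : Regime D) (u : Idx → D → F) : Prop :=
  (∀ ε, Slow γ (u ε)) ∧
    ∀ K ∈ γ.sets, ∀ k : ℕ, BigN γ K (fun ε x => ‖iteratedFDeriv ℝ k (u ε) x‖)

/-- Moderate estimates along an arbitrary filter of parameters. -/
def ModOn (γ : Regime D) (l : Filter Idx) (u : Idx → D → F) : Prop :=
  ∀ K ∈ γ.sets, ∀ k : ℕ, BigM γ l K (fun ε x => ‖iteratedFDeriv ℝ k (u ε) x‖)

/-- The filters along which a moderate net satisfies moderate estimates. -/
def Good (l : Filter Idx) : Prop := l = small ∨ ∃ ε, l = pure ε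

variable {γ : Regime D} {γ2 : Regime E} {u v : Idx → D → F}

theorem moderate_iff : Moderate γ u ↔
    (∀ ε, ContDiff ℝ ∞ (u ε)) ∧ ∀ l, Good l → ModOn γ l u := by
  constructor
  · rintro ⟨h1, h2⟩
    refine ⟨fun ε => (h1 ε).1, ?_⟩
    rintro l (rfl | ⟨ε, rfl⟩) K hK k
    · exact h2 K hK k
    · obtain ⟨p, C, h⟩ := (h1 ε).2 K hK k
      refine ⟨p, |C|, ?_⟩
      simp only [eventually_pure]
      intro x hx
      refine (h x hx).trans ?_
      have h1 := one_le_wt γ x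
      have h2 : (1 : ℝ) ≤ ((ε : ℝ)⁻¹) ^ p := one_le_pow₀ (one_le_inv ε)
      have h3 := le_abs_self C
      have h4 : C ≤ |C| * ((ε : ℝ)⁻¹) ^ p := by nlinarith [abs_nonneg C]
      gcongr
  · rintro ⟨h1, h2⟩
    refine ⟨fun ε => ⟨h1 ε, fun K hK k => ?_⟩, h2 small (Or.inl rfl)⟩
    obtain ⟨p, C, h⟩ := h2 (pure ε) (Or.inr ⟨ε, rfl⟩) K hK k
    simp only [eventually_pure] at h
    exact ⟨p, C * ((ε : ℝ)⁻¹) ^ p, h⟩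

theorem Moderate.smooth (h : Moderate γ u) (ε : Idx) : ContDiff ℝ ∞ (u ε) := (h.1 ε).1

theorem Negl.moderate (h : Negl γ u) : Moderate γ u := by
  refine ⟨h.1, fun K hK k => ?_⟩
  obtain ⟨p, h⟩ := (h.2 K hK k).pos
  obtain ⟨C, hC, h⟩ := h p le_rfl 0
  refine ⟨p, C, ?_⟩
  filter_upwards [h] with ε h x hx
  refine (h x hx).trans ?_
  have h1 := one_le_wt γ x
  have h2 : (1 : ℝ) ≤ ((ε : ℝ)⁻¹) ^ p := one_le_pow₀ (one_le_inv ε)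
  rw [pow_zero]
  gcongr

theorem lt_inf (k : ℕ) : (k : ℕ∞ω) ≤ ∞ := mod_cast le_top

theorem Moderate.add (hu : Moderate γ u) (hv : Moderate γ v) : Moderate γ (u + v) := by
  rw [moderate_iff]
  refine ⟨fun ε => (hu.smooth ε).add (hv.smooth ε), fun l hl K hK k => ?_⟩
  refine (((moderate_iff.1 hu).2 l hl K hK k).add ((moderate_iff.1 hv).2 l hl K hK k)).mono_le ?_
  refine Eventually.of_forall fun ε x _ => ?_
  rw [Pi.add_apply, iteratedFDeriv_add_apply ((hu.smooth ε).of_le (lt_inf k)).contDiffAt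
    ((hv.smooth ε).of_le (lt_inf k)).contDiffAt]
  exact norm_add_le _ _

theorem Moderate.neg (hu : Moderate γ u) : Moderate γ (-u) := by
  rw [moderate_iff] at hu ⊢
  refine ⟨fun ε => (hu.1 ε).neg, fun l hl K hK k => ?_⟩
  have h := hu.2 l hl K hK k
  simpa [iteratedFDeriv_neg_apply] using h

theorem Moderate.zero : Moderate γ (0 : Idx → D → F) := by
  rw [moderate_iff]
  refine ⟨fun ε => contDiff_const, fun l _ K _ k => ?_⟩
  have h := BigM.const (γ := γ) (l := l) (K := K) 0
  simpa using h

theorem Negl.add (hu : Negl γ u) (hv : Negl γ v) : Negl γ (u + v) := by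
  refine ⟨(hu.moderate.add hv.moderate).1, fun K hK k => ?_⟩
  refine ((hu.2 K hK k).add (hv.2 K hK k)).mono_le ?_
  refine Eventually.of_forall fun ε x _ => ?_
  rw [Pi.add_apply, iteratedFDeriv_add_apply ((hu.moderate.smooth ε).of_le (lt_inf k)).contDiffAt
    ((hv.moderate.smooth ε).of_le (lt_inf k)).contDiffAt]
  exact norm_add_le _ _

theorem Negl.neg (hu : Negl γ u) : Negl γ (-u) := by
  refine ⟨hu.moderate.neg.1, fun K hK k => ?_⟩
  have h := hu.2 K hK k
  simpa [iteratedFDeriv_neg_apply] using h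

theorem Negl.zero : Negl γ (0 : Idx → D → F) := by
  refine ⟨Moderate.zero.1, fun K _ k => ?_⟩
  have h := BigN.zero (γ := γ) (K := K)
  simpa using h

theorem Moderate.fderiv (hu : Moderate γ u) : Moderate γ (fun ε => fderiv ℝ (u ε)) := by
  rw [moderate_iff] at hu ⊢
  refine ⟨fun ε => (hu.1 ε).fderiv_right (by simp), fun l hl K hK k => ?_⟩
  simpa only [norm_iteratedFDeriv_fderiv] using hu.2 l hl K hK (k + 1)

theorem Negl.fderiv (hu : Negl γ u) : Negl γ (fun ε => fderiv ℝ (u ε)) := by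
  refine ⟨hu.moderate.fderiv.1, fun K hK k => ?_⟩
  simpa only [norm_iteratedFDeriv_fderiv] using hu.2 K hK (k + 1)

theorem Moderate.bilin (B : E →L[ℝ] F →L[ℝ] G) {f : Idx → D → E} {g : Idx → D → F}
    (hf : Moderate γ f) (hg : Moderate γ g) : Moderate γ (fun ε x => B (f ε x) (g ε x)) := by
  rw [moderate_iff]
  refine ⟨fun ε => B.isBoundedBilinearMap.contDiff.comp ((hf.smooth ε).prodMk (hg.smooth ε)),
    fun l hl K hK k => ?_⟩
  have h : BigM γ l K (fun ε x => ‖B‖ * ∑ i ∈ Finset.range (k + 1),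
      ((k.choose i : ℝ) * ‖iteratedFDeriv ℝ i (f ε) x‖ * ‖iteratedFDeriv ℝ (k - i) (g ε) x‖)) := by
    refine (BigM.const _).mul (BigM.sum _ (fun i ε x => _) fun i _ => ?_)
      (fun ε x => Finset.sum_nonneg fun i _ => by positivity)
    exact ((BigM.const _).mul ((moderate_iff.1 hf).2 l hl K hK i) (fun _ _ => norm_nonneg _)).mul
      ((moderate_iff.1 hg).2 l hl K hK (k - i)) (fun _ _ => norm_nonneg _)
  exact h.mono_le (Eventually.of_forall fun ε x _ =>
    B.norm_iteratedFDeriv_le_of_bilinear (hf.smooth ε) (hg.smooth ε) x (lt_inf k))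

/-- Leibniz estimate for a negligible factor on the left, up to a given order. -/
theorem bigN_bilin_left (B : E →L[ℝ] F →L[ℝ] G) {f : Idx → D → E} {g : Idx → D → F}
    (hf : ∀ ε, ContDiff ℝ ∞ (f ε)) (hg : Moderate γ g) {K : Set D} (hK : K ∈ γ.sets) (k : ℕ)
    (hN : ∀ i ≤ k, BigN γ K (fun ε x => ‖iteratedFDeriv ℝ i (f ε) x‖)) :
    BigN γ K (fun ε x => ‖iteratedFDeriv ℝ k (fun y => B (f ε y) (g ε y)) x‖) := by
  have h : BigN γ K (fun ε x => ∑ i ∈ Finset.range (k + 1),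
      (‖iteratedFDeriv ℝ i (f ε) x‖ * (‖B‖ * (k.choose i : ℝ) *
        ‖iteratedFDeriv ℝ (k - i) (g ε) x‖))) := by
    refine BigN.sum _ (fun i ε x => _) fun i hi => ?_
    exact (hN i (by simpa [Nat.lt_succ_iff] using hi)).mul_bigM
      ((BigM.const _).mul (hg.2 K hK (k - i)) (fun _ _ => norm_nonneg _))
      (fun _ _ => by positivity)
  refine h.mono_le (Eventually.of_forall fun ε x _ => ?_)
  refine (B.norm_iteratedFDeriv_le_of_bilinear (hf ε) (hg.smooth ε) x (lt_inf k)).trans ?_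
  rw [Finset.mul_sum]
  exact Finset.sum_le_sum fun i _ => le_of_eq (by ring)

theorem Negl.bilin_left (B : E →L[ℝ] F →L[ℝ] G) {f : Idx → D → E} {g : Idx → D → F}
    (hf : Negl γ f) (hg : Moderate γ g) : Negl γ (fun ε x => B (f ε x) (g ε x)) :=
  ⟨(hf.moderate.bilin B hg).1, fun K hK k =>
    bigN_bilin_left B hf.moderate.smooth hg hK k fun i _ => hf.2 K hK i⟩

theorem Negl.bilin_right (B : E →L[ℝ] F →L[ℝ] G) {f : Idx → D → E} {g : Idx → D → F}
    (hf : Moderate γ f) (hg : Negl γ g) : Negl γ (fun ε x => B (f ε x) (g ε x)) :=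
  Negl.bilin_left B.flip hg hf

theorem Moderate.clm (L : F →L[ℝ] G) (hu : Moderate γ u) : Moderate γ (fun ε x => L (u ε x)) := by
  rw [moderate_iff]
  refine ⟨fun ε => L.contDiff.comp (hu.smooth ε), fun l hl K hK k => ?_⟩
  refine ((BigM.const ‖L‖).mul ((moderate_iff.1 hu).2 l hl K hK k)
    (fun _ _ => norm_nonneg _)).mono_le (Eventually.of_forall fun ε x _ => ?_)
  exact L.norm_iteratedFDeriv_comp_left (hu.smooth ε).contDiffAt (lt_inf k)

theorem Negl.clm (L : F →L[ℝ] G) (hu : Negl γ u) : Negl γ (fun ε x => L (u ε x)) := by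
  refine ⟨(hu.moderate.clm L).1, fun K hK k => ?_⟩
  refine ((hu.2 K hK k).mul_bigM (BigM.const ‖L‖) (fun _ _ => norm_nonneg _)).mono_le
    (Eventually.of_forall fun ε x _ => ?_)
  rw [mul_comm]
  exact L.norm_iteratedFDeriv_comp_left (hu.moderate.smooth ε).contDiffAt (lt_inf k)

/-- The growth condition on inner maps `f, f'` under which `g ∘ f` and `g ∘ f'` are defined and
can be compared: the segments between their values stay in a set of the outer regime, with
moderate weight. -/
def Tame (γ : Regime D) (γ2 : Regime E) (f f' : Idx → D → E) : Prop :=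
  ∀ l, Good l → ∀ K ∈ γ.sets, ∃ K2 ∈ γ2.sets, ∃ b : Idx → D → ℝ, BigM γ l K b ∧
    ∀ᶠ ε in l, ∀ x ∈ K, ∀ y ∈ segment ℝ (f ε x) (f' ε x), y ∈ K2 ∧ 1 + γ2.weight y ≤ b ε x

theorem BigM.subst {f f' : Idx → D → E} (h : Tame γ γ2 f f') {l : Filter Idx}
    (hl : Good l) {K : Set D} (hK : K ∈ γ.sets) {c : Idx → E → ℝ}
    (hc : ∀ K2 ∈ γ2.sets, BigM γ2 l K2 c) :
    ∃ b : Idx → D → ℝ, BigM γ l K b ∧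
      ∀ᶠ ε in l, ∀ x ∈ K, ∀ y ∈ segment ℝ (f ε x) (f' ε x), c ε y ≤ b ε x := by
  obtain ⟨K2, hK2, b, hb, hy⟩ := h l hl K hK
  obtain ⟨p, C, hC, h2⟩ := (hc K2 hK2).pos
  refine ⟨fun ε x => (C * ((ε : ℝ)⁻¹) ^ p) * |b ε x| ^ p, ?_, ?_⟩
  · have h3 : BigM γ l K (fun ε _ => C * ((ε : ℝ)⁻¹) ^ p) := by
      refine ⟨p, C, Eventually.of_forall fun ε x _ => ?_⟩
      have h1 : (1 : ℝ) ≤ (1 + γ.weight x) ^ p := one_le_pow₀ (one_le_wt γ x)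
      have h2 : 0 ≤ C * ((ε : ℝ)⁻¹) ^ p := by have := one_le_inv ε; positivity
      nlinarith
    have h4 : BigM γ l K (fun ε x => |b ε x|) := by
      refine hb.mono_le ?_
      filter_upwards [hy] with ε hy x hx
      have := (hy x hx _ (left_mem_segment ℝ _ _)).2
      rw [abs_of_nonneg]
      linarith [one_le_wt γ2 (f ε x)]
    exact h3.mul (h4.pow (fun _ _ => abs_nonneg _) p) (fun _ _ => by positivity)
  · filter_upwards [hy, h2 p le_rfl] with ε hy h2 x hx y hyx
    obtain ⟨h5, h6⟩ := hy x hx y hyx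
    refine (h2 y h5).trans ?_
    have h7 := one_le_inv ε
    have h8 := one_le_wt γ2 y
    have h9 := h6.trans (le_abs_self _)
    gcongr

theorem Tame.left {f f' : Idx → D → E} (h : Tame γ γ2 f f') : Tame γ γ2 f f := by
  intro l hl K hK
  obtain ⟨K2, hK2, b, hb, hy⟩ := h l hl K hK
  refine ⟨K2, hK2, b, hb, ?_⟩
  filter_upwards [hy] with ε hy x hx y hyx
  rw [segment_same] at hyx
  rw [hyx]
  exact hy x hx _ (left_mem_segment ℝ _ _)

theorem Tame.right {f f' : Idx → D → E} (h : Tame γ γ2 f f') : Tame γ γ2 f' f' := by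
  intro l hl K hK
  obtain ⟨K2, hK2, b, hb, hy⟩ := h l hl K hK
  refine ⟨K2, hK2, b, hb, ?_⟩
  filter_upwards [hy] with ε hy x hx y hyx
  rw [segment_same] at hyx
  rw [hyx]
  exact hy x hx _ (right_mem_segment ℝ _ _)

theorem norm_comp_le {g : E → F} {f : D → E} (hg : ContDiff ℝ ∞ g) (hf : ContDiff ℝ ∞ f) (k : ℕ)
    (x : D) : ‖iteratedFDeriv ℝ k (fun y => g (f y)) x‖ ≤
      (∑ i ∈ Finset.range (k + 1), ‖iteratedFDeriv ℝ i g (f x)‖) *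
      (k.factorial * (1 + ∑ i ∈ Finset.range (k + 1), ‖iteratedFDeriv ℝ i f x‖) ^ k) := by
  refine (norm_iteratedFDeriv_comp_le hg hf (lt_inf k) x
    (C := ∑ i ∈ Finset.range (k + 1), ‖iteratedFDeriv ℝ i g (f x)‖)
    (D := 1 + ∑ i ∈ Finset.range (k + 1), ‖iteratedFDeriv ℝ i f x‖) (fun i hi => ?_)
    (fun i h1 hi => ?_)).trans (le_of_eq (by ring))
  · exact Finset.single_le_sum (f := fun i => ‖iteratedFDeriv ℝ i g (f x)‖)
      (fun _ _ => norm_nonneg _) (Finset.mem_range.2 (by omega))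
  · have h2 : ‖iteratedFDeriv ℝ i f x‖ ≤
        ∑ i ∈ Finset.range (k + 1), ‖iteratedFDeriv ℝ i f x‖ :=
      Finset.single_le_sum (f := fun i => ‖iteratedFDeriv ℝ i f x‖)
        (fun _ _ => norm_nonneg _) (Finset.mem_range.2 (by omega))
    have h3 : 0 ≤ ∑ i ∈ Finset.range (k + 1), ‖iteratedFDeriv ℝ i f x‖ :=
      Finset.sum_nonneg fun _ _ => norm_nonneg _
    have h4 := le_self_pow₀ (a := 1 + ∑ i ∈ Finset.range (k + 1), ‖iteratedFDeriv ℝ i f x‖)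
      (by linarith) (show i ≠ 0 by omega)
    linarith

theorem bigM_inner {f : Idx → D → E} (hf : Moderate γ f) {l : Filter Idx} (hl : Good l)
    {K : Set D} (hK : K ∈ γ.sets) (k : ℕ) : BigM γ l K (fun ε x =>
      (k.factorial : ℝ) * (1 + ∑ i ∈ Finset.range (k + 1), ‖iteratedFDeriv ℝ i (f ε) x‖) ^ k) := by
  refine (BigM.const _).mul ?_ (fun _ _ => by positivity)
  exact ((BigM.const _).add (BigM.sum _ (fun i ε x => ‖iteratedFDeriv ℝ i (f ε) x‖) fun i _ =>
    (moderate_iff.1 hf).2 l hl K hK i)).pow (fun _ _ => by positivity) k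

theorem Moderate.comp {g : Idx → E → F} {f : Idx → D → E} (hg : Moderate γ2 g)
    (hf : Moderate γ f) (ht : Tame γ γ2 f f) : Moderate γ (fun ε x => g ε (f ε x)) := by
  rw [moderate_iff]
  refine ⟨fun ε => (hg.smooth ε).comp (hf.smooth ε), fun l hl K hK k => ?_⟩
  obtain ⟨b, hb, h⟩ := BigM.subst ht hl hK
    (c := fun ε y => ∑ i ∈ Finset.range (k + 1), ‖iteratedFDeriv ℝ i (g ε) y‖)
    (fun K2 hK2 => BigM.sum _ (fun i ε x => ‖iteratedFDeriv ℝ i (g ε) x‖) fun i _ =>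
      (moderate_iff.1 hg).2 l hl K2 hK2 i)
  refine (hb.mul (bigM_inner hf hl hK k) (fun _ _ => by positivity)).mono_le ?_
  filter_upwards [h] with ε h x hx
  refine (norm_comp_le (hg.smooth ε) (hf.smooth ε) k x).trans ?_
  gcongr
  exact h x hx _ (left_mem_segment ℝ _ _)

theorem Negl.comp {g : Idx → E → F} {f : Idx → D → E} (hg : Negl γ2 g)
    (hf : Moderate γ f) (ht : Tame γ γ2 f f) : Negl γ (fun ε x => g ε (f ε x)) := by
  refine ⟨(hg.moderate.comp hf ht).1, fun K hK k => ?_⟩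
  have hl : Good small := Or.inl rfl
  have key : BigN γ K (fun ε x => ∑ i ∈ Finset.range (k + 1),
      ‖iteratedFDeriv ℝ i (g ε) (f ε x)‖) := by
    refine BigN.sum _ (fun i ε x => ‖iteratedFDeriv ℝ i (g ε) (f ε x)‖) fun i _ => ?_
    obtain ⟨K2, hK2, b, hb, hy⟩ := ht small hl K hK
    obtain ⟨p, h⟩ := (hg.2 K2 hK2 i).pos
    obtain ⟨p2, C2, hC2, h2⟩ := hb.pos
    refine ⟨p2 * p, fun q => ?_⟩
    obtain ⟨C, hC, h⟩ := h p le_rfl (q + p2 * p)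
    refine ⟨C * C2 ^ p, ?_⟩
    filter_upwards [hy, h, h2 p2 le_rfl] with ε hy h h2 x hx
    obtain ⟨h5, h6⟩ := hy x hx _ (left_mem_segment ℝ _ _)
    have h0 := ε.2.1
    have h8 := one_le_wt γ2 (f ε x)
    have h9 := one_le_wt γ x
    calc ‖iteratedFDeriv ℝ i (g ε) (f ε x)‖
        ≤ C * (ε : ℝ) ^ (q + p2 * p) * (1 + γ2.weight (f ε x)) ^ p := h _ h5
      _ ≤ C * (ε : ℝ) ^ (q + p2 * p) *
          (C2 * ((ε : ℝ)⁻¹) ^ p2 * (1 + γ.weight x) ^ p2) ^ p := by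
        have h10 := h6.trans (h2 x hx)
        gcongr
      _ = C * C2 ^ p * (ε : ℝ) ^ q * (1 + γ.weight x) ^ (p2 * p) *
          ((ε : ℝ) * (ε : ℝ)⁻¹) ^ (p2 * p) := by
        simp only [mul_pow, ← pow_mul, pow_add]; ring
      _ = _ := by rw [mul_inv_cancel₀ h0.ne']; simp
  refine (key.mul_bigM (bigM_inner hf hl hK k) (fun _ _ => by positivity)).mono_le
    (Eventually.of_forall fun ε x _ =>
      norm_comp_le (hg.moderate.smooth ε) (hf.smooth ε) k x)

end nets

section subst
variable {D E : Type} [NormedAddCommGroup D] [NormedSpace ℝ D]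
  [NormedAddCommGroup E] [NormedSpace ℝ E] {γ : Regime D} {γ2 : Regime E}

theorem bigN_comp_sub {f f' : Idx → D → E} (hf : Moderate γ f) (hf' : Moderate γ f')
    (hN : Negl γ (fun ε x => f' ε x - f ε x)) (ht : Tame γ γ2 f f') {K : Set D}
    (hK : K ∈ γ.sets) (n : ℕ) :
    ∀ (F : Type) [NormedAddCommGroup F] [NormedSpace ℝ F] (g : Idx → E → F), Moderate γ2 g →
      ∀ k ≤ n, BigN γ K (fun ε x =>
        ‖iteratedFDeriv ℝ k (fun y => g ε (f' ε y) - g ε (f ε y)) x‖) := by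
  have hl : Good small := Or.inl rfl
  induction n with
  | zero =>
    intro F _ _ g hg k hk
    obtain rfl : k = 0 := by omega
    obtain ⟨b, hb, h⟩ := BigM.subst ht hl hK (c := fun ε y => ‖fderiv ℝ (g ε) y‖)
      (fun K2 hK2 => by simpa using hg.fderiv.2 K2 hK2 0)
    have h1 := hN.2 K hK 0
    simp only [norm_iteratedFDeriv_zero] at h1 ⊢
    have hb2 : BigM γ small K (fun ε x => |b ε x|) := by
      refine hb.mono_le ?_
      filter_upwards [h] with ε h x hx
      rw [abs_of_nonneg ((norm_nonneg _).trans (h x hx _ (left_mem_segment ℝ _ _)))]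
    refine (h1.mul_bigM hb2 (fun _ _ => abs_nonneg _)).mono_le ?_
    filter_upwards [h] with ε h x hx
    rw [mul_comm]
    exact (convex_segment (𝕜 := ℝ) (f ε x) (f' ε x)).norm_image_sub_le_of_norm_fderiv_le
      (fun y _ => ((hg.smooth ε).differentiable (by simp)).differentiableAt)
      (fun y hy => (h x hx y hy).trans (le_abs_self _))
      (left_mem_segment ℝ _ _) (right_mem_segment ℝ _ _)
  | succ n ih =>
    intro F _ _ g hg k hk
    rcases Nat.lt_or_ge k (n + 1) with hk2 | hk2
    · exact ih F g hg k (by omega)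
    obtain rfl : k = n + 1 := by omega
    have e : ∀ ε, _root_.fderiv ℝ (fun y => g ε (f' ε y) - g ε (f ε y)) = fun y =>
        ContinuousLinearMap.compL ℝ D E F
          (fderiv ℝ (g ε) (f' ε y) - fderiv ℝ (g ε) (f ε y)) (fderiv ℝ (f' ε) y) +
        ContinuousLinearMap.compL ℝ D E F (fderiv ℝ (g ε) (f ε y))
          (fderiv ℝ (fun z => f' ε z - f ε z) y) := by
      intro ε
      funext y
      have dg : ∀ z, DifferentiableAt ℝ (g ε) z := fun z =>
        ((hg.smooth ε).differentiable (by simp)).differentiableAt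
      have d1 : DifferentiableAt ℝ (f ε) y :=
        ((hf.smooth ε).differentiable (by simp)).differentiableAt
      have d2 : DifferentiableAt ℝ (f' ε) y :=
        ((hf'.smooth ε).differentiable (by simp)).differentiableAt
      have c1 : fderiv ℝ (fun y => g ε (f ε y)) y = _ := fderiv_comp y (dg _) d1
      have c2 : fderiv ℝ (fun y => g ε (f' ε y)) y = _ := fderiv_comp y (dg _) d2
      have c3 : fderiv ℝ (fun y => g ε (f' ε y) - g ε (f ε y)) y = _ :=
        fderiv_fun_sub ((dg _).comp y d2) ((dg _).comp y d1)
      have c4 : fderiv ℝ (fun z => f' ε z - f ε z) y = _ := fderiv_fun_sub d2 d1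
      rw [c3, c4]
      change fderiv ℝ (fun y => g ε (f' ε y)) y - fderiv ℝ (fun y => g ε (f ε y)) y = _
      rw [c1, c2]
      ext w
      simp
    have m1 : Moderate γ (fun ε y => fderiv ℝ (g ε) (f ε y)) := hg.fderiv.comp hf ht.left
    have m2 : Moderate γ (fun ε y => fderiv ℝ (g ε) (f' ε y)) := hg.fderiv.comp hf' ht.right
    have s1 : ∀ ε, ContDiff ℝ ∞ (fun y => fderiv ℝ (g ε) (f' ε y) - fderiv ℝ (g ε) (f ε y)) :=
      fun ε => (m2.smooth ε).sub (m1.smooth ε)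
    have n1 := bigN_bilin_left (ContinuousLinearMap.compL ℝ D E F) s1 hf'.fderiv hK n
      (ih (E →L[ℝ] F) (fun ε => fderiv ℝ (g ε)) hg.fderiv)
    have n2 := (Negl.bilin_right (ContinuousLinearMap.compL ℝ D E F) m1 hN.fderiv).2 K hK n
    refine (n1.add n2).mono_le (Eventually.of_forall fun ε x _ => ?_)
    rw [← norm_iteratedFDeriv_fderiv, e ε]
    have a1 : ContDiff ℝ ∞ (fun y => ContinuousLinearMap.compL ℝ D E F
          (fderiv ℝ (g ε) (f' ε y) - fderiv ℝ (g ε) (f ε y)) (fderiv ℝ (f' ε) y)) :=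
      (ContinuousLinearMap.compL ℝ D E F).isBoundedBilinearMap.contDiff.comp
        ((s1 ε).prodMk (hf'.fderiv.smooth ε))
    have a2 : ContDiff ℝ ∞ (fun y => ContinuousLinearMap.compL ℝ D E F (fderiv ℝ (g ε) (f ε y))
          (fderiv ℝ (fun z => f' ε z - f ε z) y)) :=
      (ContinuousLinearMap.compL ℝ D E F).isBoundedBilinearMap.contDiff.comp
        ((m1.smooth ε).prodMk (hN.moderate.fderiv.smooth ε))
    have a3 := iteratedFDeriv_add_apply (a1.of_le (lt_inf n)).contDiffAt (x := x)
      (a2.of_le (lt_inf n)).contDiffAt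
    refine le_trans (le_of_eq ?_) (norm_add_le _ _)
    exact congrArg _ a3

variable {F : Type} [NormedAddCommGroup F] [NormedSpace ℝ F]

/-- Composition respects negligible changes of both arguments. -/
theorem Negl.comp_sub {g g' : Idx → E → F} {f f' : Idx → D → E} (hg : Moderate γ2 g)
    (hgN : Negl γ2 (g' - g)) (hf : Moderate γ f) (hf' : Moderate γ f')
    (hN : Negl γ (f' - f)) (ht : Tame γ γ2 f f') :
    Negl γ ((fun ε x => g' ε (f' ε x)) - (fun ε x => g ε (f ε x))) := by
  have h1 : Negl γ (fun ε x => (g' - g) ε (f' ε x)) := hgN.comp hf' ht.right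
  have h2 : Negl γ (fun ε x => g ε (f' ε x) - g ε (f ε x)) := by
    have hm : Moderate γ ((fun ε x => g ε (f' ε x)) + -(fun ε x => g ε (f ε x))) :=
      (hg.comp hf' ht.right).add (hg.comp hf ht.left).neg
    have hm2 : Moderate γ (fun ε x => g ε (f' ε x) - g ε (f ε x)) := by
      convert hm using 3 with ε x
      simp [sub_eq_add_neg]
    exact ⟨hm2.1, fun K hK k => bigN_comp_sub hf hf' hN ht hK k F g hg k le_rfl⟩
  convert h1.add h2 using 1
  funext ε x
  simp

end subst

section quotients
variable {D E F G : Type} [NormedAddCommGroup D] [NormedSpace ℝ D]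
  [NormedAddCommGroup E] [NormedSpace ℝ E] [NormedAddCommGroup F] [NormedSpace ℝ F]
  [NormedAddCommGroup G] [NormedSpace ℝ G]

/-- The group of moderate nets of `F`-valued functions. -/
def modNets (γ : Regime D) (F : Type) [NormedAddCommGroup F] [NormedSpace ℝ F] :
    AddSubgroup (Idx → D → F) where
  carrier := {u | Moderate γ u}
  add_mem' := Moderate.add
  zero_mem' := Moderate.zero
  neg_mem' := Moderate.neg

/-- The group of negligible nets of `F`-valued functions. -/
def neglNets (γ : Regime D) (F : Type) [NormedAddCommGroup F] [NormedSpace ℝ F] :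
    AddSubgroup (Idx → D → F) where
  carrier := {u | Negl γ u}
  add_mem' := Negl.add
  zero_mem' := Negl.zero
  neg_mem' := Negl.neg

/-- Generalized functions with values in `F`: moderate nets modulo negligible nets. -/
abbrev Gen (γ : Regime D) (F : Type) [NormedAddCommGroup F] [NormedSpace ℝ F] : Type :=
  modNets γ F ⧸ (neglNets γ F).addSubgroupOf (modNets γ F)

/-- The Colombeau algebra `𝒢(D)`, with values in `F`. -/
abbrev Loc (D F : Type) [NormedAddCommGroup D] [NormedSpace ℝ D] [NormedAddCommGroup F]
    [NormedSpace ℝ F] : Type := Gen (Regime.loc D) F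

/-- The algebra `𝒢_τ(D)` of tempered generalized functions, with values in `F`. -/
abbrev Temp (D F : Type) [NormedAddCommGroup D] [NormedSpace ℝ D] [NormedAddCommGroup F]
    [NormedSpace ℝ F] : Type := Gen (Regime.temp D) F

/-- The mixed algebra `𝒢̃_τ(A × E)`, with `𝒢`-bounds in `A` and `𝒢_τ`-bounds in `E`, and with
values in `F`. -/
abbrev Mix (A E F : Type) [NormedAddCommGroup A] [NormedSpace ℝ A] [NormedAddCommGroup E]
    [NormedSpace ℝ E] [NormedAddCommGroup F] [NormedSpace ℝ F] : Type := Gen (Regime.mix A E) F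

variable {γ : Regime D} {γ2 : Regime E}

/-- The class `cl[(u_ε)]`. -/
def cl (u : Idx → D → F) (hu : Moderate γ u) : Gen γ F :=
  QuotientAddGroup.mk (⟨u, hu⟩ : modNets γ F)

theorem cl_eq_cl {u v : Idx → D → F} {hu : Moderate γ u} {hv : Moderate γ v} :
    cl u hu = cl v hv ↔ Negl γ (v - u) := by
  unfold cl
  rw [QuotientAddGroup.eq, AddSubgroup.mem_addSubgroupOf]
  rw [← neg_add_eq_sub]
  rfl

theorem rel_iff {u v : modNets γ F} :
    QuotientAddGroup.leftRel ((neglNets γ F).addSubgroupOf (modNets γ F)) u v ↔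
      Negl γ (v.1 - u.1) := by
  rw [QuotientAddGroup.leftRel_apply, AddSubgroup.mem_addSubgroupOf]
  rw [← neg_add_eq_sub]
  rfl

/-- An operation on representatives that is compatible with the equivalence relation. -/
def Gen.map {γ' : Regime E} (T : (Idx → D → F) → (Idx → E → G))
    (hT : ∀ u, Moderate γ u → Moderate γ' (T u))
    (hN : ∀ u v, Moderate γ u → Moderate γ v → Negl γ (v - u) → Negl γ' (T v - T u)) :
    Gen γ F → Gen γ' G :=
  Quotient.map' (fun u => ⟨T u.1, hT u.1 u.2⟩)
    (fun u v h => rel_iff.2 (hN u.1 v.1 u.2 v.2 (rel_iff.1 h)))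

/-- A binary operation on representatives that is compatible with the equivalence relations. -/
def Gen.map₂ {E' G' : Type} [NormedAddCommGroup E'] [NormedSpace ℝ E']
    [NormedAddCommGroup G'] [NormedSpace ℝ G'] {γ' : Regime E'}
    (T : (Idx → E → F) → (Idx → D → G) → (Idx → E' → G'))
    (hT : ∀ u v, Moderate γ2 u → Moderate γ v → Moderate γ' (T u v))
    (hN : ∀ u u' v v', Moderate γ2 u → Moderate γ2 u' → Moderate γ v → Moderate γ v' →
      Negl γ2 (u' - u) → Negl γ (v' - v) → Negl γ' (T u' v' - T u v)) :
    Gen γ2 F → Gen γ G → Gen γ' G' :=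
  Quotient.map₂ (fun u v => ⟨T u.1 v.1, hT u.1 v.1 u.2 v.2⟩)
    (fun u u' h v v' h2 => rel_iff.2 (hN u.1 u'.1 v.1 v'.1 u.2 u'.2 v.2 v'.2
      (rel_iff.1 h) (rel_iff.1 h2)))

/-- Componentwise application of a continuous linear map to the values. -/
def Gen.clm (L : F →L[ℝ] G) : Gen γ F → Gen γ G :=
  Gen.map (fun u ε x => L (u ε x)) (fun _ hu => hu.clm L) (fun u v _ _ h => by
    have h2 := h.clm L
    convert h2 using 1
    funext ε x
    simp)

/-- The total derivative. -/
def Gen.fderiv : Gen γ F → Gen γ (D →L[ℝ] F) :=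
  Gen.map (fun u ε => _root_.fderiv ℝ (u ε)) (fun _ hu => hu.fderiv) (fun u v hu hv h => by
    have h2 := h.fderiv
    convert h2 using 1
    funext ε x
    exact (fderiv_sub ((hv.smooth ε).differentiable (by simp)).differentiableAt
      ((hu.smooth ε).differentiable (by simp)).differentiableAt).symm)

/-- The pointwise application `x ↦ T(x)(V(x))` of operator-valued to vector-valued functions. -/
def Gen.app (T : Gen γ (E →L[ℝ] F)) (V : Gen γ E) : Gen γ F :=
  Gen.map₂ (γ2 := γ) (γ := γ) (γ' := γ) (F := E →L[ℝ] F) (G := E) (G' := F)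
    (fun (t : Idx → D → E →L[ℝ] F) (v : Idx → D → E) ε x => t ε x (v ε x))
    (fun _ _ ht hv => Moderate.bilin (ContinuousLinearMap.id ℝ (E →L[ℝ] F)) ht hv)
    (fun t t' v v' ht ht' hv hv' h h2 => by
      have h3 := (h.bilin_left (ContinuousLinearMap.id ℝ (E →L[ℝ] F)) hv').add
        (Negl.bilin_right (ContinuousLinearMap.id ℝ (E →L[ℝ] F)) ht h2)
      convert h3 using 1
      funext ε x
      simp) T V

/-- The class of a single function, as a constant net. -/
theorem Slow.moderate {f : D → F} (hf : Slow γ f) : Moderate γ (fun _ => f) := by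
  refine ⟨fun _ => hf, fun K hK k => ?_⟩
  obtain ⟨p, C, h⟩ := hf.2 K hK k
  refine ⟨p, |C|, Eventually.of_forall fun ε x hx => (h x hx).trans ?_⟩
  have h1 := one_le_wt γ x
  have h2 : (1 : ℝ) ≤ ((ε : ℝ)⁻¹) ^ p := one_le_pow₀ (one_le_inv ε)
  have h3 := le_abs_self C
  have h4 : C ≤ |C| * ((ε : ℝ)⁻¹) ^ p := by nlinarith [abs_nonneg C]
  gcongr

theorem slow_temp {f : D → F} (hf : f.HasTemperateGrowth) : Slow (Regime.temp D) f := by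
  refine ⟨hf.1, fun K _ k => ?_⟩
  obtain ⟨p, C, h⟩ := hf.2 k
  exact ⟨p, C, fun x _ => h x⟩

theorem slow_mix {f : D × E → F} (hf : f.HasTemperateGrowth) : Slow (Regime.mix D E) f := by
  refine ⟨hf.1, ?_⟩
  rintro _ ⟨K, hK, rfl⟩ k
  obtain ⟨p, C, h⟩ := hf.2 k
  obtain ⟨M, hM⟩ := hK.isBounded.exists_norm_le
  refine ⟨p, |C| * (1 + |M|) ^ p, ?_⟩
  rintro ⟨a, y⟩ ⟨ha, _⟩
  refine (h _).trans ?_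
  have h1 : 1 + ‖(a, y)‖ ≤ (1 + |M|) * (1 + ‖y‖) := by
    have h2 : ‖a‖ ≤ |M| := (hM a ha).trans (le_abs_self M)
    have h3 : ‖(a, y)‖ ≤ ‖a‖ + ‖y‖ := by
      rw [Prod.norm_mk]
      exact max_le_add_of_nonneg (norm_nonneg _) (norm_nonneg _)
    nlinarith [norm_nonneg y, abs_nonneg M]
  have h4 := le_abs_self C
  change C * (1 + ‖(a, y)‖) ^ p ≤ |C| * (1 + |M|) ^ p * (1 + ‖y‖) ^ p
  calc C * (1 + ‖(a, y)‖) ^ p ≤ |C| * ((1 + |M|) * (1 + ‖y‖)) ^ p := by gcongr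
    _ = _ := by rw [mul_pow, mul_assoc]

/-- A function of `𝒪_M(D)`, as an element of `𝒢_τ(D)`. -/
def Gen.ofTemp (f : D → F) (hf : f.HasTemperateGrowth) : Temp D F :=
  cl (fun _ => f) (slow_temp hf).moderate

/-- A function of `𝒪_M(D × E)`, as an element of `𝒢̃_τ(D × E)`. -/
def Gen.ofMix (f : D × E → F) (hf : f.HasTemperateGrowth) : Mix D E F :=
  cl (fun _ => f) (slow_mix hf).moderate

/-- A continuous linear map, as an element of `𝒢_τ(D)`. -/
def Gen.linTemp (L : D →L[ℝ] F) : Temp D F := Gen.ofTemp L L.hasTemperateGrowth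

/-- A continuous linear map, as an element of `𝒢̃_τ(D × E)`. -/
def Gen.linMix (L : D × E →L[ℝ] F) : Mix D E F := Gen.ofMix L L.hasTemperateGrowth

theorem segment_norm_le {a b y : E} (h : y ∈ segment ℝ a b) : ‖y‖ ≤ ‖a‖ + ‖b‖ := by
  obtain ⟨s, t, hs, ht, hst, rfl⟩ := h
  refine (norm_add_le _ _).trans ?_
  rw [norm_smul, norm_smul, Real.norm_of_nonneg hs, Real.norm_of_nonneg ht]
  nlinarith [norm_nonneg a, norm_nonneg b]

theorem bigM_norm {f : Idx → D → E} (hf : Moderate γ f) {l : Filter Idx} (hl : Good l)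
    {K : Set D} (hK : K ∈ γ.sets) : BigM γ l K (fun ε x => ‖f ε x‖) := by
  simpa using (moderate_iff.1 hf).2 l hl K hK 0

theorem tame_temp {f f' : Idx → D → E} (hf : Moderate γ f) (hf' : Moderate γ f') :
    Tame γ (Regime.temp E) f f' := by
  intro l hl K hK
  refine ⟨univ, rfl, fun ε x => 1 + (‖f ε x‖ + ‖f' ε x‖),
    (BigM.const 1).add ((bigM_norm hf hl hK).add (bigM_norm hf' hl hK)),
    Eventually.of_forall fun ε x _ y hy => ⟨mem_univ y, ?_⟩⟩
  have := segment_norm_le hy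
  change 1 + ‖y‖ ≤ _
  linarith

/-- Composition `G ∘ Y` of a tempered generalized function with a generalized function, by
componentwise insertion. -/
def Gen.comp (U : Temp E F) (Y : Gen γ E) : Gen γ F :=
  Gen.map₂ (γ2 := Regime.temp E) (γ := γ) (γ' := γ) (F := F) (G := E) (G' := F)
    (fun g y ε x => g ε (y ε x))
    (fun _ _ hg hy => hg.comp hy (tame_temp hy hy))
    (fun _ _ _ _ hg _ hy hy' h h2 => Negl.comp_sub hg h hy hy' h2 (tame_temp hy hy')) U Y

end quotients

section mixed
variable {A B D E F : Type} [NormedAddCommGroup A] [NormedSpace ℝ A]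
  [NormedAddCommGroup B] [NormedSpace ℝ B] [NormedAddCommGroup D] [NormedSpace ℝ D]
  [NormedAddCommGroup E] [NormedSpace ℝ E] [NormedAddCommGroup F] [NormedSpace ℝ F]
  {γ : Regime D}

theorem Moderate.prodMk {f : Idx → D → E} {g : Idx → D → F} (hf : Moderate γ f)
    (hg : Moderate γ g) : Moderate γ (fun ε x => (f ε x, g ε x)) := by
  have h := (hf.clm (ContinuousLinearMap.inl ℝ E F)).add (hg.clm (ContinuousLinearMap.inr ℝ E F))
  convert h using 1
  funext ε x
  simp

theorem Negl.prodMk {f : Idx → D → E} {g : Idx → D → F} (hf : Negl γ f)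
    (hg : Negl γ g) : Negl γ (fun ε x => (f ε x, g ε x)) := by
  have h := (hf.clm (ContinuousLinearMap.inl ℝ E F)).add (hg.clm (ContinuousLinearMap.inr ℝ E F))
  convert h using 1
  funext ε x
  simp

/-- The pair `(U, V)` of two generalized functions. -/
def Gen.pair (U : Gen γ E) (V : Gen γ F) : Gen γ (E × F) :=
  Gen.map₂ (γ2 := γ) (γ := γ) (γ' := γ) (F := E) (G := F) (G' := E × F)
    (fun f g ε x => (f ε x, g ε x)) (fun _ _ hf hg => hf.prodMk hg)
    (fun _ _ _ _ _ _ _ _ h h2 => h.prodMk h2) U V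

/-- A finite family of generalized functions, as one generalized function. -/
def Gen.pi {ι : Type} [Fintype ι] [DecidableEq ι] (U : ι → Gen γ ℝ) : Gen γ (ι → ℝ) :=
  ∑ i, Gen.clm (ContinuousLinearMap.single ℝ (fun _ : ι => ℝ) i) (U i)

theorem tame_mix (α : B →L[ℝ] A) {f f' : Idx → B × D → E} (hf : Moderate (Regime.mix B D) f)
    (hf' : Moderate (Regime.mix B D) f') : Tame (Regime.mix B D) (Regime.mix A E)
      (fun ε z => (α z.1, f ε z)) (fun ε z => (α z.1, f' ε z)) := by
  intro l hl K hK
  have hK' := hK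
  obtain ⟨K1, hK1, rfl⟩ := hK
  refine ⟨(α '' K1) ×ˢ univ, ⟨_, hK1.image α.continuous, rfl⟩,
    fun ε x => 1 + (‖f ε x‖ + ‖f' ε x‖),
    (BigM.const 1).add ((bigM_norm hf hl hK').add (bigM_norm hf' hl hK')),
    Eventually.of_forall ?_⟩
  rintro ε ⟨b, x⟩ ⟨hb, _⟩ y hy
  obtain ⟨s, t, hs, ht, hst, rfl⟩ := hy
  refine ⟨⟨⟨b, hb, ?_⟩, mem_univ _⟩, ?_⟩
  · simp only [Prod.fst_add, Prod.smul_fst, ← add_smul, hst, one_smul]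
  · have := segment_norm_le (E := E) (a := f ε (b, x)) (b := f' ε (b, x)) ⟨s, t, hs, ht, hst, rfl⟩
    change 1 + ‖s • f ε (b, x) + t • f' ε (b, x)‖ ≤ _
    linarith

theorem moderate_lin_mix (L : B × D →L[ℝ] A) : Moderate (Regime.mix B D) (fun _ z => L z) :=
  (slow_mix L.hasTemperateGrowth).moderate

/-- The substitution `(b, x) ↦ U(α(b), Y(b, x))` in a generalized function `U` of the mixed
algebra, where `α` is a continuous linear map. -/
def Gen.subst (α : B →L[ℝ] A) (U : Mix A E F) (Y : Mix B D E) : Mix B D F :=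
  Gen.map₂ (γ2 := Regime.mix A E) (γ := Regime.mix B D) (γ' := Regime.mix B D) (F := F) (G := E)
    (G' := F) (fun g f ε z => g ε (α z.1, f ε z))
    (fun _ _ hg hf => hg.comp
      ((moderate_lin_mix (α.comp (ContinuousLinearMap.fst ℝ B D))).prodMk hf) (tame_mix α hf hf))
    (fun _ _ f f' hg _ hf hf' h h2 => Negl.comp_sub hg h
      ((moderate_lin_mix (α.comp (ContinuousLinearMap.fst ℝ B D))).prodMk hf)
      ((moderate_lin_mix (α.comp (ContinuousLinearMap.fst ℝ B D))).prodMk hf')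
      (by
        have h3 := h2.clm (ContinuousLinearMap.inr ℝ A E)
        convert h3 using 1
        funext ε z
        simp)
      (tame_mix α hf hf')) U Y

end mixed

section points
variable {E F : Type} [NormedAddCommGroup E] [NormedSpace ℝ E] [NormedAddCommGroup F]
  [NormedSpace ℝ F]

theorem small_le (r : ℝ) (hr : 0 < r) : ∀ᶠ ε in small, ((ε : Idx) : ℝ) ≤ r :=
  (tendsto_comap.eventually (eventually_le_nhds hr))

theorem two_mul_pow_le {ε : Idx} (h : (ε : ℝ) ≤ 1 / 2) (q : ℕ) :
    (ε : ℝ) ^ (q + 1) + (ε : ℝ) ^ (q + 1) ≤ (ε : ℝ) ^ q := by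
  have h0 : 0 ≤ (ε : ℝ) ^ q := pow_nonneg ε.2.1.le q
  rw [pow_succ]
  nlinarith

/-- Nets of points of moderate growth. -/
def modPts (E : Type) [NormedAddCommGroup E] : AddSubgroup (Idx → E) where
  carrier := {x | ∃ p : ℕ, ∀ᶠ ε in small, ‖x ε‖ ≤ ((ε : ℝ)⁻¹) ^ p}
  zero_mem' := ⟨0, by simp⟩
  neg_mem' := by
    rintro x ⟨p, h⟩
    exact ⟨p, by simpa using h⟩
  add_mem' := by
    rintro x y ⟨p, h⟩ ⟨p2, h2⟩
    refine ⟨max p p2 + 1, ?_⟩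
    filter_upwards [h, h2, small_le (1 / 2) (by norm_num)] with ε h h2 h3
    have h4 := one_le_inv ε
    have h5 : ((ε : ℝ)⁻¹) ^ p ≤ ((ε : ℝ)⁻¹) ^ max p p2 :=
      pow_le_pow_right₀ h4 (le_max_left _ _)
    have h6 : ((ε : ℝ)⁻¹) ^ p2 ≤ ((ε : ℝ)⁻¹) ^ max p p2 :=
      pow_le_pow_right₀ h4 (le_max_right _ _)
    have h7 : (2 : ℝ) ≤ (ε : ℝ)⁻¹ := by
      rw [le_inv_comm₀ (by norm_num) ε.2.1]
      linarith
    have h8 : 0 ≤ ((ε : ℝ)⁻¹) ^ max p p2 := by positivity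
    refine (norm_add_le _ _).trans ?_
    rw [pow_succ]
    nlinarith

/-- Negligible nets of points. -/
def neglPts (E : Type) [NormedAddCommGroup E] : AddSubgroup (Idx → E) where
  carrier := {x | ∀ q : ℕ, ∀ᶠ ε in small, ‖x ε‖ ≤ (ε : ℝ) ^ q}
  zero_mem' := fun q => Eventually.of_forall fun ε => by simpa using pow_nonneg ε.2.1.le q
  neg_mem' := by
    intro x h q
    simpa using h q
  add_mem' := by
    intro x y h h2 q
    filter_upwards [h (q + 1), h2 (q + 1), small_le (1 / 2) (by norm_num)] with ε h h2 h3
    exact (norm_add_le _ _).trans ((add_le_add h h2).trans (two_mul_pow_le h3 q))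

/-- Nets of points that eventually stay in a compact set. -/
def cptPts (E : Type) [NormedAddCommGroup E] : AddSubgroup (Idx → E) where
  carrier := {x | ∃ K : Set E, IsCompact K ∧ ∀ᶠ ε in small, x ε ∈ K}
  zero_mem' := ⟨{0}, isCompact_singleton, by simp⟩
  neg_mem' := by
    rintro x ⟨K, hK, h⟩
    refine ⟨(fun y => -y) '' K, hK.image continuous_neg, ?_⟩
    filter_upwards [h] with ε h
    exact ⟨x ε, h, rfl⟩
  add_mem' := by
    rintro x y ⟨K, hK, h⟩ ⟨K2, hK2, h2⟩
    refine ⟨(fun z : E × E => z.1 + z.2) '' (K ×ˢ K2), (hK.prod hK2).image continuous_add, ?_⟩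
    filter_upwards [h, h2] with ε h h2
    exact ⟨(x ε, y ε), ⟨h, h2⟩, rfl⟩

/-- The generalized points `Ẽ`; for `E = ℝ` these are the generalized numbers `ℛ`. -/
abbrev Pt (E : Type) [NormedAddCommGroup E] : Type :=
  modPts E ⧸ (neglPts E).addSubgroupOf (modPts E)

/-- The compactly supported generalized points `Ẽ_c`; for `E = ℝ` this is `ℛ_c`. -/
abbrev CptPt (E : Type) [NormedAddCommGroup E] : Type :=
  cptPts E ⧸ (neglPts E).addSubgroupOf (cptPts E)

theorem ptRel_iff {H : AddSubgroup (Idx → E)} {x y : H} :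
    QuotientAddGroup.leftRel ((neglPts E).addSubgroupOf H) x y ↔ y.1 - x.1 ∈ neglPts E := by
  rw [QuotientAddGroup.leftRel_apply, AddSubgroup.mem_addSubgroupOf]
  rw [← neg_add_eq_sub]
  rfl
end points

section slices
variable {D E F : Type} [NormedAddCommGroup D] [NormedSpace ℝ D] [NormedAddCommGroup E]
  [NormedSpace ℝ E] [NormedAddCommGroup F] [NormedSpace ℝ F] {γ : Regime D}

theorem slow_const (c : F) : Slow γ (fun _ : D => c) := by
  refine ⟨contDiff_const, fun K _ k => ⟨0, ‖c‖, fun x _ => ?_⟩⟩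
  rcases Nat.eq_zero_or_pos k with rfl | hk
  · simp
  · rw [iteratedFDeriv_const_of_ne (by omega)]
    simp

theorem moderate_const {c : Idx → F} (hc : c ∈ modPts F) :
    Moderate γ (fun ε (_ : D) => c ε) := by
  refine ⟨fun ε => slow_const (c ε), fun K _ k => ?_⟩
  rcases Nat.eq_zero_or_pos k with rfl | hk
  · obtain ⟨p, h⟩ := hc
    refine ⟨p, 1, ?_⟩
    filter_upwards [h] with ε h x _
    have h1 := one_le_inv ε
    have h2 : 1 ≤ (1 + γ.weight x) ^ p := one_le_pow₀ (one_le_wt γ x)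
    have h3 : 0 ≤ ((ε : ℝ)⁻¹) ^ p := by positivity
    rw [norm_iteratedFDeriv_zero]
    nlinarith
  · refine (BigM.const 0).mono_le (Eventually.of_forall fun ε x _ => ?_)
    rw [iteratedFDeriv_const_of_ne (by omega)]
    simp

theorem negl_const {c : Idx → F} (hc : c ∈ neglPts F) : Negl γ (fun ε (_ : D) => c ε) := by
  refine ⟨fun ε => slow_const (c ε), fun K _ k => ?_⟩
  rcases Nat.eq_zero_or_pos k with rfl | hk
  · refine ⟨0, fun q => ⟨1, ?_⟩⟩
    filter_upwards [hc q] with ε h x _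
    simpa using h
  · refine BigN.zero.mono_le (Eventually.of_forall fun ε x _ => ?_)
    rw [iteratedFDeriv_const_of_ne (by omega)]
    simp

theorem cptPts_le : cptPts F ≤ modPts F := by
  rintro c ⟨K, hK, h⟩
  obtain ⟨M, hM⟩ := hK.isBounded.exists_norm_le
  refine ⟨1, ?_⟩
  filter_upwards [h, small_le (|M| + 1)⁻¹ (by positivity)] with ε h h2
  have h3 : |M| + 1 ≤ (ε : ℝ)⁻¹ := by
    rwa [le_inv_comm₀ (by positivity) ε.2.1]
  rw [pow_one]
  linarith [hM _ h, le_abs_self M]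

theorem Moderate.at_mem {u : Idx → D → F} (hu : Moderate γ u) {K : Set D} (hK : K ∈ γ.sets)
    {x : D} (hx : x ∈ K) : (fun ε => u ε x) ∈ modPts F := by
  obtain ⟨p, C, hC, h⟩ := (hu.2 K hK 0).pos
  have hW : 0 ≤ C * (1 + γ.weight x) ^ p := by have := one_le_wt γ x; positivity
  refine ⟨p + 1, ?_⟩
  filter_upwards [h p le_rfl, small_le (C * (1 + γ.weight x) ^ p + 1)⁻¹ (by positivity)]
    with ε h h2
  have h3 : C * (1 + γ.weight x) ^ p + 1 ≤ (ε : ℝ)⁻¹ := by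
    rwa [le_inv_comm₀ (by positivity) ε.2.1]
  have h4 := h x hx
  rw [norm_iteratedFDeriv_zero] at h4
  refine h4.trans ?_
  have h5 : 0 ≤ ((ε : ℝ)⁻¹) ^ p := by have := one_le_inv ε; positivity
  rw [pow_succ]
  nlinarith

theorem Negl.at_mem {u : Idx → D → F} (hu : Negl γ u) {K : Set D} (hK : K ∈ γ.sets)
    {x : D} (hx : x ∈ K) : (fun ε => u ε x) ∈ neglPts F := by
  intro q
  obtain ⟨p, h⟩ := (hu.2 K hK 0).pos
  obtain ⟨C, hC, h⟩ := h p le_rfl (q + 1)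
  have hW : 0 ≤ C * (1 + γ.weight x) ^ p := by have := one_le_wt γ x; positivity
  filter_upwards [h, small_le (C * (1 + γ.weight x) ^ p + 1)⁻¹ (by positivity)] with ε h h2
  have h3 : C * (1 + γ.weight x) ^ p + 1 ≤ (ε : ℝ)⁻¹ := by
    rwa [le_inv_comm₀ (by positivity) ε.2.1]
  have h4 := h x hx
  rw [norm_iteratedFDeriv_zero] at h4
  refine h4.trans ?_
  have h5 : 0 ≤ (ε : ℝ) ^ q := pow_nonneg ε.2.1.le q
  have h6 : (C * (1 + γ.weight x) ^ p) * (ε : ℝ) ≤ 1 := by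
    have h7 : (ε : ℝ)⁻¹ * (ε : ℝ) = 1 := inv_mul_cancel₀ ε.2.1.ne'
    nlinarith [ε.2.1]
  calc C * (ε : ℝ) ^ (q + 1) * (1 + γ.weight x) ^ p
      = (C * (1 + γ.weight x) ^ p) * (ε : ℝ) * (ε : ℝ) ^ q := by ring
    _ ≤ 1 * (ε : ℝ) ^ q := by gcongr
    _ = _ := one_mul _

/-- The point value `U(x̃)` of a tempered generalized function at a generalized point, by
componentwise insertion. -/
def Gen.eval (U : Temp E F) (x : Pt E) : Pt F :=
  Quotient.map₂ (sc := QuotientAddGroup.leftRel ((neglPts F).addSubgroupOf (modPts F)))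
    (fun (u : modNets (Regime.temp E) F) (x : modPts E) =>
      (⟨fun ε => u.1 ε (x.1 ε), by
        have h : Moderate (Regime.loc ℝ) (fun ε (_ : ℝ) => u.1 ε (x.1 ε)) :=
          Moderate.comp (f := fun ε (_ : ℝ) => x.1 ε) u.2 (moderate_const x.2)
            (tame_temp (moderate_const x.2) (moderate_const x.2))
        exact h.at_mem (K := {0}) isCompact_singleton rfl⟩ : modPts F))
    (fun u v h x y h2 => by
      have h := rel_iff.1 h
      have h2 := ptRel_iff.1 h2
      have h3 := Negl.comp_sub (γ := Regime.loc ℝ) (f := fun ε (_ : ℝ) => x.1 ε)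
        (f' := fun ε (_ : ℝ) => y.1 ε) u.2 h (moderate_const x.2) (moderate_const y.2)
        (negl_const h2) (tame_temp (moderate_const x.2) (moderate_const y.2))
      exact ptRel_iff.2 (h3.at_mem (K := {0}) isCompact_singleton (x := 0) rfl)) U x

/-- The value `U(t) ∈ F̃` of `U ∈ 𝒢(D)` at a classical point `t`. -/
def Gen.evalAt (t : D) (U : Loc D F) : Pt F :=
  Quotient.map' (s₂ := QuotientAddGroup.leftRel ((neglPts F).addSubgroupOf (modPts F)))
    (fun (u : modNets (Regime.loc D) F) =>
      (⟨fun ε => u.1 ε t, u.2.at_mem (K := {t}) isCompact_singleton rfl⟩ : modPts F))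
    (fun _ _ h => ptRel_iff.2 ((rel_iff.1 h).at_mem (K := {t}) isCompact_singleton (x := t) rfl))
    U

theorem tame_slice {s t : Idx → ℝ} (hs : s ∈ cptPts ℝ) (ht : t ∈ cptPts ℝ) :
    Tame (Regime.temp E) (Regime.mix ℝ E) (fun ε x => (s ε, x)) (fun ε x => (t ε, x)) := by
  intro l hl K hK
  have hb : ∀ s ∈ cptPts ℝ, ∃ M : ℝ, ∀ᶠ ε in l, |s ε| ≤ M := by
    rintro s ⟨K, hK, h⟩
    rcases hl with rfl | ⟨ε, rfl⟩
    · obtain ⟨M, hM⟩ := hK.isBounded.exists_norm_le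
      exact ⟨M, h.mono fun ε h => hM _ h⟩
    · exact ⟨|s ε|, by simp⟩
  obtain ⟨M, hM⟩ := hb s hs
  obtain ⟨M2, hM2⟩ := hb t ht
  refine ⟨Metric.closedBall 0 (M + M2) ×ˢ univ, ⟨_, isCompact_closedBall _ _, rfl⟩,
    fun ε x => 1 + ‖x‖, BigM.weight (γ := Regime.temp E), ?_⟩
  filter_upwards [hM, hM2] with ε hM hM2 x _ y hy
  obtain ⟨a, b, ha, hb, hab, rfl⟩ := hy
  have e2 : (a • (s ε, x) + b • (t ε, x)).2 = x := by
    simp only [Prod.snd_add, Prod.smul_snd, ← add_smul, hab, one_smul]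
  have e1 : ‖a • s ε + b • t ε‖ ≤ ‖s ε‖ + ‖t ε‖ := segment_norm_le ⟨a, b, ha, hb, hab, rfl⟩
  refine ⟨⟨?_, mem_univ _⟩, ?_⟩
  · rw [Metric.mem_closedBall, dist_zero_right]
    exact e1.trans (add_le_add hM hM2)
  · change 1 + ‖(a • (s ε, x) + b • (t ε, x)).2‖ ≤ 1 + ‖x‖
    rw [e2]

/-- The element `U(η̃, ·) ∈ 𝒢_τ(E)` for `U ∈ 𝒢̃_τ(ℝ × E)` and `η̃ ∈ ℛ_c`. -/
def Gen.slice (U : Mix ℝ E F) (η : CptPt ℝ) : Temp E F :=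
  Quotient.map₂ (sc := QuotientAddGroup.leftRel
      ((neglNets (Regime.temp E) F).addSubgroupOf (modNets (Regime.temp E) F)))
    (fun (u : modNets (Regime.mix ℝ E) F) (s : cptPts ℝ) =>
      (⟨fun ε x => u.1 ε (s.1 ε, x), Moderate.comp (f := fun ε x => (s.1 ε, x)) u.2
        ((moderate_const (cptPts_le s.2)).prodMk
          (slow_temp Function.HasTemperateGrowth.id).moderate)
        (tame_slice s.2 s.2)⟩ : modNets (Regime.temp E) F))
    (fun u v h s t h2 => by
      have hid : Moderate (Regime.temp E) (fun _ x => x) :=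
        (slow_temp Function.HasTemperateGrowth.id).moderate
      have h := rel_iff.1 h
      have h2 := (negl_const (γ := Regime.temp E) (ptRel_iff.1 h2)).clm
        (ContinuousLinearMap.inl ℝ ℝ E)
      refine rel_iff.2 (Negl.comp_sub (f := fun ε x => (s.1 ε, x)) (f' := fun ε x => (t.1 ε, x))
        u.2 h ((moderate_const (cptPts_le s.2)).prodMk hid)
        ((moderate_const (cptPts_le t.2)).prodMk hid) ?_ (tame_slice s.2 t.2))
      convert h2 using 1
      funext ε x
      simp) U η

/-- The derivative of a generalized function in the direction of a fixed vector `v`. -/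
def Gen.lineD (v : D) (U : Gen γ F) : Gen γ F :=
  Gen.clm (ContinuousLinearMap.apply ℝ F v) (Gen.fderiv U)

/-- The iterated derivative `∂_{e_1}^{J_1} ⋯ ∂_{e_p}^{J_p}`. -/
def Gen.partials {p : ℕ} (e : Fin p → D) (J : Fin p → ℕ) (U : Gen γ F) : Gen γ F :=
  (List.finRange p).foldr (fun i V => (Gen.lineD (e i))^[J i] V) U

end slices

section actions
variable {E F : Type} [NormedAddCommGroup E] [NormedSpace ℝ E] [NormedAddCommGroup F]
  [NormedSpace ℝ F]

/-- The derivative `∂_η U` of `U(η, x)` in the group parameter. -/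
def Gen.dEta (U : Mix ℝ E F) : Mix ℝ E F := Gen.lineD ((1, 0) : ℝ × E) U

/-- Generalized group actions: `Φ(0, ·) = id` in `𝒢_τ(E)`, and
`Φ(η₁ + η₂, x) = Φ(η₁, Φ(η₂, x))` in `𝒢̃_τ(ℝ² × E)`. -/
def IsGroupAction (Φ : Mix ℝ E E) : Prop :=
  Gen.slice Φ 0 = Gen.linTemp (ContinuousLinearMap.id ℝ E) ∧
  Gen.subst (ContinuousLinearMap.fst ℝ ℝ ℝ + ContinuousLinearMap.snd ℝ ℝ ℝ) Φ
      (Gen.linMix (ContinuousLinearMap.snd ℝ (ℝ × ℝ) E)) =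
    Gen.subst (ContinuousLinearMap.fst ℝ ℝ ℝ) Φ
      (Gen.subst (ContinuousLinearMap.snd ℝ ℝ ℝ) Φ
        (Gen.linMix (ContinuousLinearMap.snd ℝ (ℝ × ℝ) E)))

/-- The components `ξ = d/dη|₀ Φ(η, ·) ∈ 𝒢_τ(E)` of the infinitesimal generator. -/
def generator (Φ : Mix ℝ E E) : Temp E E := Gen.slice (Gen.dEta Φ) 0

/-- `𝒢`-completeness of the generalized vector field with components `ξ`: every initial value
problem `x' = ξ(x)`, `x(t₀) = x̃₀`, is uniquely solvable in `𝒢(ℝ)`. -/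
def IsGComplete (ξ : Temp E E) : Prop :=
  ∀ (t₀ : ℝ) (x₀ : Pt E), ∃! x : Loc ℝ E,
    Gen.lineD (1 : ℝ) x = Gen.comp ξ x ∧ Gen.evalAt t₀ x = x₀

/-- The system `x' = ξ(x)` possesses a flow in `𝒢̃_τ(ℝ × E)`: there is `h` with `h(0, ·) = id` and
`∂_η h(η, a) = ξ(h(η, a))`. -/
def HasFlow (ξ : Temp E E) : Prop :=
  ∃ h : Mix ℝ E E, Gen.slice h 0 = Gen.linTemp (ContinuousLinearMap.id ℝ E) ∧
    Gen.dEta h = Gen.comp ξ h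

/-- The function `X(U) = ∑ ξ_i ∂_i U` for the generalized vector field `X` with components `ξ`. -/
def applyField (ξ : Temp E E) (U : Temp E F) : Temp E F := Gen.app (Gen.fderiv U) ξ

end actions

section jets
variable (p q n : ℕ)

/-- Multi-indices `J ∈ ℕ^p` with `|J| ≤ n`. -/
abbrev MIdx : Type := {J : Fin p → Fin (n + 1) // ∑ i, (J i : ℕ) ≤ n}

/-- The coordinates of the jet space: `x_i` for `i < p`, and `u^α_J` for `α < q` and `|J| ≤ n`. -/
abbrev JIdx : Type := Fin p ⊕ (Fin q × MIdx p n)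

/-- The jet space `(ℝ^p × ℝ^q)^{(n)}`. -/
abbrev Jet : Type := JIdx p q n → ℝ

variable {p q}

/-- The map `x ↦ (x, pr^{(n)} U(x))`. -/
def Gen.jet (U : Temp (Fin p → ℝ) (Fin q → ℝ)) : Temp (Fin p → ℝ) (Jet p q n) :=
  Gen.pi (Sum.elim (fun i => Gen.linTemp (ContinuousLinearMap.proj i))
    (fun a => Gen.partials (fun i => Pi.single i (1 : ℝ)) (fun i => (a.2.1 i : ℕ))
      (Gen.clm (ContinuousLinearMap.proj (R := ℝ) (φ := fun _ : Fin q => ℝ) a.1) U)))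

variable {n}

/-- The value at `y` of the Taylor polynomial with `n`-jet `z` at the base point of `z`. -/
def taylor (w : (Fin p → ℝ) × Jet p q n) : Fin q → ℝ := fun α =>
  ∑ J : MIdx p n, w.2 (Sum.inr (α, J)) *
    ∏ i, ((w.1 i - w.2 (Sum.inl i)) ^ (J.1 i : ℕ) / ((J.1 i : ℕ).factorial : ℝ))

theorem hasTemperateGrowth_prod {D ι : Type} [NormedAddCommGroup D] [NormedSpace ℝ D]
    (s : Finset ι) (f : ι → D → ℝ) (h : ∀ i, (f i).HasTemperateGrowth) :
    Function.HasTemperateGrowth (fun x => ∏ i ∈ s, f i x) := by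
  classical
  induction s using Finset.induction_on with
  | empty => simp
  | insert i s hi ih =>
    simp only [Finset.prod_insert hi]
    exact (h i).fun_mul ih

theorem hasTemperateGrowth_pi {D ι : Type} [NormedAddCommGroup D] [NormedSpace ℝ D] [Fintype ι]
    (f : D → ι → ℝ) (h : ∀ i, Function.HasTemperateGrowth (fun x => f x i)) :
    f.HasTemperateGrowth := by
  classical
  have e : f = fun x => ∑ i, ContinuousLinearMap.single ℝ (fun _ : ι => ℝ) i (f x i) := by
    funext x
    exact (Finset.univ_sum_single (f x)).symm
  rw [e]
  exact Function.HasTemperateGrowth.sum fun i _ =>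
    (ContinuousLinearMap.single ℝ (fun _ : ι => ℝ) i).hasTemperateGrowth.comp (h i)

theorem taylor_hasTemperateGrowth : (taylor (p := p) (q := q) (n := n)).HasTemperateGrowth := by
  refine hasTemperateGrowth_pi _ fun α => Function.HasTemperateGrowth.sum fun J _ => ?_
  have e1 : ∀ j : JIdx p q n,
      Function.HasTemperateGrowth (fun w : (Fin p → ℝ) × Jet p q n => w.2 j) := fun j =>
    ((ContinuousLinearMap.proj (R := ℝ) (φ := fun _ : JIdx p q n => ℝ) j).comp
      (ContinuousLinearMap.snd ℝ (Fin p → ℝ) (Jet p q n))).hasTemperateGrowth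
  have e2 : ∀ i : Fin p,
      Function.HasTemperateGrowth (fun w : (Fin p → ℝ) × Jet p q n => w.1 i) := fun i =>
    ((ContinuousLinearMap.proj (R := ℝ) (φ := fun _ : Fin p => ℝ) i).comp
      (ContinuousLinearMap.fst ℝ (Fin p → ℝ) (Jet p q n))).hasTemperateGrowth
  refine (e1 _).fun_mul (hasTemperateGrowth_prod _ _ fun i => ?_)
  simp only [div_eq_mul_inv]
  exact (((e2 i).fun_sub (e1 _)).fun_pow _).fun_mul (Function.HasTemperateGrowth.const _)

end jets

section prolongation
variable {p q : ℕ}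

/-- The projectable map `Φ(η, (x, u)) = (Ξ_η(x), Ψ_η(x, u))`. -/
def projectable (Ξ : Mix ℝ (Fin p → ℝ) (Fin p → ℝ))
    (Ψ : Mix ℝ ((Fin p → ℝ) × (Fin q → ℝ)) (Fin q → ℝ)) :
    Mix ℝ ((Fin p → ℝ) × (Fin q → ℝ)) ((Fin p → ℝ) × (Fin q → ℝ)) :=
  Gen.pair (Gen.subst (ContinuousLinearMap.id ℝ ℝ) Ξ
    (Gen.linMix ((ContinuousLinearMap.fst ℝ (Fin p → ℝ) (Fin q → ℝ)).comp
      (ContinuousLinearMap.snd ℝ ℝ ((Fin p → ℝ) × (Fin q → ℝ)))))) Ψ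

/-- The action `Φ_η(U) = (x ↦ Ψ_η(Ξ_{-η}(x), U(Ξ_{-η}(x))))` of a projectable generalized group
action on `U ∈ 𝒢_τ(ℝ^p)^q`. -/
def act (Ξ : Mix ℝ (Fin p → ℝ) (Fin p → ℝ))
    (Ψ : Mix ℝ ((Fin p → ℝ) × (Fin q → ℝ)) (Fin q → ℝ)) (η : CptPt ℝ)
    (U : Temp (Fin p → ℝ) (Fin q → ℝ)) : Temp (Fin p → ℝ) (Fin q → ℝ) :=
  Gen.comp (Gen.slice Ψ η) (Gen.pair (Gen.slice Ξ (-η)) (Gen.comp U (Gen.slice Ξ (-η))))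

/-- For the Taylor polynomial `h_z` with `n`-jet `z`, the transformed function
`(η, (x, z)) ↦ Φ_η(h_z)(x) = Ψ_η(Ξ_{-η}(x), h_z(Ξ_{-η}(x)))`. -/
def actTaylor (n : ℕ) (Ξ : Mix ℝ (Fin p → ℝ) (Fin p → ℝ))
    (Ψ : Mix ℝ ((Fin p → ℝ) × (Fin q → ℝ)) (Fin q → ℝ)) :
    Mix ℝ ((Fin p → ℝ) × Jet p q n) (Fin q → ℝ) :=
  let Ξinv : Mix ℝ ((Fin p → ℝ) × Jet p q n) (Fin p → ℝ) :=
    Gen.subst (-ContinuousLinearMap.id ℝ ℝ) Ξ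
      (Gen.linMix ((ContinuousLinearMap.fst ℝ (Fin p → ℝ) (Jet p q n)).comp
        (ContinuousLinearMap.snd ℝ ℝ ((Fin p → ℝ) × Jet p q n))))
  let z : Mix ℝ ((Fin p → ℝ) × Jet p q n) (Jet p q n) :=
    Gen.linMix ((ContinuousLinearMap.snd ℝ (Fin p → ℝ) (Jet p q n)).comp
      (ContinuousLinearMap.snd ℝ ℝ ((Fin p → ℝ) × Jet p q n)))
  Gen.subst (ContinuousLinearMap.id ℝ ℝ) Ψ
    (Gen.pair Ξinv (Gen.comp (Gen.ofTemp taylor taylor_hasTemperateGrowth) (Gen.pair Ξinv z)))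

/-- The `n`-th prolongation of a projectable generalized group action,
`pr^{(n)} Φ(η, z) = (Ξ_η(x), pr^{(n)}(Φ_η(h_z))(Ξ_η(x)))`, where `x` is the base point of `z` and
`h_z` is the Taylor polynomial with `n`-jet `z` at `x`. The derivatives of `Φ_η(h_z)` are taken in
its argument, with `z` fixed; only then is `Ξ_η(x)` inserted. -/
def prolong (n : ℕ) (Ξ : Mix ℝ (Fin p → ℝ) (Fin p → ℝ))
    (Ψ : Mix ℝ ((Fin p → ℝ) × (Fin q → ℝ)) (Fin q → ℝ)) : Mix ℝ (Jet p q n) (Jet p q n) :=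
  let base : Mix ℝ (Jet p q n) (Fin p → ℝ) :=
    Gen.subst (ContinuousLinearMap.id ℝ ℝ) Ξ
      (Gen.linMix ((ContinuousLinearMap.pi fun i : Fin p =>
        ContinuousLinearMap.proj (R := ℝ) (φ := fun _ : JIdx p q n => ℝ) (Sum.inl i)).comp
          (ContinuousLinearMap.snd ℝ ℝ (Jet p q n))))
  let deriv : Fin q × MIdx p n → Mix ℝ ((Fin p → ℝ) × Jet p q n) ℝ := fun a =>
    Gen.partials (fun i => ((0, (Pi.single i 1, 0)) : ℝ × (Fin p → ℝ) × Jet p q n))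
      (fun i => (a.2.1 i : ℕ))
      (Gen.clm (ContinuousLinearMap.proj (R := ℝ) (φ := fun _ : Fin q => ℝ) a.1)
        (actTaylor n Ξ Ψ))
  Gen.pi (Sum.elim
    (fun i => Gen.clm (ContinuousLinearMap.proj (R := ℝ) (φ := fun _ : Fin p => ℝ) i) base)
    (fun a => Gen.subst (ContinuousLinearMap.id ℝ ℝ) (deriv a)
      (Gen.pair base (Gen.linMix (ContinuousLinearMap.snd ℝ ℝ (Jet p q n))))))

/-- `U ∈ 𝒢_τ(ℝ^p)^q` is a solution of the system `Δ_ν(x, U^{(n)}) = 0`, `1 ≤ ν ≤ l`. -/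
def IsSolution {n l : ℕ} (Δ : Temp (Jet p q n) (Fin l → ℝ))
    (U : Temp (Fin p → ℝ) (Fin q → ℝ)) : Prop :=
  Gen.comp Δ (Gen.jet n U) = 0

/-- The projectable generalized group action `(Ξ, Ψ)` is a symmetry group of the system
`Δ(x, U^{(n)}) = 0` in `𝒢_τ`: it transforms solutions into solutions. -/
def IsSymmetryGroup {n l : ℕ} (Ξ : Mix ℝ (Fin p → ℝ) (Fin p → ℝ))
    (Ψ : Mix ℝ ((Fin p → ℝ) × (Fin q → ℝ)) (Fin q → ℝ))
    (Δ : Temp (Jet p q n) (Fin l → ℝ)) : Prop :=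
  ∀ U, IsSolution Δ U → ∀ η : CptPt ℝ, IsSolution Δ (act Ξ Ψ η U)

end prolongation

section solved
variable {ι : Type} [Fintype ι] [DecidableEq ι] {l : ℕ} (i : Fin l → ι)

/-- The coordinates other than those singled out by `i`. -/
abbrev Rest : Type := {j : ι // ∀ ν, j ≠ i ν}

/-- The projection `z ↦ z'` to the remaining coordinates. -/
def restL : (ι → ℝ) →L[ℝ] (Rest i → ℝ) :=
  ContinuousLinearMap.pi fun j => ContinuousLinearMap.proj (R := ℝ) (φ := fun _ : ι => ℝ) j.1

/-- The projection `z ↦ (z_{i_1}, …, z_{i_l})` to the coordinates singled out by `i`. -/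
def selL : (ι → ℝ) →L[ℝ] (Fin l → ℝ) :=
  ContinuousLinearMap.pi fun ν => ContinuousLinearMap.proj (R := ℝ) (φ := fun _ : ι => ℝ) (i ν)

/-- The map `(z', w) ↦ z` that assembles `z` from the remaining coordinates `z'` and the singled
out ones `w` (for injective `i`). -/
def joinL : (Rest i → ℝ) × (Fin l → ℝ) →L[ℝ] (ι → ℝ) :=
  (∑ j : Rest i, (ContinuousLinearMap.single ℝ (fun _ : ι => ℝ) j.1).comp
    ((ContinuousLinearMap.proj (R := ℝ) (φ := fun _ : Rest i => ℝ) j).comp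
      (ContinuousLinearMap.fst ℝ (Rest i → ℝ) (Fin l → ℝ)))) +
  ∑ ν : Fin l, (ContinuousLinearMap.single ℝ (fun _ : ι => ℝ) (i ν)).comp
    ((ContinuousLinearMap.proj (R := ℝ) (φ := fun _ : Fin l => ℝ) ν).comp
      (ContinuousLinearMap.snd ℝ (Rest i → ℝ) (Fin l → ℝ)))

/-- The generalized function `F_ν(z) = z_{i_ν} - f_ν(z')`. -/
def solvedForm (f : Temp (Rest i → ℝ) (Fin l → ℝ)) : Temp (ι → ℝ) (Fin l → ℝ) :=
  Gen.linTemp (selL i) - Gen.comp f (Gen.linTemp (restL i))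

/-- The generalized vector field `z' ↦ ξ'(z', f(z'))` in the remaining coordinates. -/
def reducedField (f : Temp (Rest i → ℝ) (Fin l → ℝ)) (ξ : Temp (ι → ℝ) (ι → ℝ)) :
    Temp (Rest i → ℝ) (Rest i → ℝ) :=
  Gen.clm (restL i) (Gen.comp ξ (Gen.clm (joinL i)
    (Gen.pair (Gen.linTemp (ContinuousLinearMap.id ℝ (Rest i → ℝ))) f)))

end solved

end GenFun
end
open GenFun

/-! Infinitesimal invariance is integrated by a uniqueness argument on the jet space. Let `z` be a
generalized point with `Δ(z) = 0`, that is, a point of the graph of `f` over the remaining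
coordinates. Two curves start at `z`: the orbit `η ↦ pr Φ(η, z)`, and the lift `η ↦ (h(η, z'),
f(h(η, z')))` of the flow of the reduced system. The orbit is an integral curve of the prolonged
generator `ζ` by the group law (`GroupLaw.hasDeriv`). The lift solves the equations for the
remaining coordinates by construction. The criterion `pr X(Δ) = 0` on the graph says that the
selected components of `ζ` equal `Df(z')` applied to `ζ'`, which is the chain rule for the selected
coordinates of the lift; so the lift is an integral curve too. By 𝒢-completeness of `pr X` the two
agree in `𝒢(ℝ)`, so the orbit stays on the graph at every compactly supported time
(`solvedForm_invariant`).

For a solution `U` this is applied to its jet at `Ξ_{-η}(y)`. The prolonged action sends the jet of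
`U` at `x` to the jet of `Φ_η(U)` at `Ξ_η(x)` (`prolongFn_jetFn`), and `Ξ_η(Ξ_{-η}(y)) = y`, so `Δ`
vanishes on the jet of `Φ_η(U)` at every generalized point `y`.

The prolongation is defined through Taylor polynomials, so its group law needs proof
(`prolongFn_groupLaw`). The reason is that `Φ_η(v)` depends, up to order `n` at `Ξ_η(x)`, only on
the `n`-jet of `v` at `x`. On representatives `Ξ_{-η}` inverts `Ξ_η` only up to negligible errors,
so contact of order `n` has to be handled modulo negligible nets at generalized points; this is the
role of `Flat`.

Identities between generalized functions are checked at points: `Moderate.negl_of_points` for `𝒢_τ`,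
`Moderate.negl_of_cpt` for `𝒢`. Both rest on the fact that, for moderate nets, negligibility of
order zero implies negligibility of all derivatives. -/

noncomputable section
namespace GenFun
open Filter Topology Set
open scoped ContDiff
set_option linter.unusedSectionVars false

/-! ### Generalized points and point values on representatives. -/

section pointvalues
variable {D E F G : Type} [NormedAddCommGroup D] [NormedSpace ℝ D]
  [NormedAddCommGroup E] [NormedSpace ℝ E] [NormedAddCommGroup F] [NormedSpace ℝ F]
  [NormedAddCommGroup G] [NormedSpace ℝ G]

/-- Equality of the generalized points represented by two nets. -/
def PtEq (x y : Idx → E) : Prop := (fun ε => x ε - y ε) ∈ neglPts E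

theorem PtEq.refl (x : Idx → E) : PtEq x x := by
  have h := (neglPts E).zero_mem
  unfold PtEq
  convert h using 1
  funext ε
  simp

theorem PtEq.symm {x y : Idx → E} (h : PtEq x y) : PtEq y x := by
  have h := (neglPts E).neg_mem h
  unfold PtEq
  convert h using 1
  funext ε
  simp

theorem PtEq.trans {x y z : Idx → E} (h : PtEq x y) (h2 : PtEq y z) : PtEq x z := by
  have h := (neglPts E).add_mem h h2
  unfold PtEq
  convert h using 1
  funext ε
  simp

theorem ptEq_zero {x : Idx → E} : PtEq x (fun _ => 0) ↔ x ∈ neglPts E := by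
  unfold PtEq
  simp

theorem neglPts_le : neglPts E ≤ modPts E := fun x h => by
  refine ⟨0, ?_⟩
  filter_upwards [h 0] with ε h
  simpa using h

/-- At a point of moderate weight the polynomial factor costs only a fixed negative power of `ε`,
and the estimate holds with arbitrarily high powers of `ε`. -/
theorem BigN.eventually_le {γ : Regime D} {K : Set D} {b : Idx → D → ℝ} (h : BigN γ K b)
    {x : Idx → D} (hx : ∀ᶠ ε in small, x ε ∈ K) {r : ℕ}
    (hr : ∀ᶠ ε in small, γ.weight (x ε) ≤ ((ε : ℝ)⁻¹) ^ r) (q : ℕ) :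
    ∀ᶠ ε in small, b ε (x ε) ≤ (ε : ℝ) ^ q := by
  obtain ⟨p, h⟩ := h.pos
  -- The exponent `r * p` pays for the weight; the extra power of `ε` absorbs the constant `C * 2 ^
  -- p`.
  obtain ⟨C, hC, h⟩ := h p le_rfl (q + 1 + r * p)
  filter_upwards [h, hx, hr, small_le (C * 2 ^ p + 1)⁻¹ (by positivity)] with ε h hx hy h2
  have hε := ε.2.1
  have hinv := one_le_inv ε
  have h1 : (1 : ℝ) ≤ ((ε : ℝ)⁻¹) ^ r := one_le_pow₀ hinv
  have h3 : C * 2 ^ p + 1 ≤ (ε : ℝ)⁻¹ := by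
    rwa [le_inv_comm₀ (by positivity) ε.2.1]
  have h6 : C * 2 ^ p * (ε : ℝ) ≤ 1 := by
    have h7 : (ε : ℝ)⁻¹ * (ε : ℝ) = 1 := inv_mul_cancel₀ ε.2.1.ne'
    nlinarith [ε.2.1]
  have h8 : 1 + γ.weight (x ε) ≤ 2 * ((ε : ℝ)⁻¹) ^ r := by linarith
  have h9 := one_le_wt γ (x ε)
  have h10 : ((ε : ℝ) * (ε : ℝ)⁻¹) ^ (r * p) = 1 := by rw [mul_inv_cancel₀ hε.ne', one_pow]
  calc b ε (x ε) ≤ C * (ε : ℝ) ^ (q + 1 + r * p) * (1 + γ.weight (x ε)) ^ p := h _ hx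
    _ ≤ C * (ε : ℝ) ^ (q + 1 + r * p) * (2 * ((ε : ℝ)⁻¹) ^ r) ^ p := by gcongr
    _ = (C * 2 ^ p * (ε : ℝ)) * (ε : ℝ) ^ q * ((ε : ℝ) * (ε : ℝ)⁻¹) ^ (r * p) := by ring
    _ ≤ 1 * (ε : ℝ) ^ q * ((ε : ℝ) * (ε : ℝ)⁻¹) ^ (r * p) := by gcongr
    _ = _ := by rw [h10, mul_one, one_mul]

theorem Negl.mix_eval_mem {A : Type} [NormedAddCommGroup A] [NormedSpace ℝ A]
    {u : Idx → A × E → F} (hu : Negl (Regime.mix A E) u) {t : Idx → A} (ht : t ∈ cptPts A)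
    {x : Idx → E} (hx : x ∈ modPts E) : (fun ε => u ε (t ε, x ε)) ∈ neglPts F := by
  obtain ⟨K, hK, ht⟩ := ht
  obtain ⟨r, hr⟩ := hx
  intro q
  have h := (hu.2 _ ⟨K, hK, rfl⟩ 0).eventually_le (x := fun ε => (t ε, x ε))
    (ht.mono fun ε h => ⟨h, mem_univ _⟩) hr q
  simpa only [norm_iteratedFDeriv_zero] using h

theorem neglPts_of_norm_le {x : Idx → E} {y : Idx → F} (hy : y ∈ neglPts F)
    (h : ∀ ε, ‖x ε‖ ≤ ‖y ε‖) : x ∈ neglPts E := fun q => by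
  filter_upwards [hy q] with ε h2
  exact (h ε).trans h2

/-- A net of points is a net of constant functions on `ℝ`, evaluated at `0`; facts about nets of
functions thus transfer to points. The same device serves several of the following lemmas. -/
theorem neglPts_clm (L : E →L[ℝ] F) {x : Idx → E} (hx : x ∈ neglPts E) :
    (fun ε => L (x ε)) ∈ neglPts F :=
  ((negl_const (γ := Regime.loc ℝ) hx).clm L).at_mem (K := {0}) isCompact_singleton
    (x := (0 : ℝ)) rfl

theorem PtEq.clm (L : E →L[ℝ] F) {x y : Idx → E} (h : PtEq x y) :
    PtEq (fun ε => L (x ε)) (fun ε => L (y ε)) := by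
  have := neglPts_clm L h
  simpa only [PtEq, map_sub] using this

theorem modPts_clm (L : E →L[ℝ] F) {x : Idx → E} (hx : x ∈ modPts E) :
    (fun ε => L (x ε)) ∈ modPts F :=
  ((moderate_const (γ := Regime.loc ℝ) hx).clm L).at_mem (K := {0}) isCompact_singleton
    (x := (0 : ℝ)) rfl

theorem modPts_prod {x : Idx → E} {y : Idx → F} (hx : x ∈ modPts E) (hy : y ∈ modPts F) :
    (fun ε => (x ε, y ε)) ∈ modPts (E × F) :=
  ((moderate_const (γ := Regime.loc ℝ) hx).prodMk (moderate_const hy)).at_mem (K := {0})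
    isCompact_singleton (x := (0 : ℝ)) rfl

theorem PtEq.prod {x x' : Idx → E} {y y' : Idx → F} (hx : PtEq x x') (hy : PtEq y y') :
    PtEq (fun ε => (x ε, y ε)) (fun ε => (x' ε, y' ε)) :=
  ((negl_const (γ := Regime.loc ℝ) hx).prodMk (negl_const hy)).at_mem (K := {0})
    isCompact_singleton (x := (0 : ℝ)) rfl

theorem PtEq.mem_modPts {x y : Idx → E} (h : PtEq x y) (hy : y ∈ modPts E) : x ∈ modPts E := by
  have h := (modPts E).add_mem (neglPts_le h) hy
  convert h using 1
  funext ε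
  simp

theorem PtEq.of_pi {ι : Type} [Fintype ι] {x y : Idx → ι → ℝ}
    (h : ∀ i, PtEq (fun ε => x ε i) (fun ε => y ε i)) : PtEq x y := by
  intro q
  filter_upwards [eventually_all.2 fun i => h i q] with ε h
  exact (pi_norm_le_iff_of_nonneg (pow_nonneg ε.2.1.le q)).2 h

theorem Moderate.eval_mem {u : Idx → E → F} (hu : Moderate (Regime.temp E) u) {x : Idx → E}
    (hx : x ∈ modPts E) : (fun ε => u ε (x ε)) ∈ modPts F :=
  (Moderate.comp (γ := Regime.loc ℝ) (f := fun ε (_ : ℝ) => x ε) hu (moderate_const hx)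
    (tame_temp (moderate_const hx) (moderate_const hx))).at_mem (K := {0}) isCompact_singleton
    (x := (0 : ℝ)) rfl

theorem Negl.eval_mem {u : Idx → E → F} (hu : Negl (Regime.temp E) u) {x : Idx → E}
    (hx : x ∈ modPts E) : (fun ε => u ε (x ε)) ∈ neglPts F :=
  (Negl.comp (γ := Regime.loc ℝ) (f := fun ε (_ : ℝ) => x ε) hu (moderate_const hx)
    (tame_temp (moderate_const hx) (moderate_const hx))).at_mem (K := {0}) isCompact_singleton
    (x := (0 : ℝ)) rfl

/-- The mean value estimate inside `Negl.comp_sub`, for inner nets that are constant in an auxiliary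
real variable. -/
theorem Moderate.eval_congr {u : Idx → E → F} (hu : Moderate (Regime.temp E) u) {x y : Idx → E}
    (hx : x ∈ modPts E) (hxy : PtEq x y) : PtEq (fun ε => u ε (x ε)) (fun ε => u ε (y ε)) := by
  have hy := hxy.symm.mem_modPts hx
  have h0 : Negl (Regime.temp E) (u - u) := by rw [sub_self]; exact Negl.zero
  have h3 := Negl.comp_sub (γ := Regime.loc ℝ) (f := fun ε (_ : ℝ) => y ε)
    (f' := fun ε (_ : ℝ) => x ε) hu h0 (moderate_const hy) (moderate_const hx)
    (negl_const hxy) (tame_temp (moderate_const hy) (moderate_const hx))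
  exact h3.at_mem (K := {0}) isCompact_singleton (x := (0 : ℝ)) rfl

theorem moderate_id : Moderate (Regime.temp E) (fun _ x => x) :=
  (slow_temp Function.HasTemperateGrowth.id).moderate

theorem Moderate.slice {u : Idx → ℝ × E → F} (hu : Moderate (Regime.mix ℝ E) u) {t : Idx → ℝ}
    (ht : t ∈ cptPts ℝ) : Moderate (Regime.temp E) (fun ε x => u ε (t ε, x)) :=
  Moderate.comp (f := fun ε x => (t ε, x)) hu
    ((moderate_const (cptPts_le ht)).prodMk moderate_id) (tame_slice ht ht)

theorem Moderate.mix_eval_mem {u : Idx → ℝ × E → F} (hu : Moderate (Regime.mix ℝ E) u)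
    {t : Idx → ℝ} (ht : t ∈ cptPts ℝ) {x : Idx → E} (hx : x ∈ modPts E) :
    (fun ε => u ε (t ε, x ε)) ∈ modPts F :=
  (hu.slice ht).eval_mem hx

theorem Moderate.mix_eval_congr {u : Idx → ℝ × E → F} (hu : Moderate (Regime.mix ℝ E) u)
    {t : Idx → ℝ} (ht : t ∈ cptPts ℝ) {x y : Idx → E} (hx : x ∈ modPts E) (hxy : PtEq x y) :
    PtEq (fun ε => u ε (t ε, x ε)) (fun ε => u ε (t ε, y ε)) :=
  (hu.slice ht).eval_congr hx hxy

/-- A moderate net of the mixed algebra, along a translated curve in the first variable and at a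
generalized point in the second one. -/
theorem Moderate.curve {u : Idx → ℝ × E → F} (hu : Moderate (Regime.mix ℝ E) u)
    {t : Idx → ℝ} (ht : t ∈ cptPts ℝ) {x : Idx → E} (hx : x ∈ modPts E) :
    Moderate (Regime.loc ℝ) (fun ε s => u ε (s + t ε, x ε)) := by
  -- The weight of the local regime is zero, so the bounds on the identity come from compactness of
  -- `K`.
  have hid : Moderate (Regime.loc ℝ) (fun _ (s : ℝ) => s) := by
    refine Slow.moderate ⟨contDiff_id, fun K hK k => ?_⟩
    obtain ⟨M, hM⟩ := IsCompact.exists_bound_of_continuousOn hK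
      ((contDiff_id (𝕜 := ℝ) (E := ℝ) (n := ∞)).continuous_iteratedFDeriv (m := k)
        (lt_inf k)).continuousOn
    exact ⟨0, M, fun s hs => by rw [pow_zero, mul_one]; exact hM s hs⟩
  have hf := (hid.add (moderate_const (γ := Regime.loc ℝ) (cptPts_le ht))).prodMk
    (moderate_const (γ := Regime.loc ℝ) hx)
  refine Moderate.comp (f := fun ε s => (s + t ε, x ε)) hu hf ?_
  intro l hl K hK
  have hb : ∃ K1 : Set ℝ, IsCompact K1 ∧ ∀ᶠ ε in l, t ε ∈ K1 := by
    rcases hl with rfl | ⟨ε, rfl⟩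
    · exact ht
    · exact ⟨{t ε}, isCompact_singleton, by simp⟩
  obtain ⟨K1, hK1, h1⟩ := hb
  refine ⟨((fun z : ℝ × ℝ => z.1 + z.2) '' (K ×ˢ K1)) ×ˢ univ,
    ⟨_, (IsCompact.prod hK hK1).image continuous_add, rfl⟩, fun ε _ => 1 + ‖x ε‖,
    (BigM.const 1).add (bigM_norm (moderate_const (γ := Regime.loc ℝ) hx) hl hK), ?_⟩
  filter_upwards [h1] with ε h1 s hs y hy
  rw [segment_same, mem_singleton_iff] at hy
  subst hy
  exact ⟨⟨⟨(s, t ε), ⟨hs, h1⟩, rfl⟩, mem_univ _⟩, le_rfl⟩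

theorem Negl.eval_cpt {u : Idx → D → F} (hu : Negl (Regime.loc D) u) {t : Idx → D}
    (ht : t ∈ cptPts D) : (fun ε => u ε (t ε)) ∈ neglPts F := by
  obtain ⟨K, hK, hKt⟩ := ht
  intro q
  have h := (hu.2 K hK 0).eventually_le hKt (r := 0)
    (Eventually.of_forall fun ε => by rw [pow_zero]; exact zero_le_one) q
  simpa only [norm_iteratedFDeriv_zero] using h

/-! ### Negligibility from estimates of order zero. -/

/-- Regimes whose sets can be enlarged by a unit ball with a moderate change of the weight. -/
def Thick (γ : Regime D) : Prop :=
  ∀ K ∈ γ.sets, ∃ K' ∈ γ.sets, ∀ x ∈ K, ∀ y, ‖y - x‖ ≤ 1 →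
    y ∈ K' ∧ 1 + γ.weight y ≤ 2 * (1 + γ.weight x)

theorem thick_temp : Thick (Regime.temp D) := by
  rintro _ rfl
  refine ⟨univ, rfl, fun x _ y hy => ⟨mem_univ _, ?_⟩⟩
  have h := norm_le_norm_add_norm_sub x y
  rw [norm_sub_rev] at h
  change 1 + ‖y‖ ≤ 2 * (1 + ‖x‖)
  linarith [norm_nonneg x]

theorem thick_loc [ProperSpace D] : Thick (Regime.loc D) := by
  intro K hK
  refine ⟨Metric.cthickening 1 K, IsCompact.cthickening hK, fun x hx y hy => ⟨?_, ?_⟩⟩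
  · exact Metric.mem_cthickening_of_dist_le y x 1 K hx (by rwa [dist_eq_norm])
  · change (1 : ℝ) + 0 ≤ 2 * (1 + 0)
    norm_num

/-- For a unit vector `e`, the increment `u(x + he) - u(x)` differs from `h Du(x)e` by at most `M
h²`; divide by `h`. Since `h` is free, smallness of `u` can be traded for smallness of `Du` when the
second derivative is merely moderate. -/
theorem norm_fderiv_le_of_bound {u : D → F} (hu : ContDiff ℝ ∞ u) {x : D} {h a M : ℝ}
    (h0 : 0 < h) (ha : ∀ y, ‖y - x‖ ≤ h → ‖u y‖ ≤ a) (hM0 : 0 ≤ M)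
    (hM : ∀ y, ‖y - x‖ ≤ h → ‖fderiv ℝ (fderiv ℝ u) y‖ ≤ M) :
    ‖fderiv ℝ u x‖ ≤ 2 * a / h + M * h := by
  have ha0 : 0 ≤ a := (norm_nonneg _).trans (ha x (by simpa using h0.le))
  have hd : ∀ y, DifferentiableAt ℝ u y := fun y => (hu.differentiable (by simp)).differentiableAt
  have hd2 : ∀ y, DifferentiableAt ℝ (fderiv ℝ u) y := fun y =>
    ((hu.fderiv_right (m := ∞) (by simp)).differentiable (by simp)).differentiableAt
  have hxx : x ∈ Metric.closedBall x h := Metric.mem_closedBall_self h0.le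
  have hmem : ∀ y ∈ Metric.closedBall x h, ‖y - x‖ ≤ h := fun y hy => by
    rwa [Metric.mem_closedBall, dist_eq_norm] at hy
  refine ContinuousLinearMap.opNorm_le_of_unit_norm (by positivity) fun e he => ?_
  have hy : x + h • e ∈ Metric.closedBall x h := by
    rw [Metric.mem_closedBall, dist_eq_norm, add_sub_cancel_left, norm_smul, he,
      Real.norm_of_nonneg h0.le, mul_one]
  have h1 := (convex_closedBall x h).norm_image_sub_le_of_norm_fderiv_le' (𝕜 := ℝ) (f := u)
    (φ := fderiv ℝ u x) (C := M * h) (fun y _ => hd y) (fun y hy => by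
      refine ((convex_closedBall x h).norm_image_sub_le_of_norm_fderiv_le (𝕜 := ℝ)
        (fun y _ => hd2 y) (fun y hy => hM y (hmem y hy)) hxx hy).trans ?_
      gcongr
      exact hmem y hy) hxx hy
  rw [add_sub_cancel_left, norm_smul, he, Real.norm_of_nonneg h0.le, mul_one] at h1
  have h2 : ‖h • (fderiv ℝ u x e)‖ ≤ ‖u (x + h • e)‖ + ‖u x‖ + M * h * h := by
    rw [← map_smul]
    have h3 : fderiv ℝ u x (h • e) = u (x + h • e) - u x -
        (u (x + h • e) - u x - fderiv ℝ u x (h • e)) := by abel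
    rw [h3]
    refine (norm_sub_le _ _).trans (add_le_add (norm_sub_le _ _) h1)
  rw [norm_smul, Real.norm_of_nonneg h0.le] at h2
  have h4 := ha _ (hmem _ hy)
  have h5 := ha _ (hmem _ hxx)
  have h6 : h * ‖fderiv ℝ u x e‖ ≤ h * (2 * a / h + M * h) := by
    have : h * (2 * a / h + M * h) = 2 * a + M * h * h := by field_simp
    rw [this]
    linarith
  exact le_of_mul_le_mul_left h6 h0

theorem bigN_fderiv {γ : Regime D} (hγ : Thick γ) {u : Idx → D → F} (hu : Moderate γ u)
    (h0 : ∀ K ∈ γ.sets, BigN γ K (fun ε x => ‖u ε x‖)) {K : Set D} (hK : K ∈ γ.sets) :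
    BigN γ K (fun ε x => ‖fderiv ℝ (u ε) x‖) := by
  obtain ⟨K', hK', hKK⟩ := hγ K hK
  obtain ⟨p1, h1⟩ := (h0 K' hK').pos
  have hM := hu.fderiv.fderiv.2 K' hK' 0
  simp only [norm_iteratedFDeriv_zero] at hM
  obtain ⟨p2, C2, hC2, h2⟩ := hM.pos
  set P := max p1 p2
  refine ⟨P, fun q => ?_⟩
  obtain ⟨C1, hC1, h1⟩ := h1 P (le_max_left _ _) (P + 2 * q)
  refine ⟨(2 * C1 + C2) * 2 ^ P, ?_⟩
  filter_upwards [h1, h2 P (le_max_right _ _)] with ε h1 h2 x hx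
  have hε := ε.2.1
  have hW := one_le_wt γ x
  have hh1 : (ε : ℝ) ^ (P + q) ≤ 1 := pow_le_one₀ hε.le ε.2.2
  have hinv := one_le_inv ε
  -- With step size `ε^(P+q)`, a bound on `u` of order `ε^(P+2q)` and one on the second derivative
  -- of order `ε^(-P)`, both terms are of order `ε^q`. The factor `2 ^ P` comes from the doubled
  -- weight on the enlarged set.
  refine (norm_fderiv_le_of_bound (hu.smooth ε) (h := (ε : ℝ) ^ (P + q))
    (a := C1 * (ε : ℝ) ^ (P + 2 * q) * (2 * (1 + γ.weight x)) ^ P)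
    (M := C2 * ((ε : ℝ)⁻¹) ^ P * (2 * (1 + γ.weight x)) ^ P) (by positivity) ?_ (by positivity)
    ?_).trans ?_
  · intro y hy
    obtain ⟨hy1, hy2⟩ := hKK x hx y (hy.trans hh1)
    refine (h1 y hy1).trans ?_
    have := one_le_wt γ y
    gcongr
  · intro y hy
    obtain ⟨hy1, hy2⟩ := hKK x hx y (hy.trans hh1)
    refine (h2 y hy1).trans ?_
    have := one_le_wt γ y
    gcongr
  · apply le_of_eq
    have e0 : (ε : ℝ) ≠ 0 := hε.ne'
    rw [inv_pow, mul_pow]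
    field_simp
    ring

/-- Induction on the order, passing from `u` to its derivative; the target space varies because the
derivative is operator-valued. -/
theorem bigN_iteratedFDeriv {γ : Regime D} (hγ : Thick γ) (k : ℕ) :
    ∀ (F : Type) [NormedAddCommGroup F] [NormedSpace ℝ F] (u : Idx → D → F), Moderate γ u →
      (∀ K ∈ γ.sets, BigN γ K (fun ε x => ‖u ε x‖)) → ∀ K ∈ γ.sets,
      BigN γ K (fun ε x => ‖iteratedFDeriv ℝ k (u ε) x‖) := by
  induction k with
  | zero =>
    intro F _ _ u _ h0 K hK
    simpa using h0 K hK
  | succ k ih =>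
    intro F _ _ u hu h0 K hK
    simp only [← norm_iteratedFDeriv_fderiv]
    exact ih _ _ hu.fderiv (fun K hK => bigN_fderiv hγ hu h0 hK) K hK

/-- For a moderate net, the negligibility estimates of order zero imply those of all orders. -/
theorem Moderate.negl_of_order_zero {γ : Regime D} (hγ : Thick γ) {u : Idx → D → F}
    (hu : Moderate γ u) (h0 : ∀ K ∈ γ.sets, BigN γ K (fun ε x => ‖u ε x‖)) : Negl γ u :=
  ⟨hu.1, fun K hK k => bigN_iteratedFDeriv hγ k F u hu h0 K hK⟩

/-- Generalized functions in `𝒢` are determined by their values at compactly supported points. -/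
theorem Moderate.negl_of_cpt [ProperSpace D] {u : Idx → D → F} (hu : Moderate (Regime.loc D) u)
    (h : ∀ x ∈ cptPts D, (fun ε => u ε (x ε)) ∈ neglPts F) : Negl (Regime.loc D) u := by
  classical
  refine hu.negl_of_order_zero thick_loc fun K hK => ⟨0, fun q => ⟨1, ?_⟩⟩
  rcases K.eq_empty_or_nonempty with rfl | ⟨x0, hx0⟩
  · simp
  -- For each `ε` pick a point of `K` that violates the bound, if there is one. The hypothesis at
  -- this net of points shows that for small `ε` there is none.
  let x : Idx → D := fun ε =>
    if h : ∃ x ∈ K, (ε : ℝ) ^ q < ‖u ε x‖ then h.choose else x0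
  have hx : x ∈ cptPts D := by
    refine ⟨K, hK, Eventually.of_forall fun ε => ?_⟩
    by_cases h : ∃ x ∈ K, (ε : ℝ) ^ q < ‖u ε x‖
    · simp only [x, dif_pos h]
      exact h.choose_spec.1
    · simpa only [x, dif_neg h] using hx0
  filter_upwards [h x hx q] with ε h2 y hy
  rw [one_mul, pow_zero, mul_one]
  by_contra! hc
  have h : ∃ x ∈ K, (ε : ℝ) ^ q < ‖u ε x‖ := ⟨y, hy, hc⟩
  simp only [x, dif_pos h] at h2
  exact absurd h.choose_spec.2 (not_lt.2 h2)

/-- Tempered generalized functions are determined by their values at generalized points. -/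
theorem Moderate.negl_of_points {u : Idx → E → F} (hu : Moderate (Regime.temp E) u)
    (h : ∀ x ∈ modPts E, (fun ε => u ε (x ε)) ∈ neglPts F) : Negl (Regime.temp E) u := by
  classical
  refine hu.negl_of_order_zero thick_temp fun K hK => ?_
  have hb := hu.2 K hK 0
  simp only [norm_iteratedFDeriv_zero] at hb
  obtain ⟨p, C, hC, hb⟩ := hb.pos
  -- The exponent of the weight must not depend on `q`. In the ball of radius `ε^(-(q+p))` point
  -- values give the bound. Outside, the moderate bound suffices: one more factor `1 + ‖y‖` exceeds
  -- `ε^(-(q+p))` and so turns `ε^(-p)` into `ε^q`.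
  refine ⟨p + 1, fun q => ⟨C + 1, ?_⟩⟩
  -- A violating point is chosen inside the ball only, which makes the net moderate.
  let x : Idx → E := fun ε =>
    if h : ∃ x, ‖x‖ ≤ ((ε : ℝ)⁻¹) ^ (q + p) ∧ (ε : ℝ) ^ q < ‖u ε x‖ then h.choose else 0
  have hx : x ∈ modPts E := by
    refine ⟨q + p, Eventually.of_forall fun ε => ?_⟩
    by_cases h : ∃ x, ‖x‖ ≤ ((ε : ℝ)⁻¹) ^ (q + p) ∧ (ε : ℝ) ^ q < ‖u ε x‖
    · simp only [x, dif_pos h]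
      exact h.choose_spec.1
    · have := one_le_inv ε
      simp only [x, dif_neg h, norm_zero]
      positivity
  filter_upwards [h x hx q, hb p le_rfl] with ε h2 hb y hyK
  have hε := ε.2.1
  change ‖u ε y‖ ≤ (C + 1) * (ε : ℝ) ^ q * (1 + ‖y‖) ^ (p + 1)
  have hW : 1 ≤ 1 + ‖y‖ := by linarith [norm_nonneg y]
  rcases le_or_gt ‖y‖ (((ε : ℝ)⁻¹) ^ (q + p)) with hy | hy
  · have h3 : ‖u ε y‖ ≤ (ε : ℝ) ^ q := by
      by_contra! hc
      have h : ∃ x, ‖x‖ ≤ ((ε : ℝ)⁻¹) ^ (q + p) ∧ (ε : ℝ) ^ q < ‖u ε x‖ := ⟨y, hy, hc⟩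
      simp only [x, dif_pos h] at h2
      exact absurd h.choose_spec.2 (not_lt.2 h2)
    refine h3.trans ?_
    have h4 : 1 ≤ (1 + ‖y‖) ^ (p + 1) := one_le_pow₀ hW
    have h5 : 0 ≤ (ε : ℝ) ^ q := by positivity
    calc (ε : ℝ) ^ q = 1 * (ε : ℝ) ^ q * 1 := by ring
      _ ≤ _ := by gcongr; linarith
  · have h3 := hb y hyK
    change ‖u ε y‖ ≤ C * ((ε : ℝ)⁻¹) ^ p * (1 + ‖y‖) ^ p at h3
    have h4 : 1 ≤ (ε : ℝ) ^ (q + p) * (1 + ‖y‖) := by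
      have h5 : (ε : ℝ) ^ (q + p) * ((ε : ℝ)⁻¹) ^ (q + p) = 1 := by
        rw [← mul_pow, mul_inv_cancel₀ hε.ne', one_pow]
      have h6 : 0 ≤ (ε : ℝ) ^ (q + p) := by positivity
      nlinarith
    have hinv := one_le_inv ε
    calc ‖u ε y‖ ≤ C * ((ε : ℝ)⁻¹) ^ p * (1 + ‖y‖) ^ p * 1 := by rw [mul_one]; exact h3
      _ ≤ C * ((ε : ℝ)⁻¹) ^ p * (1 + ‖y‖) ^ p * ((ε : ℝ) ^ (q + p) * (1 + ‖y‖)) := by gcongr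
      _ = C * (ε : ℝ) ^ q * (1 + ‖y‖) ^ (p + 1) * ((ε : ℝ) * (ε : ℝ)⁻¹) ^ p := by ring
      _ = C * (ε : ℝ) ^ q * (1 + ‖y‖) ^ (p + 1) := by rw [mul_inv_cancel₀ hε.ne']; simp
      _ ≤ _ := by gcongr; linarith

end pointvalues

/-! ### Iterated partial derivatives along lists of directions. -/

section partials
variable {D E F G : Type} [NormedAddCommGroup D] [NormedSpace ℝ D]
  [NormedAddCommGroup E] [NormedSpace ℝ E] [NormedAddCommGroup F] [NormedSpace ℝ F]
  [NormedAddCommGroup G] [NormedSpace ℝ G] {p : ℕ}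

/-- The iterated derivative `∂_{e_{i_1}} ⋯ ∂_{e_{i_k}} f` for a list `[i_1, …, i_k]`. -/
def pdList (e : Fin p → D) (l : List (Fin p)) (f : D → F) : D → F :=
  l.foldr (fun i W x => fderiv ℝ W x (e i)) f

/-- The list that contains each index `i` exactly `J i` times. -/
def idxList (J : Fin p → ℕ) : List (Fin p) :=
  (List.finRange p).flatMap fun i => List.replicate (J i) i

theorem count_idxList (J : Fin p → ℕ) (i : Fin p) : (idxList J).count i = J i := by
  rw [idxList, List.count_flatMap]
  have h : (List.map (List.count i ∘ fun i => List.replicate (J i) i) (List.finRange p)).sum =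
      ∑ j, if j = i then J j else 0 := by
    rw [← List.sum_ofFn, List.ofFn_eq_map]
    congr 1
    refine List.map_congr_left fun j _ => ?_
    simp [List.count_replicate]
  rw [h]
  simp

theorem length_idxList (J : Fin p → ℕ) : (idxList J).length = ∑ i, J i := by
  rw [idxList, List.length_flatMap, ← List.sum_ofFn, List.ofFn_eq_map]
  simp

theorem pdList_cons (e : Fin p → D) (i : Fin p) (l : List (Fin p)) (f : D → F) (x : D) :
    pdList e (i :: l) f x = fderiv ℝ (pdList e l f) x (e i) := rfl

theorem pdList_contDiff (e : Fin p → D) (l : List (Fin p)) {f : D → F} (hf : ContDiff ℝ ∞ f) :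
    ContDiff ℝ ∞ (pdList e l f) := by
  induction l with
  | nil => exact hf
  | cons i l ih => exact (ih.fderiv_right (m := ∞) (by simp)).clm_apply contDiff_const

/-- Symmetry of second derivatives settles a transposition of neighbours, and these generate all
permutations. -/
theorem pdList_perm (e : Fin p → D) {l l' : List (Fin p)} (h : l.Perm l') {f : D → F}
    (hf : ContDiff ℝ ∞ f) : pdList e l f = pdList e l' f := by
  induction h with
  | nil => rfl
  | cons i _ ih =>
    funext x
    rw [pdList_cons, pdList_cons, ih]
  | swap i j l =>
    have hg := pdList_contDiff e l hf
    set g := pdList e l f with hgdef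
    have hd : ∀ x, DifferentiableAt ℝ (fderiv ℝ g) x := fun x =>
      ((hg.fderiv_right (m := ∞) (by simp)).differentiable (by simp)).differentiableAt
    have key : ∀ (a b : D) (x : D),
        fderiv ℝ (fun z => fderiv ℝ g z a) x b = fderiv ℝ (fderiv ℝ g) x b a := by
      intro a b x
      rw [fderiv_clm_apply (hd x) (differentiableAt_const a)]
      simp
    funext x
    have hs : IsSymmSndFDerivAt ℝ g x := hg.contDiffAt.isSymmSndFDerivAt
      (by rw [minSmoothness_of_isRCLikeNormedField]; exact lt_inf 2)
    change fderiv ℝ (fun z => fderiv ℝ g z (e i)) x (e j) =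
      fderiv ℝ (fun z => fderiv ℝ g z (e j)) x (e i)
    rw [key, key]
    exact hs _ _
  | trans _ _ ih1 ih2 => exact ih1.trans ih2

/-- The head of the list is the outermost derivative, which is the first slot of the iterated
derivative. -/
theorem pdList_ofFn (e : Fin p → D) {f : D → F} (hf : ContDiff ℝ ∞ f) (k : ℕ) (v : Fin k → Fin p)
    (x : D) : pdList e (List.ofFn v) f x = iteratedFDeriv ℝ k f x (fun j => e (v j)) := by
  induction k generalizing x with
  | zero => simp [pdList]
  | succ k ih =>
    have h1 : pdList e (List.ofFn fun j : Fin k => v j.succ) f =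
        fun y => iteratedFDeriv ℝ k f y (fun j => e (v j.succ)) := funext fun y => ih _ y
    rw [List.ofFn_succ, pdList_cons, h1, iteratedFDeriv_succ_apply_left]
    have hd : DifferentiableAt ℝ (iteratedFDeriv ℝ k f) x :=
      (hf.differentiable_iteratedFDeriv (m := k)
        (by exact_mod_cast (WithTop.coe_lt_top (k : ℕ)))).differentiableAt
    have h2 := ((ContinuousMultilinearMap.apply ℝ (fun _ : Fin k => D) F
      (fun j => e (v j.succ))).hasFDerivAt.comp x hd.hasFDerivAt).fderiv
    exact congrArg (fun L : D →L[ℝ] F => L (e (v 0))) h2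

theorem norm_pdList_le (e : Fin p → D) (he : ∀ i, ‖e i‖ ≤ 1) {f : D → F} (hf : ContDiff ℝ ∞ f)
    (l : List (Fin p)) (x : D) : ‖pdList e l f x‖ ≤ ‖iteratedFDeriv ℝ l.length f x‖ := by
  have h := pdList_ofFn e hf l.length l.get x
  rw [List.ofFn_get] at h
  rw [h]
  refine (ContinuousMultilinearMap.le_opNorm _ _).trans ?_
  exact mul_le_of_le_one_right (norm_nonneg _)
    (Finset.prod_le_one (fun _ _ => norm_nonneg _) fun j _ => he _)

/-- The standard basis vectors of `ℝ^p`. -/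
def stdVec (i : Fin p) : Fin p → ℝ := Pi.single i 1

theorem norm_stdVec (i : Fin p) : ‖stdVec i‖ ≤ 1 := by
  refine (pi_norm_le_iff_of_nonneg zero_le_one).2 fun j => ?_
  rcases eq_or_ne j i with rfl | h
  · simp [stdVec]
  · simp [stdVec, h]

/-- The derivatives of order `k` are determined by the partial derivatives of order `k`. -/
theorem iteratedFDeriv_eq_of_partials {f g : (Fin p → ℝ) → F} (hf : ContDiff ℝ ∞ f)
    (hg : ContDiff ℝ ∞ g) {x : Fin p → ℝ} {k : ℕ}
    (h : ∀ J : Fin p → ℕ, ∑ i, J i = k →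
      pdList stdVec (idxList J) f x = pdList stdVec (idxList J) g x) :
    iteratedFDeriv ℝ k f x = iteratedFDeriv ℝ k g x := by
  apply ContinuousMultilinearMap.toMultilinearMap_injective
  refine Module.Basis.ext_multilinear (fun _ => Pi.basisFun ℝ (Fin p)) fun v => ?_
  have e : (fun j => (Pi.basisFun ℝ (Fin p)) (v j)) = fun j => stdVec (v j) := by
    funext j
    simp [stdVec]
  change iteratedFDeriv ℝ k f x (fun j => (Pi.basisFun ℝ (Fin p)) (v j)) =
    iteratedFDeriv ℝ k g x (fun j => (Pi.basisFun ℝ (Fin p)) (v j))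
  rw [e, ← pdList_ofFn stdVec hf, ← pdList_ofFn stdVec hg]
  -- Sorting a tuple of basis directions leaves only its multiplicities, that is, a multi-index of
  -- order `k`.
  have hp : (List.ofFn v).Perm (idxList fun i => (List.ofFn v).count i) :=
    List.perm_iff_count.2 fun i => by rw [count_idxList]
  rw [pdList_perm stdVec hp hf, pdList_perm stdVec hp hg]
  refine h _ ?_
  rw [← length_idxList, ← hp.length_eq, List.length_ofFn]

/-- Chain rule for an inner map with constant derivative `L`. It is needed for slices in which the
time and the jet are frozen. -/
theorem pdList_affine (e : Fin p → D) (L : D →L[ℝ] E) (a : E) (l : List (Fin p)) {f : E → F}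
    (hf : ContDiff ℝ ∞ f) (y : D) :
    pdList (fun i => L (e i)) l f (a + L y) = pdList e l (fun y => f (a + L y)) y := by
  induction l generalizing y with
  | nil => rfl
  | cons i l ih =>
    have h1 : pdList e l (fun y => f (a + L y)) =
        fun y => pdList (fun i => L (e i)) l f (a + L y) := funext fun y => (ih y).symm
    rw [pdList_cons, pdList_cons, h1]
    have hd : DifferentiableAt ℝ (pdList (fun i => L (e i)) l f) (a + L y) :=
      ((pdList_contDiff _ l hf).differentiable (by simp)).differentiableAt
    have h2 := (hd.hasFDerivAt.comp y (L.hasFDerivAt.const_add a)).fderiv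
    exact (congrArg (fun T : D →L[ℝ] F => T (e i)) h2).symm

theorem pdList_sum {ι : Type} (s : Finset ι) (e : Fin p → D) (l : List (Fin p)) (c : ι → ℝ)
    (f : ι → D → ℝ) (hf : ∀ i, ContDiff ℝ ∞ (f i)) :
    pdList e l (fun y => ∑ i ∈ s, c i * f i y) =
      fun y => ∑ i ∈ s, c i * pdList e l (f i) y := by
  induction l with
  | nil => rfl
  | cons j l ih =>
    funext y
    have hd : ∀ i, DifferentiableAt ℝ (pdList e l (f i)) y := fun i =>
      ((pdList_contDiff e l (hf i)).differentiable (by simp)).differentiableAt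
    rw [pdList_cons, ih, fderiv_fun_sum fun i _ => (hd i).const_mul (c i)]
    simp only [FunLike.coe_sum, Finset.sum_apply]
    refine Finset.sum_congr rfl fun i _ => ?_
    rw [fderiv_const_mul (hd i)]
    rfl

/-! ### Derivatives of Taylor monomials. -/

/-- The Taylor monomial `(y - x)^K / K!`. -/
def mono (x : Fin p → ℝ) (K : Fin p → ℕ) (y : Fin p → ℝ) : ℝ :=
  ∏ i, ((y i - x i) ^ K i / ((K i).factorial : ℝ))

theorem mono_contDiff (x : Fin p → ℝ) (K : Fin p → ℕ) : ContDiff ℝ ∞ (mono x K) := by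
  unfold mono
  refine contDiff_prod fun i _ => ?_
  exact (((contDiff_apply ℝ ℝ i).sub contDiff_const).pow _).div_const _

/-- The exponent produced by differentiation cancels against the factorial. The case `k = 0` is
separate because `k - 1` is truncated. -/
theorem hasDerivAt_mono_factor (a : ℝ) (k : ℕ) (b : ℝ) :
    HasDerivAt (fun t : ℝ => (b + t - a) ^ k / (k.factorial : ℝ))
      (if k = 0 then 0 else (b - a) ^ (k - 1) / ((k - 1).factorial : ℝ)) 0 := by
  have h : HasDerivAt (fun t : ℝ => b + t - a) 1 0 :=
    ((hasDerivAt_id (0 : ℝ)).const_add b).sub_const a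
  have h2 := (h.pow k).div_const (k.factorial : ℝ)
  refine h2.congr_deriv ?_
  rcases k with _ | k
  · simp
  · have : ((k + 1 : ℕ) : ℝ) ≠ 0 := by positivity
    have h3 : (k.factorial : ℝ) ≠ 0 := by positivity
    rw [if_neg (by omega), Nat.factorial_succ]
    push_cast at this ⊢
    simp only [add_zero, mul_one]
    field_simp

/-- On the line through `y` in direction `i` only the `i`-th factor of the product varies. -/
theorem fderiv_mono (x : Fin p → ℝ) (K : Fin p → ℕ) (y : Fin p → ℝ) (i : Fin p) :
    fderiv ℝ (mono x K) y (stdVec i) =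
      if K i = 0 then 0 else mono x (fun j => if j = i then K j - 1 else K j) y := by
  classical
  have hd : DifferentiableAt ℝ (mono x K) y :=
    ((mono_contDiff x K).differentiable (by simp)).differentiableAt
  have hl : HasDerivAt (fun t : ℝ => y + t • stdVec i) (stdVec i) 0 := by
    simpa using ((hasDerivAt_id (0 : ℝ)).smul_const (stdVec i)).const_add y
  have h0 : y = y + (0 : ℝ) • stdVec i := by simp
  have h1 : HasDerivAt (fun t : ℝ => mono x K (y + t • stdVec i))
      (fderiv ℝ (mono x K) y (stdVec i)) 0 := by
    rw [h0] at hd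
    have := hd.hasFDerivAt.comp_hasDerivAt (0 : ℝ) hl
    rwa [← h0] at this
  have e : ∀ t : ℝ, mono x K (y + t • stdVec i) =
      (y i + t - x i) ^ K i / ((K i).factorial : ℝ) *
        ∏ j ∈ Finset.univ.erase i, ((y j - x j) ^ K j / ((K j).factorial : ℝ)) := by
    intro t
    unfold mono
    rw [← Finset.mul_prod_erase _ _ (Finset.mem_univ i)]
    congr 1
    · simp [stdVec]
    · refine Finset.prod_congr rfl fun j hj => ?_
      simp [stdVec, Finset.ne_of_mem_erase hj]
  have h2 := (hasDerivAt_mono_factor (x i) (K i) (y i)).mul_const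
    (∏ j ∈ Finset.univ.erase i, ((y j - x j) ^ K j / ((K j).factorial : ℝ)))
  rw [funext e] at h1
  rw [h1.unique h2]
  split_ifs with hK
  · simp
  · unfold mono
    rw [← Finset.mul_prod_erase _ _ (Finset.mem_univ i)]
    congr 1
    · simp
    · refine Finset.prod_congr rfl fun j hj => ?_
      simp [Finset.ne_of_mem_erase hj]

/-- Each entry of the list lowers one exponent by one. The guard matters: truncated subtraction
would replace a derivative that vanishes by a nonzero monomial. -/
theorem pdList_mono (x : Fin p → ℝ) (K : Fin p → ℕ) (l : List (Fin p)) (y : Fin p → ℝ) :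
    pdList stdVec l (mono x K) y =
      if ∀ i, l.count i ≤ K i then mono x (fun i => K i - l.count i) y else 0 := by
  induction l generalizing y with
  | nil => simp [pdList]
  | cons j l ih =>
    rw [pdList_cons, funext ih]
    by_cases h : ∀ i, l.count i ≤ K i
    · simp only [if_pos h]
      rw [fderiv_mono]
      by_cases hj : K j - l.count j = 0
      · rw [if_pos hj, if_neg]
        intro h2
        have := h2 j
        rw [List.count_cons_self] at this
        omega
      · rw [if_neg hj, if_pos]
        · congr 1
          funext i
          rcases eq_or_ne i j with rfl | hij
          · rw [if_pos rfl, List.count_cons_self]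
            omega
          · rw [if_neg hij, List.count_cons_of_ne hij.symm]
        · intro i
          rcases eq_or_ne i j with rfl | hij
          · rw [List.count_cons_self]
            omega
          · rw [List.count_cons_of_ne hij.symm]
            exact h i
    · simp only [if_neg h]
      rw [if_neg]
      · simp
      · intro h2
        exact h fun i => (List.count_le_count_cons).trans (h2 i)

theorem mono_base (x : Fin p → ℝ) (K : Fin p → ℕ) : mono x K x = if K = 0 then 1 else 0 := by
  unfold mono
  split_ifs with h
  · subst h
    simp
  · obtain ⟨i, hi⟩ := Function.ne_iff.1 h
    refine Finset.prod_eq_zero (Finset.mem_univ i) ?_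
    rw [sub_self, zero_pow (by simpa using hi), zero_div]

/-- Monomials and derivatives at the base point are dual: if some `J i` exceeds `K i` the derivative
vanishes identically, and if `K ≠ J` otherwise, a positive power of zero remains. -/
theorem pdList_mono_base (x : Fin p → ℝ) (K J : Fin p → ℕ) :
    pdList stdVec (idxList J) (mono x K) x = if K = J then 1 else 0 := by
  rw [pdList_mono]
  simp only [count_idxList]
  rw [mono_base]
  by_cases h : K = J
  · subst h
    have : (fun i => K i - K i) = 0 := by funext i; simp
    rw [if_pos fun i => le_rfl, if_pos this, if_pos rfl]
  · rw [if_neg h]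
    split_ifs with h1 h2
    · refine absurd (funext fun i => ?_) h
      have h3 := congrFun h2 i
      have h4 := h1 i
      simp only [Pi.zero_apply] at h3
      omega
    · rfl
    · rfl

end partials

/-! ### Jets of functions and their Taylor polynomials. -/

section jetfn
variable {p q : ℕ}

/-- The map `y ↦ (y, pr^{(n)} v(y))` for a smooth function `v`. -/
def jetFn (n : ℕ) (v : (Fin p → ℝ) → Fin q → ℝ) (y : Fin p → ℝ) : Jet p q n :=
  Sum.elim y fun a => pdList stdVec (idxList fun i => (a.2.1 i : ℕ)) (fun x => v x a.1) y

/-- The base point of a jet. -/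
def basePt {n : ℕ} : Jet p q n →L[ℝ] (Fin p → ℝ) :=
  ContinuousLinearMap.pi fun i : Fin p =>
    ContinuousLinearMap.proj (R := ℝ) (φ := fun _ : JIdx p q n => ℝ) (Sum.inl i)

/-- By duality of monomials and derivatives, differentiating the Taylor sum at the base point picks
out a single coefficient. -/
theorem jetFn_taylor {n : ℕ} (z : Jet p q n) :
    jetFn n (fun y => taylor (y, z)) (basePt z) = z := by
  funext j
  rcases j with i | ⟨α, J⟩
  · rfl
  · have h := pdList_sum (p := p) Finset.univ stdVec (idxList fun i => (J.1 i : ℕ))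
      (fun K : MIdx p n => z (Sum.inr (α, K))) (fun K => mono (basePt z) fun i => (K.1 i : ℕ))
      (fun K => mono_contDiff _ _)
    change pdList stdVec (idxList fun i => (J.1 i : ℕ))
      (fun y => ∑ K : MIdx p n, z (Sum.inr (α, K)) * mono (basePt z) (fun i => (K.1 i : ℕ)) y)
      (basePt z) = _
    rw [h]
    simp only [pdList_mono_base]
    rw [Finset.sum_eq_single J]
    · simp
    · intro K _ hK
      rw [if_neg, mul_zero]
      intro h2
      exact hK (Subtype.ext (funext fun i => Fin.ext (congrFun h2 i)))
    · simp

theorem taylor_contDiff {n : ℕ} (z : Jet p q n) :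
    ContDiff ℝ ∞ (fun y : Fin p → ℝ => (taylor (y, z) : Fin q → ℝ)) :=
  taylor_hasTemperateGrowth.1.comp (contDiff_id.prodMk contDiff_const)

/-- A function and the Taylor polynomial of its `n`-jet have the same derivatives up to order `n`
at the base point. -/
theorem iteratedFDeriv_taylor_jetFn (n : ℕ) {v : (Fin p → ℝ) → Fin q → ℝ}
    (hv : ContDiff ℝ ∞ v) (x : Fin p → ℝ) {k : ℕ} (hk : k ≤ n) :
    iteratedFDeriv ℝ k v x = iteratedFDeriv ℝ k (fun y => taylor (y, jetFn n v x)) x := by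
  have hcomp : ∀ (w : (Fin p → ℝ) → Fin q → ℝ), ContDiff ℝ ∞ w → ∀ α,
      iteratedFDeriv ℝ k (fun y => w y α) x =
      (ContinuousLinearMap.proj (R := ℝ) (φ := fun _ : Fin q => ℝ) α).compContinuousMultilinearMap
        (iteratedFDeriv ℝ k w x) := fun w hw α =>
    (ContinuousLinearMap.proj (R := ℝ) (φ := fun _ : Fin q => ℝ) α).iteratedFDeriv_comp_left
      hw.contDiffAt (lt_inf k)
  ext m α
  have h1 := congrArg (fun T => T m) (hcomp v hv α)
  have h2 := congrArg (fun T => T m) (hcomp _ (taylor_contDiff (jetFn n v x)) α)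
  refine h1.symm.trans (Eq.trans ?_ h2)
  refine congrArg (fun T : ContinuousMultilinearMap ℝ (fun _ : Fin k => Fin p → ℝ) ℝ => T m) ?_
  refine iteratedFDeriv_eq_of_partials (contDiff_pi.1 hv α)
    (contDiff_pi.1 (taylor_contDiff (jetFn n v x)) α) fun J hJ => ?_
  have hJn : ∀ i, J i < n + 1 := fun i => by
    have := Finset.single_le_sum (f := J) (fun _ _ => Nat.zero_le _) (Finset.mem_univ i)
    omega
  let J' : MIdx p n := ⟨fun i => ⟨J i, hJn i⟩, by simpa using hJ.le.trans hk⟩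
  -- The partial derivatives of the Taylor polynomial are the entries of the jet, and these are by
  -- definition the partial derivatives of `v`.
  have h3 := congrFun (jetFn_taylor (jetFn n v x)) (Sum.inr (α, J'))
  exact h3.symm

end jetfn

/-! ### Contact of finite order at generalized points. -/

section contact
variable {D E F G : Type} [NormedAddCommGroup D] [NormedSpace ℝ D]
  [NormedAddCommGroup E] [NormedSpace ℝ E] [NormedAddCommGroup F] [NormedSpace ℝ F]
  [NormedAddCommGroup G] [NormedSpace ℝ G]

/-- If two inner nets differ negligibly up to order `N`, so do the compositions. -/
theorem bigN_comp_sub_order {γ : Regime D} {γ2 : Regime E} {f f' : Idx → D → E}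
    (hf : Moderate γ f) (hf' : Moderate γ f') (ht : Tame γ γ2 f f') {K : Set D} (hK : K ∈ γ.sets)
    {N : ℕ} (hN : ∀ i ≤ N, BigN γ K (fun ε x =>
      ‖iteratedFDeriv ℝ i (fun y => f' ε y - f ε y) x‖)) (n : ℕ) :
    ∀ (F : Type) [NormedAddCommGroup F] [NormedSpace ℝ F] (g : Idx → E → F), Moderate γ2 g →
      n ≤ N → ∀ k ≤ n, BigN γ K (fun ε x =>
        ‖iteratedFDeriv ℝ k (fun y => g ε (f' ε y) - g ε (f ε y)) x‖) := by
  have hl : Good small := Or.inl rfl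
  induction n with
  | zero =>
    intro F _ _ g hg _ k hk
    obtain rfl : k = 0 := by omega
    obtain ⟨b, hb, h⟩ := BigM.subst ht hl hK (c := fun ε y => ‖fderiv ℝ (g ε) y‖)
      (fun K2 hK2 => by simpa using hg.fderiv.2 K2 hK2 0)
    have h1 := hN 0 (Nat.zero_le _)
    simp only [norm_iteratedFDeriv_zero] at h1 ⊢
    have hb2 : BigM γ small K (fun ε x => |b ε x|) := by
      refine hb.mono_le ?_
      filter_upwards [h] with ε h x hx
      rw [abs_of_nonneg ((norm_nonneg _).trans (h x hx _ (left_mem_segment ℝ _ _)))]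
    refine (h1.mul_bigM hb2 (fun _ _ => abs_nonneg _)).mono_le ?_
    filter_upwards [h] with ε h x hx
    rw [mul_comm]
    exact (convex_segment (𝕜 := ℝ) (f ε x) (f' ε x)).norm_image_sub_le_of_norm_fderiv_le
      (fun y _ => ((hg.smooth ε).differentiable (by simp)).differentiableAt)
      (fun y hy => (h x hx y hy).trans (le_abs_self _))
      (left_mem_segment ℝ _ _) (right_mem_segment ℝ _ _)
  | succ n ih =>
    intro F _ _ g hg hnN k hk
    rcases Nat.lt_or_ge k (n + 1) with hk2 | hk2
    · exact ih F g hg (by omega) k (by omega)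
    obtain rfl : k = n + 1 := by omega
    have dg : ∀ ε z, DifferentiableAt ℝ (g ε) z := fun ε z =>
      ((hg.smooth ε).differentiable (by simp)).differentiableAt
    have d1 : ∀ ε y, DifferentiableAt ℝ (f ε) y := fun ε y =>
      ((hf.smooth ε).differentiable (by simp)).differentiableAt
    have d2 : ∀ ε y, DifferentiableAt ℝ (f' ε) y := fun ε y =>
      ((hf'.smooth ε).differentiable (by simp)).differentiableAt
    -- The derivative of `g ∘ f' - g ∘ f` splits into a difference of `Dg` along the two inner maps,
    -- covered by induction with `Dg` in place of `g`, and `Dg` applied to the derivative of `f' -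
    -- f`, which uses the hypothesis one order higher.
    have e : ∀ ε, _root_.fderiv ℝ (fun y => g ε (f' ε y) - g ε (f ε y)) = fun y =>
        ContinuousLinearMap.compL ℝ D E F
          (fderiv ℝ (g ε) (f' ε y) - fderiv ℝ (g ε) (f ε y)) (fderiv ℝ (f' ε) y) +
        (ContinuousLinearMap.compL ℝ D E F).flip
          (fderiv ℝ (fun z => f' ε z - f ε z) y) (fderiv ℝ (g ε) (f ε y)) := by
      intro ε
      funext y
      have c1 : fderiv ℝ (fun y => g ε (f ε y)) y = _ := fderiv_comp y (dg ε _) (d1 ε y)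
      have c2 : fderiv ℝ (fun y => g ε (f' ε y)) y = _ := fderiv_comp y (dg ε _) (d2 ε y)
      have c3 : fderiv ℝ (fun y => g ε (f' ε y) - g ε (f ε y)) y = _ :=
        fderiv_fun_sub ((dg ε _).comp y (d2 ε y)) ((dg ε _).comp y (d1 ε y))
      have c4 : fderiv ℝ (fun z => f' ε z - f ε z) y = _ := fderiv_fun_sub (d2 ε y) (d1 ε y)
      rw [c3, c4]
      change fderiv ℝ (fun y => g ε (f' ε y)) y - fderiv ℝ (fun y => g ε (f ε y)) y = _
      rw [c1, c2]
      ext w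
      simp
    have m1 : Moderate γ (fun ε y => fderiv ℝ (g ε) (f ε y)) := hg.fderiv.comp hf ht.left
    have m2 : Moderate γ (fun ε y => fderiv ℝ (g ε) (f' ε y)) := hg.fderiv.comp hf' ht.right
    have s1 : ∀ ε, ContDiff ℝ ∞ (fun y => fderiv ℝ (g ε) (f' ε y) - fderiv ℝ (g ε) (f ε y)) :=
      fun ε => (m2.smooth ε).sub (m1.smooth ε)
    have s2 : ∀ ε, ContDiff ℝ ∞ (fderiv ℝ (fun z => f' ε z - f ε z)) := fun ε =>
      ((hf'.smooth ε).sub (hf.smooth ε)).fderiv_right (by simp)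
    have n1 := bigN_bilin_left (ContinuousLinearMap.compL ℝ D E F) s1 hf'.fderiv hK n
      (ih (E →L[ℝ] F) (fun ε => fderiv ℝ (g ε)) hg.fderiv (by omega))
    have n2 := bigN_bilin_left (ContinuousLinearMap.compL ℝ D E F).flip s2 m1 hK n
      (fun i hi => by
        simp only [norm_iteratedFDeriv_fderiv]
        exact hN (i + 1) (by omega))
    refine (n1.add n2).mono_le (Eventually.of_forall fun ε x _ => ?_)
    rw [← norm_iteratedFDeriv_fderiv, e ε]
    have a1 : ContDiff ℝ ∞ (fun y => ContinuousLinearMap.compL ℝ D E F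
          (fderiv ℝ (g ε) (f' ε y) - fderiv ℝ (g ε) (f ε y)) (fderiv ℝ (f' ε) y)) :=
      (ContinuousLinearMap.compL ℝ D E F).isBoundedBilinearMap.contDiff.comp
        ((s1 ε).prodMk (hf'.fderiv.smooth ε))
    have a2 : ContDiff ℝ ∞ (fun y => (ContinuousLinearMap.compL ℝ D E F).flip
          (fderiv ℝ (fun z => f' ε z - f ε z) y) (fderiv ℝ (g ε) (f ε y))) :=
      (ContinuousLinearMap.compL ℝ D E F).flip.isBoundedBilinearMap.contDiff.comp
        ((s2 ε).prodMk (m1.smooth ε))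
    have a3 := iteratedFDeriv_add_apply (a1.of_le (lt_inf n)).contDiffAt (x := x)
      (a2.of_le (lt_inf n)).contDiffAt
    refine le_trans (le_of_eq ?_) (norm_add_le _ _)
    exact congrArg _ a3

/-- Estimates at the origin. -/
def Regime.origin (D : Type) [NormedAddCommGroup D] : Regime D where
  sets := {{0}}
  weight := fun _ => 0
  weight_nonneg := fun _ => le_rfl

theorem bigN_origin_iff {w : Idx → D → F} :
    BigN (Regime.origin D) {0} (fun ε x => ‖w ε x‖) ↔ (fun ε => w ε 0) ∈ neglPts F := by
  constructor
  · intro h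
    exact fun q => h.eventually_le (x := fun _ => 0) (Eventually.of_forall fun _ => rfl) (r := 0)
      (Eventually.of_forall fun ε => by rw [pow_zero]; exact zero_le_one) q
  · intro h
    refine ⟨0, fun q => ⟨1, ?_⟩⟩
    filter_upwards [h q] with ε h x hx
    rw [mem_singleton_iff.1 hx]
    simpa using h

/-- Recentring at the moving point `y ε` turns estimates at a generalized point into estimates at
the fixed origin, so the composition estimates for regimes apply. -/
theorem Moderate.translate {u : Idx → D → F} (hu : Moderate (Regime.temp D) u) {y : Idx → D}
    (hy : y ∈ modPts D) : Moderate (Regime.origin D) (fun ε τ => u ε (y ε + τ)) := by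
  have hid : Moderate (Regime.origin D) (fun _ (τ : D) => τ) := by
    refine Slow.moderate ⟨contDiff_id, ?_⟩
    rintro _ rfl k
    exact ⟨0, ‖iteratedFDeriv ℝ k (fun τ : D => τ) 0‖, by simp⟩
  have hf := (moderate_const (γ := Regime.origin D) hy).add hid
  exact Moderate.comp (f := fun ε τ => y ε + τ) hu hf (tame_temp hf hf)

/-- The derivatives of `w` up to order `n` vanish at the generalized point `y`. -/
def Flat (n : ℕ) (w : Idx → D → F) (y : Idx → D) : Prop :=
  ∀ k ≤ n, (fun ε => iteratedFDeriv ℝ k (w ε) (y ε)) ∈ neglPts _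

theorem flat_iff {n : ℕ} {w : Idx → D → F} {y : Idx → D} :
    Flat n w y ↔ ∀ k ≤ n, BigN (Regime.origin D) {0}
      (fun ε τ => ‖iteratedFDeriv ℝ k (fun τ => w ε (y ε + τ)) τ‖) := by
  refine forall_congr' fun k => forall_congr' fun _ => ?_
  rw [bigN_origin_iff]
  simp only [iteratedFDeriv_comp_add_left, add_zero]

theorem Negl.flat {w : Idx → D → F} (hw : Negl (Regime.temp D) w) {y : Idx → D}
    (hy : y ∈ modPts D) (n : ℕ) : Flat n w y := by
  intro k _
  obtain ⟨r, hr⟩ := hy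
  exact fun q => (hw.2 univ rfl k).eventually_le (Eventually.of_forall fun _ => mem_univ _) hr q

theorem Moderate.iteratedFDeriv {γ : Regime D} {u : Idx → D → F} (hu : Moderate γ u) (k : ℕ) :
    Moderate γ (fun ε => iteratedFDeriv ℝ k (u ε)) := by
  induction k with
  | zero =>
    exact hu.clm (continuousMultilinearCurryFin0 ℝ D
      F).symm.toContinuousLinearEquiv.toContinuousLinearMap
  | succ k ih =>
    exact ih.fderiv.clm (continuousMultilinearCurryLeftEquiv ℝ
      (fun _ : Fin (k + 1) => D) F).symm.toContinuousLinearEquiv.toContinuousLinearMap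

/-- Each iterated derivative of a moderate net is itself moderate, so its point values depend only
on the generalized point. -/
theorem Flat.congr_point {n : ℕ} {w : Idx → D → F} (hw : Moderate (Regime.temp D) w)
    {x y : Idx → D} (hx : x ∈ modPts D) (hxy : PtEq x y) (h : Flat n w x) : Flat n w y := by
  intro k hk
  exact ptEq_zero.1 (((hw.iteratedFDeriv k).eval_congr hx hxy).symm.trans (ptEq_zero.2 (h k hk)))

/-- In the bound for the `k`-th derivative of a composition every term carries a derivative of `w`
of order at most `k` at the image point, multiplied by moderate quantities. -/
theorem Flat.comp_inner {n : ℕ} {w : Idx → E → F} {θ : Idx → D → E}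
    (hw : ∀ ε, ContDiff ℝ ∞ (w ε)) (hθ : Moderate (Regime.temp D) θ) {y : Idx → D}
    (hy : y ∈ modPts D) (h : Flat n w (fun ε => θ ε (y ε))) :
    Flat n (fun ε x => w ε (θ ε x)) y := by
  rw [flat_iff]
  intro k hk
  have hθ' := hθ.translate hy
  have key : BigN (Regime.origin D) {0} (fun ε τ => ∑ i ∈ Finset.range (k + 1),
      ‖iteratedFDeriv ℝ i (w ε) (θ ε (y ε + τ))‖) := by
    refine BigN.sum _ (fun i ε τ => ‖iteratedFDeriv ℝ i (w ε) (θ ε (y ε + τ))‖) fun i hi => ?_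
    rw [bigN_origin_iff]
    simpa only [add_zero] using h i (by rw [Finset.mem_range] at hi; omega)
  refine (key.mul_bigM (bigM_inner hθ' (Or.inl rfl) (K := {0}) rfl k)
    (fun _ _ => by positivity)).mono_le
    (Eventually.of_forall fun ε τ _ => norm_comp_le (hw ε) (hθ'.smooth ε) k τ)

theorem Flat.clm {n : ℕ} {w : Idx → D → F} (L : F →L[ℝ] G) (hw : ∀ ε, ContDiff ℝ ∞ (w ε))
    {y : Idx → D} (h : Flat n w y) : Flat n (fun ε x => L (w ε x)) y := by
  intro k hk
  refine neglPts_of_norm_le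
    (neglPts_clm (ContinuousLinearMap.compContinuousMultilinearMapL ℝ (fun _ : Fin k => D) F G L)
      (h k hk)) fun ε => le_of_eq ?_
  exact congrArg norm (L.iteratedFDeriv_comp_left (hw ε).contDiffAt (lt_inf k))

/-- The inner maps agree only up to order `n` and only at `y`, so the order-by-order estimate
`bigN_comp_sub_order` at the origin takes the place of `Negl.comp_sub`. -/
theorem Flat.comp_outer {n : ℕ} {g : Idx → E → F} (hg : Moderate (Regime.temp E) g)
    {f f' : Idx → D → E} (hf : Moderate (Regime.temp D) f) (hf' : Moderate (Regime.temp D) f')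
    {y : Idx → D} (hy : y ∈ modPts D) (h : Flat n (fun ε x => f' ε x - f ε x) y) :
    Flat n (fun ε x => g ε (f' ε x) - g ε (f ε x)) y := by
  rw [flat_iff] at h ⊢
  exact bigN_comp_sub_order (hf.translate hy) (hf'.translate hy)
    (tame_temp (hf.translate hy) (hf'.translate hy)) (K := {0}) rfl h n F g hg le_rfl

theorem norm_pdList_sub_le {p : ℕ} (e : Fin p → D) (he : ∀ i, ‖e i‖ ≤ 1) {f g : D → F}
    (hf : ContDiff ℝ ∞ f) (hg : ContDiff ℝ ∞ g) (l : List (Fin p)) (x : D) :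
    ‖pdList e l f x - pdList e l g x‖ ≤
      ‖iteratedFDeriv ℝ l.length (fun y => f y - g y) x‖ := by
  have h1 := pdList_ofFn e hf l.length l.get x
  have h2 := pdList_ofFn e hg l.length l.get x
  have h3 := pdList_ofFn e (hf.sub hg) l.length l.get x
  have h4 := norm_pdList_le e he (hf.sub hg) l x
  rw [List.ofFn_get] at h1 h2 h3
  have h5 : _root_.iteratedFDeriv ℝ l.length (fun y => f y - g y) x =
      _root_.iteratedFDeriv ℝ l.length f x - _root_.iteratedFDeriv ℝ l.length g x :=
    iteratedFDeriv_sub_apply (hf.of_le (lt_inf _)).contDiffAt (hg.of_le (lt_inf _)).contDiffAt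
  rw [h5, sub_apply, ← h1, ← h2] at h3
  rwa [h3] at h4

/-- The jet coordinates involve derivatives of order at most `n` only, each controlled by the
corresponding iterated derivative of the difference. -/
theorem Flat.jetFn {p q n : ℕ} {u v : Idx → (Fin p → ℝ) → Fin q → ℝ}
    (hu : ∀ ε, ContDiff ℝ ∞ (u ε)) (hv : ∀ ε, ContDiff ℝ ∞ (v ε)) {y : Idx → Fin p → ℝ}
    (h : Flat n (fun ε x => u ε x - v ε x) y) :
    PtEq (fun ε => jetFn n (u ε) (y ε)) (fun ε => jetFn n (v ε) (y ε)) := by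
  refine PtEq.of_pi fun j => ?_
  rcases j with i | ⟨α, J⟩
  · exact PtEq.refl _
  · have hlen : (idxList fun i => (J.1 i : ℕ)).length ≤ n := by
      rw [length_idxList]
      exact J.2
    have h2 := h.clm (ContinuousLinearMap.proj (R := ℝ) (φ := fun _ : Fin q => ℝ) α)
      (fun ε => (hu ε).sub (hv ε)) _ hlen
    exact neglPts_of_norm_le h2 fun ε => norm_pdList_sub_le stdVec norm_stdVec
      (contDiff_pi.1 (hu ε) α) (contDiff_pi.1 (hv ε) α) _ _

end contact

/-! ### Operations on classes, computed on representatives. -/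

section representatives
variable {A B D E F G : Type} [NormedAddCommGroup A] [NormedSpace ℝ A]
  [NormedAddCommGroup B] [NormedSpace ℝ B] [NormedAddCommGroup D] [NormedSpace ℝ D]
  [NormedAddCommGroup E] [NormedSpace ℝ E] [NormedAddCommGroup F] [NormedSpace ℝ F]
  [NormedAddCommGroup G] [NormedSpace ℝ G] {γ : Regime D} {p q : ℕ}

theorem exists_cl (U : Gen γ F) : ∃ (u : Idx → D → F) (hu : Moderate γ u), U = cl u hu := by
  obtain ⟨u, rfl⟩ := QuotientAddGroup.mk_surjective U
  exact ⟨u.1, u.2, rfl⟩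

theorem cl_congr {u v : Idx → D → F} {hu : Moderate γ u} {hv : Moderate γ v} (h : u = v) :
    cl u hu = cl v hv := by
  subst h
  rfl

theorem Moderate.sub {u v : Idx → D → F} (hu : Moderate γ u) (hv : Moderate γ v) :
    Moderate γ (fun ε x => u ε x - v ε x) :=
  (modNets γ F).sub_mem hu hv

theorem Moderate.pdList {u : Idx → D → F} (hu : Moderate γ u) (e : Fin p → D)
    (l : List (Fin p)) : Moderate γ (fun ε => pdList e l (u ε)) := by
  induction l with
  | nil => exact hu
  | cons i l ih => exact ih.fderiv.clm (ContinuousLinearMap.apply ℝ F (e i))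

theorem lineD_iterate_cl (e : Fin p → D) (i : Fin p) (k : ℕ) {u : Idx → D → F}
    (hu : Moderate γ u) : (Gen.lineD (e i))^[k] (cl u hu) =
      cl (fun ε => pdList e (List.replicate k i) (u ε)) (hu.pdList e _) := by
  induction k with
  | zero => rfl
  | succ k ih =>
    rw [Function.iterate_succ_apply', ih]
    rfl

theorem pdList_append (e : Fin p → D) (l l' : List (Fin p)) (f : D → F) :
    pdList e (l ++ l') f = pdList e l (pdList e l' f) := List.foldr_append

/-- The nested iteration of directional derivatives is a single fold along the concatenated list of
directions. -/
theorem partials_cl (e : Fin p → D) (J : Fin p → ℕ) {u : Idx → D → F} (hu : Moderate γ u) :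
    Gen.partials e J (cl u hu) =
      cl (fun ε => pdList e (idxList J) (u ε)) (hu.pdList e _) := by
  unfold Gen.partials idxList
  generalize List.finRange p = L
  induction L with
  | nil => rfl
  | cons i L ih =>
    rw [List.foldr_cons, ih, lineD_iterate_cl]
    refine cl_congr ?_
    funext ε
    rw [List.flatMap_cons, pdList_append]

theorem Moderate.sum {ι : Type} (s : Finset ι) {u : ι → Idx → D → F}
    (hu : ∀ i ∈ s, Moderate γ (u i)) : Moderate γ (∑ i ∈ s, u i) :=
  (modNets γ F).sum_mem hu

theorem pi_net_eq {ι : Type} [Fintype ι] [DecidableEq ι] (u : ι → Idx → D → ℝ) :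
    (∑ i, fun ε x => ContinuousLinearMap.single ℝ (fun _ : ι => ℝ) i (u i ε x)) =
      fun ε x i => u i ε x := by
  funext ε x
  rw [Finset.sum_apply, Finset.sum_apply]
  exact Finset.univ_sum_single (fun i => u i ε x)

theorem Moderate.pi {ι : Type} [Fintype ι] [DecidableEq ι] {u : ι → Idx → D → ℝ}
    (hu : ∀ i, Moderate γ (u i)) : Moderate γ (fun ε x i => u i ε x) := by
  rw [← pi_net_eq]
  exact Moderate.sum _ fun i _ => (hu i).clm (ContinuousLinearMap.single ℝ (fun _ : ι => ℝ) i)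

theorem cl_sum {ι : Type} (s : Finset ι) {u : ι → Idx → D → F} (hu : ∀ i, Moderate γ (u i)) :
    ∑ i ∈ s, cl (u i) (hu i) = cl (∑ i ∈ s, u i) (Moderate.sum s fun i _ => hu i) := by
  classical
  induction s using Finset.induction_on with
  | empty => rfl
  | insert i s hi ih =>
    rw [Finset.sum_insert hi, ih]
    refine Eq.trans ?_ (cl_congr (hu := (hu i).add (Moderate.sum s fun i _ => hu i))
      (Finset.sum_insert hi).symm)
    rfl

theorem pi_cl {ι : Type} [Fintype ι] [DecidableEq ι] {u : ι → Idx → D → ℝ}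
    (hu : ∀ i, Moderate γ (u i)) :
    Gen.pi (fun i => cl (u i) (hu i)) = cl (fun ε x i => u i ε x) (Moderate.pi hu) := by
  refine Eq.trans ?_ (cl_congr (hu := Moderate.sum _ fun i _ =>
    (hu i).clm (ContinuousLinearMap.single ℝ (fun _ : ι => ℝ) i)) (pi_net_eq u))
  exact cl_sum Finset.univ fun i => (hu i).clm (ContinuousLinearMap.single ℝ (fun _ : ι => ℝ) i)

theorem Moderate.subst {α : B →L[ℝ] A} {u : Idx → A × E → F} {f : Idx → B × D → E}
    (hu : Moderate (Regime.mix A E) u) (hf : Moderate (Regime.mix B D) f) :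
    Moderate (Regime.mix B D) (fun ε z => u ε (α z.1, f ε z)) :=
  hu.comp (f := fun ε z => (α z.1, f ε z))
    ((moderate_lin_mix (α.comp (ContinuousLinearMap.fst ℝ B D))).prodMk hf) (tame_mix α hf hf)

end representatives

/-! ### Explicit representatives of jets, transformed functions and prolongations. -/

section jets
variable {p q : ℕ} {n : ℕ}

theorem jetFn_moderate {v : Idx → (Fin p → ℝ) → Fin q → ℝ} (n : ℕ)
    (hv : Moderate (Regime.temp (Fin p → ℝ)) v) :
    Moderate (Regime.temp (Fin p → ℝ)) (fun ε => jetFn n (v ε)) := by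
  refine Moderate.pi (u := fun j ε x => jetFn n (v ε) x j) fun j => ?_
  rcases j with i | ⟨α, J⟩
  · exact (slow_temp (ContinuousLinearMap.proj (R := ℝ)
      (φ := fun _ : Fin p => ℝ) i).hasTemperateGrowth).moderate
  · exact (hv.clm (ContinuousLinearMap.proj (R := ℝ) (φ := fun _ : Fin q => ℝ) α)).pdList
      stdVec _

theorem jet_cl {v : Idx → (Fin p → ℝ) → Fin q → ℝ} (n : ℕ)
    (hv : Moderate (Regime.temp (Fin p → ℝ)) v) :
    Gen.jet n (cl v hv) = cl (fun ε => jetFn n (v ε)) (jetFn_moderate n hv) := by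
  have hu : ∀ j : JIdx p q n, Moderate (Regime.temp (Fin p → ℝ))
      (fun ε x => jetFn n (v ε) x j) := fun j =>
    (jetFn_moderate n hv).clm (ContinuousLinearMap.proj (R := ℝ) (φ := fun _ : JIdx p q n => ℝ) j)
  refine Eq.trans ?_ (pi_cl hu)
  unfold Gen.jet
  congr 1
  funext j
  rcases j with i | ⟨α, J⟩
  · rfl
  · exact partials_cl stdVec (fun i => (J.1 i : ℕ))
      (hv.clm (ContinuousLinearMap.proj (R := ℝ) (φ := fun _ : Fin q => ℝ) α))

/-- The transformed function `Φ_t(v)` for a projectable map with components `ξ` and `ψ`. -/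
def actFn (ξ : ℝ × (Fin p → ℝ) → Fin p → ℝ)
    (ψ : ℝ × ((Fin p → ℝ) × (Fin q → ℝ)) → Fin q → ℝ) (t : ℝ) (v : (Fin p → ℝ) → Fin q → ℝ)
    (y : Fin p → ℝ) : Fin q → ℝ :=
  ψ (t, (ξ (-t, y), v (ξ (-t, y))))

/-- The prolongation of a projectable map with components `ξ` and `ψ`. -/
def prolongFn (n : ℕ) (ξ : ℝ × (Fin p → ℝ) → Fin p → ℝ)
    (ψ : ℝ × ((Fin p → ℝ) × (Fin q → ℝ)) → Fin q → ℝ) (w : ℝ × Jet p q n) : Jet p q n :=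
  jetFn n (actFn ξ ψ w.1 fun y => taylor (y, w.2)) (ξ (w.1, basePt w.2))

/-- The function `(t, (y, z)) ↦ Φ_t(h_z)(y)` for the Taylor polynomial `h_z` with `n`-jet `z`. -/
def actTaylorFn (n : ℕ) (ξ : ℝ × (Fin p → ℝ) → Fin p → ℝ)
    (ψ : ℝ × ((Fin p → ℝ) × (Fin q → ℝ)) → Fin q → ℝ)
    (w : ℝ × ((Fin p → ℝ) × Jet p q n)) : Fin q → ℝ :=
  actFn ξ ψ w.1 (fun y => taylor (y, w.2.2)) w.2.1

variable {ξ : Idx → ℝ × (Fin p → ℝ) → Fin p → ℝ}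
  {ψ : Idx → ℝ × ((Fin p → ℝ) × (Fin q → ℝ)) → Fin q → ℝ}

theorem actTaylorFn_moderate (n : ℕ) (hξ : Moderate (Regime.mix ℝ (Fin p → ℝ)) ξ)
    (hψ : Moderate (Regime.mix ℝ ((Fin p → ℝ) × (Fin q → ℝ))) ψ) :
    Moderate (Regime.mix ℝ ((Fin p → ℝ) × Jet p q n)) (fun ε => actTaylorFn n (ξ ε) (ψ ε)) := by
  have h1 := hξ.subst (α := -ContinuousLinearMap.id ℝ ℝ) (moderate_lin_mix
    ((ContinuousLinearMap.fst ℝ (Fin p → ℝ) (Jet p q n)).comp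
      (ContinuousLinearMap.snd ℝ ℝ ((Fin p → ℝ) × Jet p q n))))
  have h2 := moderate_lin_mix ((ContinuousLinearMap.snd ℝ (Fin p → ℝ) (Jet p q n)).comp
      (ContinuousLinearMap.snd ℝ ℝ ((Fin p → ℝ) × Jet p q n)))
  have h3 := (slow_temp (taylor_hasTemperateGrowth (p := p) (q := q) (n := n))).moderate.comp
    (h1.prodMk h2) (tame_temp (h1.prodMk h2) (h1.prodMk h2))
  exact hψ.subst (α := ContinuousLinearMap.id ℝ ℝ) (h1.prodMk h3)

theorem actTaylor_cl (n : ℕ) (hξ : Moderate (Regime.mix ℝ (Fin p → ℝ)) ξ)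
    (hψ : Moderate (Regime.mix ℝ ((Fin p → ℝ) × (Fin q → ℝ))) ψ) :
    actTaylor n (cl ξ hξ) (cl ψ hψ) =
      cl (fun ε => actTaylorFn n (ξ ε) (ψ ε)) (actTaylorFn_moderate n hξ hψ) := rfl

/-- Differentiating in the argument with `z` fixed means differentiating along the affine slice `y ↦
(t, (y, z))`, so `pdList_affine` applies. -/
theorem prolongFn_inr (n : ℕ) (hξ : Moderate (Regime.mix ℝ (Fin p → ℝ)) ξ)
    (hψ : Moderate (Regime.mix ℝ ((Fin p → ℝ) × (Fin q → ℝ))) ψ) (ε : Idx)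
    (w : ℝ × Jet p q n) (α : Fin q) (J : MIdx p n) :
    pdList (fun i => ((0, (Pi.single i 1, 0)) : ℝ × (Fin p → ℝ) × Jet p q n))
      (idxList fun i => (J.1 i : ℕ)) (fun w => actTaylorFn n (ξ ε) (ψ ε) w α)
      (w.1, (ξ ε (w.1, basePt w.2), w.2)) = prolongFn n (ξ ε) (ψ ε) w (Sum.inr (α, J)) := by
  have hs : ContDiff ℝ ∞ (fun w => actTaylorFn n (ξ ε) (ψ ε) w α) :=
    contDiff_pi.1 ((actTaylorFn_moderate n hξ hψ).smooth ε) α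
  have h := pdList_affine stdVec ((ContinuousLinearMap.inr ℝ ℝ ((Fin p → ℝ) × Jet p q n)).comp
    (ContinuousLinearMap.inl ℝ (Fin p → ℝ) (Jet p q n)))
    ((w.1, (0, w.2)) : ℝ × (Fin p → ℝ) × Jet p q n) (idxList fun i => (J.1 i : ℕ)) hs
    (ξ ε (w.1, basePt w.2))
  have e : ∀ y : Fin p → ℝ, ((w.1, (0, w.2)) : ℝ × (Fin p → ℝ) × Jet p q n) +
      ((ContinuousLinearMap.inr ℝ ℝ ((Fin p → ℝ) × Jet p q n)).comp
        (ContinuousLinearMap.inl ℝ (Fin p → ℝ) (Jet p q n))) y = (w.1, (y, w.2)) := by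
    intro y
    simp
  simp only [e] at h
  exact h

theorem prolong_cl (n : ℕ) (hξ : Moderate (Regime.mix ℝ (Fin p → ℝ)) ξ)
    (hψ : Moderate (Regime.mix ℝ ((Fin p → ℝ) × (Fin q → ℝ))) ψ) :
    ∃ h : Moderate (Regime.mix ℝ (Jet p q n)) (fun ε => prolongFn n (ξ ε) (ψ ε)),
      prolong n (cl ξ hξ) (cl ψ hψ) = cl (fun ε => prolongFn n (ξ ε) (ψ ε)) h := by
  have hbase := hξ.subst (α := ContinuousLinearMap.id ℝ ℝ) (moderate_lin_mix
    ((basePt (p := p) (q := q) (n := n)).comp (ContinuousLinearMap.snd ℝ ℝ (Jet p q n))))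
  have hz := moderate_lin_mix (ContinuousLinearMap.snd ℝ ℝ (Jet p q n))
  have hpd := fun (α : Fin q) (J : MIdx p n) =>
    ((actTaylorFn_moderate n hξ hψ).clm (ContinuousLinearMap.proj (R := ℝ)
      (φ := fun _ : Fin q => ℝ) α)).pdList
      (fun i => ((0, (Pi.single i 1, 0)) : ℝ × (Fin p → ℝ) × Jet p q n))
      (idxList fun i => (J.1 i : ℕ))
  have hinr := fun (α : Fin q) (J : MIdx p n) =>
    (hpd α J).subst (α := ContinuousLinearMap.id ℝ ℝ) (hbase.prodMk hz)
  have hu : ∀ j : JIdx p q n, Moderate (Regime.mix ℝ (Jet p q n))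
      (fun ε w => prolongFn n (ξ ε) (ψ ε) w j) := by
    rintro (i | ⟨α, J⟩)
    · exact hbase.clm (ContinuousLinearMap.proj (R := ℝ) (φ := fun _ : Fin p => ℝ) i)
    · convert hinr α J using 3 with ε w
      exact (prolongFn_inr n hξ hψ ε w α J).symm
  refine ⟨Moderate.pi hu, Eq.trans ?_ (pi_cl hu)⟩
  unfold prolong
  dsimp only
  congr 1
  funext j
  rcases j with i | ⟨α, J⟩
  · rfl
  · have h1 := partials_cl (fun i => ((0, (Pi.single i 1, 0)) : ℝ × (Fin p → ℝ) × Jet p q n))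
      (fun i => (J.1 i : ℕ)) ((actTaylorFn_moderate n hξ hψ).clm (ContinuousLinearMap.proj (R := ℝ)
      (φ := fun _ : Fin q => ℝ) α))
    have h2 : cl (fun ε w => prolongFn n (ξ ε) (ψ ε) w (Sum.inr (α, J))) (hu (Sum.inr (α, J))) =
        cl _ (hinr α J) := by
      refine cl_congr ?_
      funext ε w
      exact (prolongFn_inr n hξ hψ ε w α J).symm
    rw [h2]
    simp only [Sum.elim_inr]
    rw [actTaylor_cl]
    exact congrArg (fun V => Gen.subst (ContinuousLinearMap.id ℝ ℝ) V _) h1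

end jets

/-! ### The group law of the prolonged action. -/

section grouplaw
variable {E : Type} [NormedAddCommGroup E] [NormedSpace ℝ E]

/-- The identity and group laws of a net of maps, at generalized points. -/
structure GroupLaw (φ : Idx → ℝ × E → E) : Prop where
  zero : ∀ x ∈ modPts E, PtEq (fun ε => φ ε (0, x ε)) x
  add : ∀ s ∈ cptPts ℝ, ∀ t ∈ cptPts ℝ, ∀ x ∈ modPts E,
    PtEq (fun ε => φ ε (s ε + t ε, x ε)) (fun ε => φ ε (s ε, φ ε (t ε, x ε)))

theorem cptPts_prod {A B : Type} [NormedAddCommGroup A] [NormedAddCommGroup B] {s : Idx → A}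
    {t : Idx → B} (hs : s ∈ cptPts A) (ht : t ∈ cptPts B) :
    (fun ε => (s ε, t ε)) ∈ cptPts (A × B) := by
  obtain ⟨K, hK, hs⟩ := hs
  obtain ⟨L, hL, ht⟩ := ht
  refine ⟨K ×ˢ L, hK.prod hL, ?_⟩
  filter_upwards [hs, ht] with ε h1 h2
  exact ⟨h1, h2⟩

/-- Equality of classes means that representatives differ by a negligible net; such a net has
negligible values at compactly supported times and moderate points. -/
theorem IsGroupAction.groupLaw {φ : Idx → ℝ × E → E} {hφ : Moderate (Regime.mix ℝ E) φ}
    (h : IsGroupAction (cl φ hφ)) : GroupLaw φ := by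
  obtain ⟨h0, hg⟩ := h
  have h0' : Negl (Regime.temp E) ((fun _ x => x) - fun ε x => φ ε (0, x)) := cl_eq_cl.1 h0
  have hg' : Negl (Regime.mix (ℝ × ℝ) E)
      ((fun ε w => φ ε (w.1.1, φ ε (w.1.2, w.2))) - fun ε w => φ ε (w.1.1 + w.1.2, w.2)) :=
    cl_eq_cl.1 hg
  refine ⟨fun x hx => PtEq.symm (h0'.eval_mem hx), fun s hs t ht x hx => PtEq.symm ?_⟩
  exact hg'.mix_eval_mem (cptPts_prod hs ht) hx

theorem zero_mem_cptPts : (fun _ => 0 : Idx → ℝ) ∈ cptPts ℝ := (cptPts ℝ).zero_mem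

theorem neg_mem_cptPts {t : Idx → ℝ} (ht : t ∈ cptPts ℝ) : (fun ε => -t ε) ∈ cptPts ℝ :=
  (cptPts ℝ).neg_mem ht

theorem add_mem_cptPts {s t : Idx → ℝ} (hs : s ∈ cptPts ℝ) (ht : t ∈ cptPts ℝ) :
    (fun ε => s ε + t ε) ∈ cptPts ℝ :=
  (cptPts ℝ).add_mem hs ht

variable {p q : ℕ} {ξ : Idx → ℝ × (Fin p → ℝ) → Fin p → ℝ}
  {ψ : Idx → ℝ × ((Fin p → ℝ) × (Fin q → ℝ)) → Fin q → ℝ}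

/-- The projectable map with components `ξ` and `ψ`. -/
def projFn (ξ : ℝ × (Fin p → ℝ) → Fin p → ℝ)
    (ψ : ℝ × ((Fin p → ℝ) × (Fin q → ℝ)) → Fin q → ℝ) (w : ℝ × ((Fin p → ℝ) × (Fin q → ℝ))) :
    (Fin p → ℝ) × (Fin q → ℝ) :=
  (ξ (w.1, w.2.1), ψ w)

theorem projectable_cl (hξ : Moderate (Regime.mix ℝ (Fin p → ℝ)) ξ)
    (hψ : Moderate (Regime.mix ℝ ((Fin p → ℝ) × (Fin q → ℝ))) ψ) :
    ∃ h : Moderate (Regime.mix ℝ ((Fin p → ℝ) × (Fin q → ℝ))) (fun ε => projFn (ξ ε) (ψ ε)),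
      projectable (cl ξ hξ) (cl ψ hψ) = cl (fun ε => projFn (ξ ε) (ψ ε)) h :=
  ⟨(hξ.subst (α := ContinuousLinearMap.id ℝ ℝ) (moderate_lin_mix
    ((ContinuousLinearMap.fst ℝ (Fin p → ℝ) (Fin q → ℝ)).comp
      (ContinuousLinearMap.snd ℝ ℝ ((Fin p → ℝ) × (Fin q → ℝ)))))).prodMk hψ, rfl⟩

theorem PtEq.fst {E F : Type} [NormedAddCommGroup E] [NormedSpace ℝ E] [NormedAddCommGroup F]
    [NormedSpace ℝ F] {x y : Idx → E × F} (h : PtEq x y) :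
    PtEq (fun ε => (x ε).1) (fun ε => (y ε).1) :=
  h.clm (ContinuousLinearMap.fst ℝ E F)

theorem PtEq.snd {E F : Type} [NormedAddCommGroup E] [NormedSpace ℝ E] [NormedAddCommGroup F]
    [NormedSpace ℝ F] {x y : Idx → E × F} (h : PtEq x y) :
    PtEq (fun ε => (x ε).2) (fun ε => (y ε).2) :=
  h.clm (ContinuousLinearMap.snd ℝ E F)

/-- The first component does not see the dependent variables, so these may be set to `0`. -/
theorem GroupLaw.base (h : GroupLaw fun ε => projFn (ξ ε) (ψ ε)) : GroupLaw ξ := by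
  have hmem : ∀ x ∈ modPts (Fin p → ℝ),
      (fun ε => (x ε, 0)) ∈ modPts ((Fin p → ℝ) × (Fin q → ℝ)) := fun x hx =>
    modPts_prod hx (modPts (Fin q → ℝ)).zero_mem
  exact ⟨fun x hx => (h.zero _ (hmem x hx)).fst,
    fun s hs t ht x hx => (h.add s hs t ht _ (hmem x hx)).fst⟩

/-- `Ξ_{-s}` inverts `Ξ_s`. -/
theorem GroupLaw.neg_left {φ : Idx → ℝ × E → E} (h : GroupLaw φ) {s : Idx → ℝ}
    (hs : s ∈ cptPts ℝ) {x : Idx → E} (hx : x ∈ modPts E) :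
    PtEq (fun ε => φ ε (-s ε, φ ε (s ε, x ε))) x := by
  have h1 := (h.add _ (neg_mem_cptPts hs) s hs x hx).symm
  simp only [neg_add_cancel] at h1
  exact h1.trans (h.zero x hx)

theorem GroupLaw.neg_right {φ : Idx → ℝ × E → E} (h : GroupLaw φ) {s : Idx → ℝ}
    (hs : s ∈ cptPts ℝ) {x : Idx → E} (hx : x ∈ modPts E) :
    PtEq (fun ε => φ ε (s ε, φ ε (-s ε, x ε))) x := by
  have h1 := (h.add s hs _ (neg_mem_cptPts hs) x hx).symm
  simp only [add_neg_cancel] at h1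
  exact h1.trans (h.zero x hx)

theorem actFn_inner_moderate (hξ : Moderate (Regime.mix ℝ (Fin p → ℝ)) ξ) {t : Idx → ℝ}
    (ht : t ∈ cptPts ℝ) {v : Idx → (Fin p → ℝ) → Fin q → ℝ}
    (hv : Moderate (Regime.temp (Fin p → ℝ)) v) :
    Moderate (Regime.temp (Fin p → ℝ))
      (fun ε y => (ξ ε (-t ε, y), v ε (ξ ε (-t ε, y)))) := by
  have h1 := hξ.slice (neg_mem_cptPts ht)
  exact h1.prodMk (hv.comp h1 (tame_temp h1 h1))

theorem actFn_moderate (hξ : Moderate (Regime.mix ℝ (Fin p → ℝ)) ξ)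
    (hψ : Moderate (Regime.mix ℝ ((Fin p → ℝ) × (Fin q → ℝ))) ψ) {t : Idx → ℝ}
    (ht : t ∈ cptPts ℝ) {v : Idx → (Fin p → ℝ) → Fin q → ℝ}
    (hv : Moderate (Regime.temp (Fin p → ℝ)) v) :
    Moderate (Regime.temp (Fin p → ℝ)) (fun ε => actFn (ξ ε) (ψ ε) (t ε) (v ε)) := by
  have h2 := actFn_inner_moderate hξ ht hv
  exact (hψ.slice ht).comp h2 (tame_temp h2 h2)

theorem taylor_moderate {n : ℕ} {z : Idx → Jet p q n} (hz : z ∈ modPts (Jet p q n)) :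
    Moderate (Regime.temp (Fin p → ℝ)) (fun ε y => (taylor (y, z ε) : Fin q → ℝ)) := by
  have h := (moderate_id (E := Fin p → ℝ)).prodMk
    (moderate_const (γ := Regime.temp (Fin p → ℝ)) hz)
  exact (slow_temp (taylor_hasTemperateGrowth (p := p) (q := q) (n := n))).moderate.comp h
    (tame_temp h h)

variable (hξ : Moderate (Regime.mix ℝ (Fin p → ℝ)) ξ)
  (hψ : Moderate (Regime.mix ℝ ((Fin p → ℝ) × (Fin q → ℝ))) ψ)
  (hG : GroupLaw fun ε => projFn (ξ ε) (ψ ε))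
include hξ hψ hG

/-- The prolonged action maps the jet of `v` at `x` to the jet of the transformed function at the
transformed point. -/
theorem prolongFn_jetFn (n : ℕ) {s : Idx → ℝ} (hs : s ∈ cptPts ℝ)
    {v : Idx → (Fin p → ℝ) → Fin q → ℝ} (hv : Moderate (Regime.temp (Fin p → ℝ)) v)
    {x : Idx → Fin p → ℝ} (hx : x ∈ modPts (Fin p → ℝ)) :
    PtEq (fun ε => prolongFn n (ξ ε) (ψ ε) (s ε, jetFn n (v ε) (x ε)))
      (fun ε => jetFn n (actFn (ξ ε) (ψ ε) (s ε) (v ε)) (ξ ε (s ε, x ε))) := by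
  have hz : (fun ε => jetFn n (v ε) (x ε)) ∈ modPts (Jet p q n) :=
    (jetFn_moderate n hv).eval_mem hx
  have hh := taylor_moderate hz
  have hy := hξ.mix_eval_mem hs hx
  have hθ := hξ.slice (neg_mem_cptPts hs)
  -- On representatives `Ξ_{-s}` inverts `Ξ_s` only up to a negligible error, so contact at `x` has
  -- to be moved to this nearby point.
  have hθy : PtEq x (fun ε => ξ ε (-s ε, ξ ε (s ε, x ε))) := (hG.base.neg_left hs hx).symm
  have hw := hh.sub hv
  -- At `x` itself contact is exact for every `ε`: the derivatives up to order `n` coincide.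
  have f1 : Flat n (fun ε y => taylor (y, jetFn n (v ε) (x ε)) - v ε y) x := by
    intro k hk
    have h0 := (neglPts (ContinuousMultilinearMap ℝ
      (fun _ : Fin k => Fin p → ℝ) (Fin q → ℝ))).zero_mem
    convert h0 using 1
    funext ε
    have h1 := iteratedFDeriv_sub_apply (x := x ε) (i := k)
      ((hh.smooth ε).of_le (lt_inf k)).contDiffAt ((hv.smooth ε).of_le (lt_inf k)).contDiffAt
    refine h1.trans ?_
    rw [iteratedFDeriv_taylor_jetFn n (hv.smooth ε) (x ε) hk]
    exact sub_self _
  have f2 := (f1.congr_point hw hx hθy).comp_inner (θ := fun ε y => ξ ε (-s ε, y))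
    (y := fun ε => ξ ε (s ε, x ε)) hw.smooth hθ hy
  -- The inner maps of the two transformed functions share the base component `Ξ_{-s}`; their
  -- difference lies in the dependent variables only.
  have f3 := f2.clm (ContinuousLinearMap.inr ℝ (Fin p → ℝ) (Fin q → ℝ))
    fun ε => (hw.smooth ε).comp (hθ.smooth ε)
  have hi := actFn_inner_moderate hξ hs hv
  have hi' := actFn_inner_moderate hξ hs hh
  have f4 := Flat.comp_outer (hψ.slice hs) hi hi' hy (n := n) (by
    convert f3 using 3 with ε y
    simp)
  exact f4.jetFn (actFn_moderate hξ hψ hs hh).smooth (actFn_moderate hξ hψ hs hv).smooth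

/-- At a point `y`, put `x = Ξ_{-t}(Ξ_{-s}(y))`, which is `Ξ_{-(s+t)}(y)`. The claim is then the
second component of the group law at the point `(x, v(x))` of the graph of `v`. -/
theorem actFn_actFn {s t : Idx → ℝ} (hs : s ∈ cptPts ℝ) (ht : t ∈ cptPts ℝ)
    {v : Idx → (Fin p → ℝ) → Fin q → ℝ} (hv : Moderate (Regime.temp (Fin p → ℝ)) v) :
    Negl (Regime.temp (Fin p → ℝ)) (fun ε y =>
      actFn (ξ ε) (ψ ε) (s ε) (actFn (ξ ε) (ψ ε) (t ε) (v ε)) y -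
        actFn (ξ ε) (ψ ε) (s ε + t ε) (v ε) y) := by
  have hst := add_mem_cptPts hs ht
  refine Moderate.negl_of_points ((actFn_moderate hξ hψ hs (actFn_moderate hξ hψ ht hv)).sub
    (actFn_moderate hξ hψ hst hv)) fun y hy => ?_
  have hB := hG.base
  have hy1 := hξ.mix_eval_mem (neg_mem_cptPts hs) hy
  have hy2 := hξ.mix_eval_mem (neg_mem_cptPts ht) hy1
  have hw := modPts_prod hy2 (hv.eval_mem hy2)
  -- The group law inserts `Ξ_t(x)` as base argument, whereas the iterated action has `Ξ_{-s}(y)`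
  -- there.
  have hw1 := hB.neg_right ht hy1
  have e1 : PtEq (fun ε => ξ ε (-(s ε + t ε), y ε)) (fun ε => ξ ε (-t ε, ξ ε (-s ε, y ε))) := by
    have := hB.add _ (neg_mem_cptPts ht) _ (neg_mem_cptPts hs) y hy
    simpa only [neg_add_rev] using this
  have e2 := hG.add s hs t ht _ hw
  have e3 := hψ.mix_eval_congr hst (hξ.mix_eval_mem (neg_mem_cptPts hst) hy |> fun h =>
    modPts_prod h (hv.eval_mem h)) (e1.prod (hv.eval_congr
      (hξ.mix_eval_mem (neg_mem_cptPts hst) hy) e1))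
  have e4 := hψ.mix_eval_congr hs (modPts_prod (hξ.mix_eval_mem ht hy2)
    (hψ.mix_eval_mem ht hw)) (hw1.prod (PtEq.refl _))
  exact ((e3.trans e2.snd).trans e4).symm

theorem actFn_zero {v : Idx → (Fin p → ℝ) → Fin q → ℝ}
    (hv : Moderate (Regime.temp (Fin p → ℝ)) v) :
    Negl (Regime.temp (Fin p → ℝ)) (fun ε y => actFn (ξ ε) (ψ ε) 0 (v ε) y - v ε y) := by
  refine Moderate.negl_of_points ((actFn_moderate hξ hψ zero_mem_cptPts hv).sub hv)
    fun y hy => ?_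
  have hy1 := hξ.mix_eval_mem (neg_mem_cptPts zero_mem_cptPts) hy
  have e1 := hG.base.zero y hy
  -- The action at time zero inserts `Ξ` at time `-0`.
  rw [← neg_zero] at e1
  exact (hG.zero _ (modPts_prod hy1 (hv.eval_mem hy1))).snd.trans (hv.eval_congr hy1 e1)

/-- The prolongation of a projectable group action satisfies the laws of a group action. -/
theorem prolongFn_groupLaw (n : ℕ) :
    GroupLaw fun ε => prolongFn n (ξ ε) (ψ ε) := by
  refine ⟨fun z hz => ?_, fun s hs t ht z hz => ?_⟩
  · have hh := taylor_moderate hz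
    have hb : (fun ε => basePt (z ε)) ∈ modPts (Fin p → ℝ) := modPts_clm basePt hz
    have hA := actFn_moderate hξ hψ zero_mem_cptPts hh
    have h1 := ((actFn_zero hξ hψ hG hh).flat hb n).jetFn hA.smooth hh.smooth
    have h2 := (jetFn_moderate n hA).eval_congr
      (hξ.mix_eval_mem zero_mem_cptPts hb) (hG.base.zero _ hb)
    -- The Taylor polynomial of `z` has jet `z` at its base point, so `h1` compares the transformed
    -- jet with `z` itself.
    simp only [jetFn_taylor] at h1
    exact h2.trans h1
  · have hh := taylor_moderate hz
    have hb : (fun ε => basePt (z ε)) ∈ modPts (Fin p → ℝ) := modPts_clm basePt hz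
    have hst := add_mem_cptPts hs ht
    have hx := hξ.mix_eval_mem ht hb
    have hA := actFn_moderate hξ hψ ht hh
    have hAA := actFn_moderate hξ hψ hs hA
    -- After time `t` the jet is that of the function `Φ_t(h_z)`, which need not be a polynomial; by
    -- this lemma `pr Φ_s` acts on it as on any jet of a moderate net of functions.
    have h1 := prolongFn_jetFn hξ hψ hG n hs hA hx
    have hy := hξ.mix_eval_mem hst hb
    have h2 := (jetFn_moderate n hAA).eval_congr hy (hG.base.add s hs t ht _ hb)
    have h3 := ((actFn_actFn hξ hψ hG hs ht hh).flat hy n).jetFn hAA.smooth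
      (actFn_moderate hξ hψ hst hh).smooth
    exact ((h1.trans h2.symm).trans h3).symm

end grouplaw

/-! ### Integral curves in `𝒢(ℝ)`. -/

section curves
variable {E F : Type} [NormedAddCommGroup E] [NormedSpace ℝ E] [NormedAddCommGroup F]
  [NormedSpace ℝ F]

theorem ptEq_apply {T : Idx → E →L[ℝ] F} (hT : T ∈ modPts (E →L[ℝ] F)) {v w : Idx → E}
    (h : PtEq v w) : PtEq (fun ε => T ε (v ε)) (fun ε => T ε (w ε)) := by
  have h1 := (Negl.bilin_right (ContinuousLinearMap.id ℝ (E →L[ℝ] F))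
    (moderate_const (γ := Regime.loc ℝ) hT) (negl_const (γ := Regime.loc ℝ) h)).at_mem (K := {0})
    isCompact_singleton (x := (0 : ℝ)) rfl
  simpa only [PtEq, ContinuousLinearMap.coe_id', id_eq, map_sub] using h1

theorem Moderate.curve_zero {u : Idx → ℝ × E → F} (hu : Moderate (Regime.mix ℝ E) u)
    {x : Idx → E} (hx : x ∈ modPts E) : Moderate (Regime.loc ℝ) (fun ε s => u ε (s, x ε)) := by
  simpa only [add_zero] using hu.curve zero_mem_cptPts hx

theorem hasDerivAt_curve {u : ℝ × E → F} (hu : ContDiff ℝ ∞ u) (t : ℝ) (x : E) :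
    HasDerivAt (fun s => u (s, x)) (fderiv ℝ u (t, x) (1, 0)) t := by
  have h1 : HasDerivAt (fun s : ℝ => (s, x)) ((1, 0) : ℝ × E) t :=
    (hasDerivAt_id t).prodMk (hasDerivAt_const t x)
  exact ((hu.differentiable (by simp)).differentiableAt (x := (t, x))).hasFDerivAt.comp_hasDerivAt
    t h1

/-- The orbits of a generalized group action are integral curves of its generator. -/
theorem GroupLaw.hasDeriv {φ : Idx → ℝ × E → E} (h : GroupLaw φ)
    (hφ : Moderate (Regime.mix ℝ E) φ) {z : Idx → E} (hz : z ∈ modPts E) {t : Idx → ℝ}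
    (ht : t ∈ cptPts ℝ) :
    PtEq (fun ε => fderiv ℝ (φ ε) (t ε, z ε) (1, 0))
      (fun ε => fderiv ℝ (φ ε) (0, φ ε (t ε, z ε)) (1, 0)) := by
  have hw := hφ.mix_eval_mem ht hz
  have hd := (hφ.curve ht hz).sub (hφ.curve_zero hw)
  -- The group law, valid at every compactly supported `s`, becomes an identity of generalized
  -- functions of `s`, which may then be differentiated at `s = 0`.
  have hN : Negl (Regime.loc ℝ)
      (fun ε s => φ ε (s + t ε, z ε) - φ ε (s, φ ε (t ε, z ε))) :=
    hd.negl_of_cpt fun s hs => h.add s hs t ht z hz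
  have h1 := (hN.fderiv.clm (ContinuousLinearMap.apply ℝ E (1 : ℝ))).eval_cpt zero_mem_cptPts
  unfold PtEq
  convert h1 using 1
  funext ε
  have a1 : HasDerivAt (fun s => φ ε (s + t ε, z ε))
      (fderiv ℝ (φ ε) (t ε, z ε) (1, 0)) 0 := by
    have := hasDerivAt_curve (hφ.smooth ε) (0 + t ε) (z ε)
    rw [zero_add] at this
    refine HasDerivAt.comp_add_const (f := fun s => φ ε (s, z ε)) 0 (t ε) ?_
    rwa [zero_add]
  have a2 := hasDerivAt_curve (hφ.smooth ε) 0 (φ ε (t ε, z ε))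
  exact (a1.sub a2).deriv.symm

/-- A moderate curve that satisfies a differential equation at all compactly supported points
satisfies it in `𝒢(ℝ)`. -/
theorem lineD_eq_comp {ζ : Idx → E → E} (hζ : Moderate (Regime.temp E) ζ) {c : Idx → ℝ → E}
    (hc : Moderate (Regime.loc ℝ) c) {c' : Idx → ℝ → E}
    (hd : ∀ ε t, HasDerivAt (c ε) (c' ε t) t)
    (h : ∀ t ∈ cptPts ℝ, PtEq (fun ε => c' ε (t ε)) (fun ε => ζ ε (c ε (t ε)))) :
    Gen.lineD (1 : ℝ) (cl c hc) = Gen.comp (cl ζ hζ) (cl c hc) := by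
  have h1 := hc.fderiv.clm (ContinuousLinearMap.apply ℝ E (1 : ℝ))
  have h2 : Moderate (Regime.loc ℝ) (fun ε t => ζ ε (c ε t)) := hζ.comp hc (tame_temp hc hc)
  refine (cl_eq_cl (hu := h1) (hv := h2)).2 ?_
  refine (h2.sub h1).negl_of_cpt fun t ht => PtEq.symm ?_
  have e : ∀ ε, ContinuousLinearMap.apply ℝ E (1 : ℝ) (fderiv ℝ (c ε) (t ε)) = c' ε (t ε) :=
    fun ε => (hd ε (t ε)).deriv
  simp only [e]
  exact h t ht

end curves

/-! ### Invariance of a system in solved form. -/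

section solved
variable {ι : Type} [Fintype ι] [DecidableEq ι] {l : ℕ} {i : Fin l → ι}

theorem joinL_rest (w : (Rest i → ℝ) × (Fin l → ℝ)) (j : Rest i) : joinL i w j.1 = w.1 j := by
  classical
  have h1 : ∀ j' : Rest i, (Pi.single j'.1 (w.1 j') : ι → ℝ) j.1 = if j' = j then w.1 j' else 0 := by
    intro j'
    rw [Pi.single_apply]
    exact if_congr ⟨fun h => Subtype.ext h.symm, fun h => by rw [h]⟩ rfl rfl
  have h2 : ∀ ν : Fin l, (Pi.single (i ν) (w.2 ν) : ι → ℝ) j.1 = 0 := fun ν => by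
    rw [Pi.single_apply, if_neg (j.2 ν)]
  simp [joinL, Finset.sum_apply, h1, h2]

theorem joinL_sel (hi : Function.Injective i) (w : (Rest i → ℝ) × (Fin l → ℝ)) (ν : Fin l) :
    joinL i w (i ν) = w.2 ν := by
  classical
  have h1 : ∀ j' : Rest i, (Pi.single j'.1 (w.1 j') : ι → ℝ) (i ν) = 0 := fun j' => by
    rw [Pi.single_apply, if_neg (j'.2 ν).symm]
  have h2 : ∀ μ : Fin l, (Pi.single (i μ) (w.2 μ) : ι → ℝ) (i ν) = if μ = ν then w.2 μ else 0 := by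
    intro μ
    rw [Pi.single_apply]
    exact if_congr ⟨fun h => (hi h).symm, fun h => by rw [h]⟩ rfl rfl
  simp [joinL, Finset.sum_apply, h1, h2]

theorem restL_joinL (w : (Rest i → ℝ) × (Fin l → ℝ)) : restL i (joinL i w) = w.1 :=
  funext fun j => joinL_rest w j

theorem selL_joinL (hi : Function.Injective i) (w : (Rest i → ℝ) × (Fin l → ℝ)) :
    selL i (joinL i w) = w.2 :=
  funext fun ν => joinL_sel hi w ν

theorem joinL_restL_selL (hi : Function.Injective i) (z : ι → ℝ) :
    joinL i (restL i z, selL i z) = z := by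
  funext j
  by_cases h : ∃ ν, j = i ν
  · obtain ⟨ν, rfl⟩ := h
    exact joinL_sel hi _ ν
  · push Not at h
    exact joinL_rest (restL i z, selL i z) ⟨j, h⟩

variable {φ : Idx → ℝ × (ι → ℝ) → ι → ℝ} {f : Idx → (Rest i → ℝ) → Fin l → ℝ}

theorem solvedForm_moderate (hf : Moderate (Regime.temp (Rest i → ℝ)) f) :
    Moderate (Regime.temp (ι → ℝ)) (fun ε z => selL i z - f ε (restL i z)) := by
  have h1 : Moderate (Regime.temp (ι → ℝ)) (fun _ z => restL i z) :=
    (slow_temp (restL i).hasTemperateGrowth).moderate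
  exact (slow_temp (selL i).hasTemperateGrowth).moderate.sub (hf.comp h1 (tame_temp h1 h1))

/-- At a point of the graph of `g`, vanishing of the right-hand side expresses tangency of `v` to
the graph. -/
theorem fderiv_solvedForm {g : (Rest i → ℝ) → Fin l → ℝ} (hg : ContDiff ℝ ∞ g) (z v : ι → ℝ) :
    fderiv ℝ (fun z => selL i z - g (restL i z)) z v =
      selL i v - fderiv ℝ g (restL i z) (restL i v) := by
  have h1 := ((hg.differentiable (by simp)).differentiableAt (x := restL i z)).hasFDerivAt.comp z
    (restL i).hasFDerivAt
  have h2 := ((selL i).hasFDerivAt (x := z)).sub h1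
  exact congrArg (fun T : (ι → ℝ) →L[ℝ] (Fin l → ℝ) => T v) h2.fderiv

theorem eval_cl_eq_zero {E F : Type} [NormedAddCommGroup E] [NormedSpace ℝ E]
    [NormedAddCommGroup F] [NormedSpace ℝ F] {u : Idx → E → F}
    (hu : Moderate (Regime.temp E) u) {x : Idx → E} (hx : x ∈ modPts E) :
    Gen.eval (cl u hu) (QuotientAddGroup.mk (⟨x, hx⟩ : modPts E)) = 0 ↔
      (fun ε => u ε (x ε)) ∈ neglPts F := by
  have h1 := hu.eval_mem hx
  change (QuotientAddGroup.mk (⟨_, h1⟩ : modPts F) : Pt F) = 0 ↔ _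
  rw [QuotientAddGroup.eq_zero_iff, AddSubgroup.mem_addSubgroupOf]

/-- If the system `z_{i_ν} = f_ν(z')` is invariant under the generator of a generalized group
action and the reduced system possesses a flow, then it is invariant under the action. -/
theorem solvedForm_invariant (hφ : Moderate (Regime.mix ℝ (ι → ℝ)) φ) (hG : GroupLaw φ)
    (hcomplete : IsGComplete (generator (cl φ hφ))) (hi : Function.Injective i)
    (hf : Moderate (Regime.temp (Rest i → ℝ)) f)
    (hflow : HasFlow (reducedField i (cl f hf) (generator (cl φ hφ))))
    (hinv : ∀ z : Pt (ι → ℝ), Gen.eval (solvedForm i (cl f hf)) z = 0 →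
      Gen.eval (applyField (generator (cl φ hφ)) (solvedForm i (cl f hf))) z = 0)
    {z : Idx → ι → ℝ} (hz : z ∈ modPts (ι → ℝ))
    (hΔ : (fun ε => selL i (z ε) - f ε (restL i (z ε))) ∈ neglPts (Fin l → ℝ)) {t : Idx → ℝ}
    (ht : t ∈ cptPts ℝ) :
    (fun ε => selL i (φ ε (t ε, z ε)) - f ε (restL i (φ ε (t ε, z ε)))) ∈
      neglPts (Fin l → ℝ) := by
  have hζ : Moderate (Regime.temp (ι → ℝ)) (fun ε z => fderiv ℝ (φ ε) (0, z) (1, 0)) :=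
    (hφ.fderiv.clm (ContinuousLinearMap.apply ℝ (ι → ℝ) ((1, 0) : ℝ × (ι → ℝ)))).slice
      zero_mem_cptPts
  have hgen : generator (cl φ hφ) = cl (fun ε z => fderiv ℝ (φ ε) (0, z) (1, 0)) hζ := rfl
  rw [hgen] at hcomplete hflow hinv
  set ζ : Idx → (ι → ℝ) → ι → ℝ := fun ε z => fderiv ℝ (φ ε) (0, z) (1, 0) with hζdef
  obtain ⟨H, hH0, hH⟩ := hflow
  obtain ⟨χ, hχ, rfl⟩ := exists_cl H
  have hz' : (fun ε => restL i (z ε)) ∈ modPts (Rest i → ℝ) := modPts_clm (restL i) hz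
  have hχ0 : Negl (Regime.temp (Rest i → ℝ)) ((fun _ a => a) - fun ε a => χ ε (0, a)) :=
    cl_eq_cl.1 hH0
  have hχd : Negl (Regime.mix ℝ (Rest i → ℝ))
      ((fun ε w => restL i (ζ ε (joinL i (χ ε w, f ε (χ ε w))))) -
        fun ε w => fderiv ℝ (χ ε) w (1, 0)) := cl_eq_cl.1 hH
  have hχc := hχ.curve_zero hz'
  have hfχ : Moderate (Regime.loc ℝ) (fun ε s => f ε (χ ε (s, restL i (z ε)))) :=
    hf.comp hχc (tame_temp hχc hχc)
  -- The reduced flow through `z'`, lifted to the graph of `f`.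
  let c2 : Idx → ℝ → ι → ℝ := fun ε s =>
    joinL i (χ ε (s, restL i (z ε)), f ε (χ ε (s, restL i (z ε))))
  have hc2 : Moderate (Regime.loc ℝ) c2 := (hχc.prodMk hfχ).clm (joinL i)
  -- The orbit of `z` under the action.
  let c1 : Idx → ℝ → ι → ℝ := fun ε s => φ ε (s, z ε)
  have hc1 : Moderate (Regime.loc ℝ) c1 := hφ.curve_zero hz
  have ode1 : Gen.lineD (1 : ℝ) (cl c1 hc1) = Gen.comp (cl ζ hζ) (cl c1 hc1) :=
    lineD_eq_comp hζ hc1 (fun ε t => hasDerivAt_curve (hφ.smooth ε) t (z ε))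
      fun t ht => hG.hasDeriv hφ hz ht
  -- The lift lies on the graph exactly, for every `ε`, so its points are admissible in the
  -- invariance hypothesis.
  have hΔc2 : ∀ ε s, selL i (c2 ε s) - f ε (restL i (c2 ε s)) = 0 := fun ε s => by
    rw [selL_joinL hi, restL_joinL, sub_self]
  have ode2 : Gen.lineD (1 : ℝ) (cl c2 hc2) = Gen.comp (cl ζ hζ) (cl c2 hc2) := by
    refine lineD_eq_comp hζ hc2 (c' := fun ε s =>
      joinL i (fderiv ℝ (χ ε) (s, restL i (z ε)) (1, 0),
        fderiv ℝ (f ε) (χ ε (s, restL i (z ε)))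
          (fderiv ℝ (χ ε) (s, restL i (z ε)) (1, 0)))) (fun ε s => ?_) fun s hs => ?_
    · have h1 := hasDerivAt_curve (hχ.smooth ε) s (restL i (z ε))
      have h2 := (((hf.smooth ε).differentiable (by simp)).differentiableAt
        (x := χ ε (s, restL i (z ε)))).hasFDerivAt.comp_hasDerivAt s h1
      exact (joinL i).hasFDerivAt.comp_hasDerivAt s (h1.prodMk h2)
    -- The flow equation of the reduced system gives the remaining components of the velocity; the
    -- selected ones follow from `e2` and the tangency relation `e4`.
    · have e1 : PtEq (fun ε => fderiv ℝ (χ ε) (s ε, restL i (z ε)) (1, 0))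
          (fun ε => restL i (ζ ε (c2 ε (s ε)))) := PtEq.symm (hχd.mix_eval_mem hs hz')
      have hχs := hχ.mix_eval_mem hs hz'
      have hc2s : (fun ε => c2 ε (s ε)) ∈ modPts (ι → ℝ) :=
        modPts_clm (joinL i) (modPts_prod hχs (hf.eval_mem hχs))
      have e2 := ptEq_apply (hf.fderiv.eval_mem hχs) e1
      have h0 : (fun ε => selL i (c2 ε (s ε)) - f ε (restL i (c2 ε (s ε)))) ∈
          neglPts (Fin l → ℝ) := by
        simp only [hΔc2]
        exact (neglPts _).zero_mem
      have e3 := hinv _ ((eval_cl_eq_zero (solvedForm_moderate hf) hc2s).2 h0)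
      have hap : Moderate (Regime.temp (ι → ℝ)) (fun ε w =>
          fderiv ℝ (fun z => selL i z - f ε (restL i z)) w (ζ ε w)) :=
        Moderate.bilin (ContinuousLinearMap.id ℝ ((ι → ℝ) →L[ℝ] (Fin l → ℝ)))
          (solvedForm_moderate hf).fderiv hζ
      have e4 := (eval_cl_eq_zero hap hc2s).1 e3
      have e5 : ∀ ε, fderiv ℝ (fun z => selL i z - f ε (restL i z)) (c2 ε (s ε))
          (ζ ε (c2 ε (s ε))) = selL i (ζ ε (c2 ε (s ε))) -
            fderiv ℝ (f ε) (χ ε (s ε, restL i (z ε))) (restL i (ζ ε (c2 ε (s ε)))) := fun ε => by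
        rw [fderiv_solvedForm (hf.smooth ε), restL_joinL]
      simp only [e5] at e4
      -- Reassembling the two groups of components gives the field at the lifted point.
      have e6 := (e1.prod (e2.trans (PtEq.symm e4))).clm (joinL i)
      simp only [joinL_restL_selL hi] at e6
      exact e6
  have init1 : Gen.evalAt 0 (cl c1 hc1) = QuotientAddGroup.mk (⟨z, hz⟩ : modPts (ι → ℝ)) :=
    Quotient.sound (ptRel_iff.2 (PtEq.symm (hG.zero z hz)))
  -- The lift starts at `(z', f(z'))`, which represents the same generalized point as `z` because
  -- `Δ` vanishes there.
  have init2 : Gen.evalAt 0 (cl c2 hc2) = QuotientAddGroup.mk (⟨z, hz⟩ : modPts (ι → ℝ)) := by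
    refine Quotient.sound (ptRel_iff.2 ?_)
    have e1 : PtEq (fun ε => χ ε (0, restL i (z ε))) (fun ε => restL i (z ε)) :=
      PtEq.symm (hχ0.eval_mem hz')
    have e2 := hf.eval_congr (hχ.mix_eval_mem zero_mem_cptPts hz') e1
    have e3 := (e1.prod (e2.trans (PtEq.symm hΔ))).clm (joinL i)
    simp only [joinL_restL_selL hi] at e3
    exact e3.symm
  have heq := (hcomplete 0 (QuotientAddGroup.mk (⟨z, hz⟩ : modPts (ι → ℝ)))).unique
    ⟨ode2, init2⟩ ⟨ode1, init1⟩
  -- Equality in `𝒢(ℝ)` carries over to compactly supported generalized times.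
  have hpt : PtEq (fun ε => c1 ε (t ε)) (fun ε => c2 ε (t ε)) := (cl_eq_cl.1 heq).eval_cpt ht
  have hfin := (solvedForm_moderate hf).eval_congr (hφ.mix_eval_mem ht hz) hpt
  simp only [hΔc2] at hfin
  exact ptEq_zero.1 hfin

end solved

/-! ### From invariance on the jet space to symmetries. -/

section symmetry
variable {p q n l : ℕ}

/-- At a generalized point `y`, the jet of `Φ_η(U)` is the image under `pr Φ_η` of the jet of `U` at
`Ξ_{-η}(y)`. The latter jet satisfies the system, and `solvedForm_invariant` keeps its image in the
zero set. -/
theorem isSymmetryGroup_of_invariant {Ξ : Mix ℝ (Fin p → ℝ) (Fin p → ℝ)}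
    {Ψ : Mix ℝ ((Fin p → ℝ) × (Fin q → ℝ)) (Fin q → ℝ)}
    (hΦ : IsGroupAction (projectable Ξ Ψ))
    (hprX : IsGComplete (generator (prolong n Ξ Ψ)))
    {i : Fin l → JIdx p q n} (hi : Function.Injective i)
    {f : Temp (Rest i → ℝ) (Fin l → ℝ)}
    (hflow : HasFlow (reducedField i f (generator (prolong n Ξ Ψ))))
    (hinv : ∀ z : Pt (Jet p q n), Gen.eval (solvedForm i f) z = 0 →
      Gen.eval (applyField (generator (prolong n Ξ Ψ)) (solvedForm i f)) z = 0) :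
    IsSymmetryGroup Ξ Ψ (solvedForm i f) := by
  obtain ⟨ξ, hξ, rfl⟩ := exists_cl Ξ
  obtain ⟨ψ, hψ, rfl⟩ := exists_cl Ψ
  obtain ⟨f, hf, rfl⟩ := exists_cl f
  obtain ⟨hproj, e1⟩ := projectable_cl hξ hψ
  obtain ⟨hpr, e2⟩ := prolong_cl n hξ hψ
  rw [e1] at hΦ
  rw [e2] at hprX hflow hinv
  have hG : GroupLaw fun ε => projFn (ξ ε) (ψ ε) := hΦ.groupLaw
  have hGpr := prolongFn_groupLaw hξ hψ hG n
  intro U hU η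
  obtain ⟨v, hv, rfl⟩ := exists_cl U
  obtain ⟨⟨t, ht⟩, rfl⟩ := QuotientAddGroup.mk_surjective η
  have hA := actFn_moderate hξ hψ ht hv
  have hact : act (cl ξ hξ) (cl ψ hψ) (QuotientAddGroup.mk (⟨t, ht⟩ : cptPts ℝ)) (cl v hv) =
      cl (fun ε => actFn (ξ ε) (ψ ε) (t ε) (v ε)) hA := rfl
  have hΔ := solvedForm_moderate hf
  have hcomp : ∀ {w : Idx → (Fin p → ℝ) → Fin q → ℝ} (hw : Moderate (Regime.temp (Fin p → ℝ)) w),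
      IsSolution (solvedForm i (cl f hf)) (cl w hw) ↔ Negl (Regime.temp (Fin p → ℝ))
        (fun ε x => selL i (jetFn n (w ε) x) - f ε (restL i (jetFn n (w ε) x))) := by
    intro w hw
    have hj := jetFn_moderate n hw
    have h1 : Moderate (Regime.temp (Fin p → ℝ))
        (fun ε x => selL i (jetFn n (w ε) x) - f ε (restL i (jetFn n (w ε) x))) :=
      hΔ.comp hj (tame_temp hj hj)
    unfold IsSolution
    rw [jet_cl]
    change (QuotientAddGroup.mk (⟨_, h1⟩ : modNets _ _) : Temp (Fin p → ℝ) (Fin l → ℝ)) = 0 ↔ _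
    rw [QuotientAddGroup.eq_zero_iff, AddSubgroup.mem_addSubgroupOf]
    rfl
  rw [hcomp] at hU
  rw [hact, hcomp]
  have hjA := jetFn_moderate n hA
  refine Moderate.negl_of_points (hΔ.comp hjA (tame_temp hjA hjA)) fun y hy => ?_
  have hx := hξ.mix_eval_mem (neg_mem_cptPts ht) hy
  have hj := (jetFn_moderate n hv).eval_mem hx
  have h1 := solvedForm_invariant hpr hGpr hprX hi hf hflow hinv hj (hU.eval_mem hx) ht
  have h2 := prolongFn_jetFn hξ hψ hG n ht hv hx
  -- The prolongation yields the jet at `Ξ_η(Ξ_{-η}(y))`, which is the same generalized point as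
  -- `y`.
  have h3 := hjA.eval_congr (hξ.mix_eval_mem ht hx) (hG.base.neg_right ht hy)
  have h4 := hΔ.eval_congr (hpr.mix_eval_mem ht hj) (h2.trans h3)
  exact ptEq_zero.1 (h4.symm.trans (ptEq_zero.2 h1))

end symmetry

end GenFun
end
theorem theorem4p16 (p q n l : ℕ)
    (Φ : Mix ℝ ((Fin p → ℝ) × (Fin q → ℝ)) ((Fin p → ℝ) × (Fin q → ℝ)))
    (Ξ : Mix ℝ (Fin p → ℝ) (Fin p → ℝ))
    (Ψ : Mix ℝ ((Fin p → ℝ) × (Fin q → ℝ)) (Fin q → ℝ))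
    (hproj : Φ = projectable Ξ Ψ)
    (hΦ : IsGroupAction Φ)
    (hX : IsGComplete (generator Φ))
    (hprX : IsGComplete (generator (prolong n Ξ Ψ)))
    (Δ : Temp (Jet p q n) (Fin l → ℝ))
    (i : Fin l → JIdx p q n) (hi : Function.Injective i)
    (f : Temp (Rest i → ℝ) (Fin l → ℝ))
    (hΔ : Δ = solvedForm i f)
    (hflow : HasFlow (reducedField i f (generator (prolong n Ξ Ψ))))
    (hinv : ∀ z : Pt (Jet p q n), Gen.eval Δ z = 0 →
      Gen.eval (applyField (generator (prolong n Ξ Ψ)) Δ) z = 0) :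
    IsSymmetryGroup Ξ Ψ Δ := by
  subst hproj hΔ
  exact isSymmetryGroup_of_invariant hΦ hprX hi hflow hinv
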